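/- Let $V$ be a real vector space of finite dimension $d$ with a lattice $\Lambda$ (a discrete subgroup spanning $V$), $L\subseteq V$ a rational subspace ($L\cap\Lambda$ spans $L$), $\Lambda_{V/L}$ the image of $\Lambda$ in $V/L$, and $\Lambda^*\subset V^*$ the dual lattice. A *rational cone* is a set $\{x:\langle\eta_j,x\rangle\le 0,\ j=1,\dots,N\}$ with $\eta_j\in\Lambda^*$, and a *semi-rational polyhedron* a set $\{x:\langle\eta_j,x\rangle\le b_j,\ j=1,\dots,N\}$ with $\eta_j\in\Lambda^*$, $b_j\in\mathbb R$. Let $\mathfrak c\subseteq V$ be a rational cone of full dimension $d$. *Generating functions.* $\mathcal M_\ell(V^*)$ is the ring of meromorphic functions near $0\in V^*_{\mathbb C}$ of the form $\phi(\xi)/\prod_{j=1}^N\langle\xi,w_j\rangle$ with $\phi$ holomorphic near $0$ and $0\neq w_j\in V$; $\phi_{[m]}$ is the coefficient of $\tau^m$ in the Laurent expansion of $\tau\mapsto\phi(\tau\xi)$ at $0$. $\mathcal R_{[m]}(V^*)$ is the space of rational functions $P(\xi)/\prod_{j=1}^N\langle\xi,w_j\rangle$ with $0\ne w_j\in V$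 and $P$ homogeneous of degree $m+N$. $S^L$ is the unique $\mathcal M_\ell(V^*)$-valued valuation on semi-rational polyhedra $\mathfrak p\subseteq V$ that vanishes when $\mathfrak p$ contains a line and satisfies $S^L(\mathfrak p)(\xi)=\sum_{y\in\Lambda_{V/L}}\int_{\mathfrak p\cap(y+L)}e^{\langle\xi,x\rangle}\,dx$ at those $\xi\in V^*$ where the sum converges ($dx$ being normalized by $L\cap\Lambda$). Put $I(\mathfrak p)=S^V(\mathfrak p)$ and $M^L(s,\mathfrak c)(\xi)=e^{-\langle\xi,s\rangle}S^L(s+\mathfrak c)(\xi)$ for $s\in V$. *The set $\Psi^L_{\mathfrak c}$.* Write $[E]$ for the indicator function of $E$. Choose a decomposition $[\mathfrak c]\equiv\sum_i\epsilon_i[\mathfrak c_i]$, $\epsilon_i=\pm1$, modulo the span of the indicator functions of rational cones containing lines, where each $\mathfrak c_i$ is a full-dimensional simplicial rational cone with a face parallel to $L$; and for each $i$ choose such a signed decomposition of the projection of $\mathfrak c_i$ to $V/L$ into full-dimensional cones $\mathfrak u$ that are unimodular with respect to $\Lambda_{V/L}$. Let $v^{\mathfrak u}_j$ be the primitive edge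 generators of $\mathfrak u$, let $\eta_j^{\mathfrak u}\in\Lambda^*\cap L^\perp$ be the dual basis, and let $\Psi^L_{\mathfrak c}$ be the set of all $-\eta_j^{\mathfrak u}$. *Step-polynomials.* Let $\{t\}\in[0,1)$ be the fractional part of $t$. $\mathcal Q^{\Psi}_{[\le k]}(V)$ is the space of functions of $s\in V$ spanned by products of at most $k$ functions $s\mapsto\{\langle\eta,s\rangle\}$, $\eta\in\Psi$ (so it is $0$ for $k<0$), and $\mathcal{QP}^{\Psi}_{[\le q]}(V)$ (quasi-polynomials of local degree at most $q$) is the span of the products of an element of $\mathcal Q^{\Psi}_{[\le k]}(V)$ and a homogeneous polynomial function of degree $r$ on $V$, with $k+r\le q$. **Theorem.** Decompositions as above exist, and for every choice of them the following holds. Let $m\in\mathbb Z$. (i) The function $(s,\xi)\mapsto M^L(s,\mathfrak c)_{[m]}(\xi)$ belongs to $\mathcal Q^{\Psi^L_{\mathfrak c}}_{[\le m+d]}(V)\otimes\mathcal R_{[m]}(V^*)$. (ii) The function $(s,\xi)\mapsto S^L(s+\mathfrak c)_{[m]}(\xi)$ belongs to $\mathcal{QP}^{\Psi^L_{\mathfrak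 c}}_{[\le m+d]}(V)\otimes\mathcal R_{[m]}(V^*)$. More precisely, $$S^L(s+\mathfrak c)_{[m]}(\xi)=\sum_{r=0}^{m+d}\frac{\langle\xi,s\rangle^r}{r!}\,M^L(s,\mathfrak c)_{[m-r]}(\xi).$$ (iii) The homogeneous component in $\xi$ of lowest degree has degree $-d$ and does not depend on $s$: for all $s\in V$, the components of $S^L(s+\mathfrak c)$ and of $M^L(s,\mathfrak c)$ of degree less than $-d$ vanish, and $$S^L(s+\mathfrak c)_{[-d]}(\xi)=M^L(s,\mathfrak c)_{[-d]}(\xi)=I(\mathfrak c)(\xi),$$ which is not zero if $\mathfrak c$ contains no line. -/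

import Mathlib

open Filter Topology MeasureTheory

noncomputable section

namespace ConeGF

/-! ### Lattices, polyhedra and cones -/

section Geometry

variable {W : Type*} [AddCommGroup W] [Module ℝ W]

/-- The dual lattice `Λ*`: linear forms that are integral on `Λ`. -/
def dualLattice (Λ : Submodule ℤ W) : Set (Module.Dual ℝ W) :=
  {η | ∀ v ∈ Λ, ∃ n : ℤ, η v = n}

/-- A subspace `L` is rational if `L ∩ Λ` is a lattice in `L`, that is, spans `L`. -/
def IsRationalSubspace (Λ : Submodule ℤ W) (L : Submodule ℝ W) : Prop :=
  Submodule.span ℝ ((L : Set W) ∩ (Λ : Set W)) = L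

/-- The projected lattice: the image of `Λ` in `W / L`. -/
def projectedLattice (Λ : Submodule ℤ W) (L : Submodule ℝ W) : Submodule ℤ (W ⧸ L) :=
  Λ.map (L.mkQ.restrictScalars ℤ)

/-- A semi-rational polyhedron: a finite intersection of half-spaces `⟨η, x⟩ ≤ b` with `η` in the
dual lattice (a rational form, up to scaling) and `b` an arbitrary real number. -/
def IsSemiRationalPolyhedron (Λ : Submodule ℤ W) (p : Set W) : Prop :=
  ∃ H : Set (Module.Dual ℝ W × ℝ), H.Finite ∧ (∀ h ∈ H, h.1 ∈ dualLattice Λ) ∧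
    p = {x | ∀ h ∈ H, h.1 x ≤ h.2}

/-- A rational (convex polyhedral) cone with vertex `0`. -/
def IsRationalCone (Λ : Submodule ℤ W) (c : Set W) : Prop :=
  ∃ H : Set (Module.Dual ℝ W), H.Finite ∧ (∀ η ∈ H, η ∈ dualLattice Λ) ∧
    c = {x | ∀ η ∈ H, η x ≤ 0}

/-- The set contains an affine line. -/
def ContainsLine (p : Set W) : Prop :=
  ∃ x v : W, v ≠ 0 ∧ ∀ t : ℝ, x + t • v ∈ p

/-- The cone generated by a finite family of vectors. -/
def coneHull {ι : Type*} [Fintype ι] (v : ι → W) : Set W :=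
  {x | ∃ t : ι → ℝ, (∀ i, 0 ≤ t i) ∧ x = ∑ i, t i • v i}

/-- The indicator function `[p]`. -/
def ind (p : Set W) : W → ℂ := p.indicator 1

/-- Congruence modulo the span of the indicator functions of rational cones containing lines. -/
def CongrModLines (Λ : Submodule ℤ W) (f g : W → ℂ) : Prop :=
  f - g ∈ Submodule.span ℂ {h : W → ℂ | ∃ k : Set W, IsRationalCone Λ k ∧ ContainsLine k ∧ h = ind k}

/-- The data from which `Ψ_c^L` is read off: a signed decomposition of `[c]`, modulo cones with
lines, into full-dimensional rational simplicial cones with a face parallel to `L`, and for each of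
them a signed decomposition of its projection to `W / L`, modulo cones with lines, into
full-dimensional cones that are unimodular for the projected lattice. -/
structure Decomposition (Λ : Submodule ℤ W) (L : Submodule ℝ W) (c : Set W) where
  /-- number of simplicial cones -/
  n : ℕ
  /-- their signs -/
  sign : Fin n → ℤˣ
  /-- their edge generators -/
  gen : Fin n → Module.Basis (Fin (Module.finrank ℝ W)) ℝ W
  gen_mem : ∀ i j, gen i j ∈ Λ
  /-- the edges spanning the face parallel to `L` -/
  face : Fin n → Set (Fin (Module.finrank ℝ W))
  span_face : ∀ i, Submodule.span ℝ (gen i '' face i) = L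
  congr : CongrModLines Λ (ind c) (∑ i, ((sign i : ℤ) : ℂ) • ind (coneHull (gen i)))
  /-- number of unimodular cones for each projected cone -/
  un : Fin n → ℕ
  /-- their signs -/
  usign : (i : Fin n) → Fin (un i) → ℤˣ
  /-- their primitive edge generators, a basis of the projected lattice -/
  ugen : (i : Fin n) → Fin (un i) → Module.Basis (Fin (Module.finrank ℝ (W ⧸ L))) ℝ (W ⧸ L)
  ugen_span : ∀ i a, Submodule.span ℤ (Set.range (ugen i a)) = projectedLattice Λ L
  ucongr : ∀ i, CongrModLines (projectedLattice Λ L) (ind (L.mkQ '' coneHull (gen i)))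
    (∑ a, ((usign i a : ℤ) : ℂ) • ind (coneHull (ugen i a)))

/-- The set `Ψ_c^L ⊆ Λ* ∩ L^⊥`: the opposites of the elements of the bases dual to the primitive
generators of the unimodular cones, regarded as linear forms on `W` that vanish on `L`. -/
def Decomposition.Psi {Λ : Submodule ℤ W} {L : Submodule ℝ W} {c : Set W}
    (D : Decomposition Λ L c) : Set (Module.Dual ℝ W) :=
  {ψ | ∃ i a j, ψ = -(((D.ugen i a).coord j).comp L.mkQ)}

/-! ### Step-polynomials and quasi-polynomials -/

/-- `𝒬^Ψ_{[≤ k]}`: the span of the products of at most `k` functions `s ↦ {⟨η, s⟩}`, `η ∈ Ψ`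
(the zero space if `k < 0`). -/
def stepPoly (Ψ : Set (Module.Dual ℝ W)) (k : ℤ) : Submodule ℝ (W → ℝ) :=
  Submodule.span ℝ {f | ∃ l : List (Module.Dual ℝ W), (∀ η ∈ l, η ∈ Ψ) ∧ (l.length : ℤ) ≤ k ∧
    f = fun s => (l.map fun η => Int.fract (η s)).prod}

/-- `𝒫_{[r]}(W)`: the homogeneous polynomial functions of degree `r` on `W`. -/
def homPoly (W : Type*) [AddCommGroup W] [Module ℝ W] (r : ℕ) : Submodule ℝ (W → ℝ) :=
  Submodule.span ℝ {f | ∃ l : List (Module.Dual ℝ W), l.length = r ∧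
    f = fun s => (l.map fun η => η s).prod}

/-- `𝒬𝒫^Ψ_{[≤ q]}`: the quasi-polynomials of local degree at most `q`, spanned by the products of an
element of `𝒬^Ψ_{[≤ k]}` and an element of `𝒫_{[r]}` with `k + r ≤ q`. -/
def quasiPoly (Ψ : Set (Module.Dual ℝ W)) (q : ℤ) : Submodule ℝ (W → ℝ) :=
  Submodule.span ℝ {f | ∃ (k : ℤ) (r : ℕ), k + r ≤ q ∧
    ∃ g ∈ stepPoly Ψ k, ∃ h ∈ homPoly W r, f = g * h}

end Geometry

/-! ### Meromorphic functions near `0` with hyperplane singularities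

`V →L[ℝ] ℂ` is the complexified dual space of `V`. -/

section Meromorphic

variable (V : Type*) [NormedAddCommGroup V] [NormedSpace ℝ V]

/-- The filter of sets containing, for some neighbourhood `U` of `0` and finitely many nonzero
vectors `w` in `V`, all the points of `U` outside of the hyperplanes `⟨ξ, w⟩ = 0`. -/
def generic : Filter (V →L[ℝ] ℂ) :=
  𝓝 0 ⊓ ⨅ w : {w : V // w ≠ 0}, 𝓟 {ξ | ξ (w : V) ≠ 0}

/-- Functions near `0` in the complexified dual, defined outside of finitely many real
hyperplanes. -/
abbrev GermV := Germ (generic V) ℂ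

variable {V}

/-- `ℳ_ℓ(V*)`: quotients of a function holomorphic near `0` by a finite product of nonzero linear
forms `ξ ↦ ⟨ξ, w⟩`, `w ∈ V`. -/
def merL : Set (GermV V) :=
  {F | ∃ (w : List V) (φ : (V →L[ℝ] ℂ) → ℂ), (∀ x ∈ w, x ≠ 0) ∧ AnalyticAt ℂ φ 0 ∧
    F = ((fun ξ => φ ξ / (w.map fun x => ξ x).prod : (V →L[ℝ] ℂ) → ℂ) : GermV V)}

/-- Homogeneous polynomial functions of degree `n` on the complexified dual. -/
def homPolyDual (V : Type*) [NormedAddCommGroup V] [NormedSpace ℝ V] (n : ℕ) :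
    Submodule ℂ ((V →L[ℝ] ℂ) → ℂ) :=
  Submodule.span ℂ {f | ∃ l : List V, l.length = n ∧ f = fun ξ => (l.map fun x => ξ x).prod}

/-- `ℛ_{[m]}(V*)`: the rational functions `P(ξ) / ∏_{j ≤ N} ⟨ξ, w_j⟩` with `w_j ∈ V` nonzero and `P`
homogeneous of degree `m + N`. -/
def ratHom (m : ℤ) : Submodule ℂ (GermV V) :=
  Submodule.span ℂ {F | ∃ (w : List V) (n : ℕ) (P : (V →L[ℝ] ℂ) → ℂ), (∀ x ∈ w, x ≠ 0) ∧
    (n : ℤ) = m + w.length ∧ P ∈ homPolyDual V n ∧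
    F = ((fun ξ => P ξ / (w.map fun x => ξ x).prod : (V →L[ℝ] ℂ) → ℂ) : GermV V)}

/-- `g(τ) = ∑_{m ≥ m₀} a_m τ^m` for all small `τ ≠ 0`. -/
def HasLaurentExpansion (g : ℂ → ℂ) (a : ℤ → ℂ) : Prop :=
  (∃ m₀ : ℤ, ∀ m < m₀, a m = 0) ∧ ∀ᶠ τ in 𝓝[≠] (0 : ℂ), HasSum (fun m : ℤ => τ ^ m * a m) (g τ)

open Classical in
/-- The coefficient of `τ^m` in the Laurent expansion of `g` at `0`. -/
def laurentCoeff (g : ℂ → ℂ) (m : ℤ) : ℂ :=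
  if h : ∃ a, HasLaurentExpansion g a then h.choose m else 0

theorem laurentCoeff_congr {f g : ℂ → ℂ} (h : f =ᶠ[𝓝[≠] (0 : ℂ)] g) (m : ℤ) :
    laurentCoeff f m = laurentCoeff g m := by
  have key : HasLaurentExpansion f = HasLaurentExpansion g := by
    funext a
    refine propext (and_congr_right fun _ => eventually_congr ?_)
    filter_upwards [h] with τ hτ
    rw [hτ]
  unfold laurentCoeff
  rw [key]

theorem generic_smul {U : Set (V →L[ℝ] ℂ)} (hU : U ∈ generic V) :
    ∀ᶠ ξ in generic V, ∀ᶠ τ in 𝓝[≠] (0 : ℂ), τ • ξ ∈ U := by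
  have hle : Filter.bind (generic V) (fun ξ => map (fun τ : ℂ => τ • ξ) (𝓝[≠] (0 : ℂ)))
      ≤ generic V := by
    refine le_inf ?_ (le_iInf fun w => ?_)
    · intro s hs
      rw [Filter.mem_bind']
      refine Eventually.of_forall fun ξ => ?_
      have : Tendsto (fun τ : ℂ => τ • ξ) (𝓝[≠] (0 : ℂ)) (𝓝 0) := by
        have h : Tendsto (fun τ : ℂ => τ • ξ) (𝓝 (0 : ℂ)) (𝓝 ((0 : ℂ) • ξ)) :=
          (continuous_id.smul continuous_const).tendsto 0
        have h0 : (0 : ℂ) • ξ = 0 := zero_smul ℂ ξ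
        rw [h0] at h
        exact h.mono_left nhdsWithin_le_nhds
      exact this hs
    · rw [le_principal_iff, Filter.mem_bind']
      have hw : {ξ : V →L[ℝ] ℂ | ξ (w : V) ≠ 0} ∈ generic V :=
        mem_inf_of_right (mem_iInf_of_mem w (mem_principal_self _))
      filter_upwards [hw] with ξ hξ
      rw [mem_map]
      filter_upwards [self_mem_nhdsWithin] with τ hτ
      simpa using ⟨hτ, hξ⟩
  have h := hle hU
  rw [Filter.mem_bind'] at h
  exact h

/-- The homogeneous component `φ_{[m]}`: the coefficient of `τ^m` in the Laurent expansion of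
`τ ↦ φ(τ ξ)`, as a function of `ξ`. -/
def homComp (m : ℤ) : GermV V → GermV V :=
  Germ.map' (fun (f : (V →L[ℝ] ℂ) → ℂ) ξ => laurentCoeff (fun τ => f (τ • ξ)) m) (by
    intro f g hfg
    filter_upwards [generic_smul hfg] with ξ hξ
    exact laurentCoeff_congr hξ m)

/-- The function `ξ ↦ e^{⟨ξ, s⟩}`. -/
def expGerm (s : V) : GermV V :=
  ((fun ξ => Complex.exp (ξ s) : (V →L[ℝ] ℂ) → ℂ) : GermV V)

/-- The linear form `ξ ↦ ⟨ξ, s⟩`. -/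
def linGerm (s : V) : GermV V :=
  ((fun ξ => ξ s : (V →L[ℝ] ℂ) → ℂ) : GermV V)

/-- `A ⊗ B` as a space of functions of `(s, ξ)`: the finite sums of functions
`(s, ξ) ↦ q(s) R(ξ)`, with `q ∈ A` and `R ∈ B`. -/
def tensorFun (A : Submodule ℝ (V → ℝ)) (B : Submodule ℂ (GermV V)) : Submodule ℂ (V → GermV V) :=
  Submodule.span ℂ {F | ∃ q ∈ A, ∃ R ∈ B, F = fun s => ((q s : ℝ) : ℂ) • R}

end Meromorphic

/-! ### Intermediate generating functions -/

section Intermediate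

variable {V : Type*} [NormedAddCommGroup V] [NormedSpace ℝ V] [FiniteDimensional ℝ V]
  [MeasurableSpace V] [BorelSpace V]

/-- The Lebesgue measure on `L` for which `L / (L ∩ Λ)` has measure `1`. -/
def latticeMeasure (Λ : Submodule ℤ V) (L : Submodule ℝ V) : Measure L :=
  ENNReal.ofReal (ZLattice.covolume (Λ.comap (L.subtype.restrictScalars ℤ)) Measure.addHaar)⁻¹ •
    Measure.addHaar

/-- The slice `p ∩ (y + L)`, for `y ∈ V / L`, translated to `L` by a representative of `y`. -/
def slice (L : Submodule ℝ V) (p : Set V) (y : V ⧸ L) : Set L :=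
  {u | Quotient.out y + (u : V) ∈ p}

/-- The integral of `e^{⟨η, x⟩}` over `p ∩ (y + L)`. -/
def sliceIntegral (Λ : Submodule ℤ V) (L : Submodule ℝ V) (p : Set V) (η : Module.Dual ℝ V)
    (y : V ⧸ L) : ℝ :=
  ∫ u in slice L p y, Real.exp (η (Quotient.out y + (u : V))) ∂(latticeMeasure Λ L)

/-- Convergence of `∑_{y ∈ Λ_{V/L}} ∫_{p ∩ (y + L)} e^{⟨η, x⟩} dx`. -/
def SumConverges (Λ : Submodule ℤ V) (L : Submodule ℝ V) (p : Set V) (η : Module.Dual ℝ V) : Prop :=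
  (∀ y ∈ projectedLattice Λ L,
    IntegrableOn (fun u : L => Real.exp (η (Quotient.out y + (u : V)))) (slice L p y)
      (latticeMeasure Λ L)) ∧
  Summable fun y : projectedLattice Λ L => sliceIntegral Λ L p η y

/-- `F` is the `ℳ_ℓ(V*)`-valued valuation on semi-rational polyhedra that vanishes on polyhedra
containing lines and is given by the sum of the integrals over slices, at every real `ξ` (near `0`,
outside of the singular hyperplanes) where this sum converges. -/
structure IsIntermediateValuation (Λ : Submodule ℤ V) (L : Submodule ℝ V)
    (F : Set V → GermV V) : Prop where
  mem : ∀ p, IsSemiRationalPolyhedron Λ p → F p ∈ merL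
  valuation : ∀ (n : ℕ) (p : Fin n → Set V) (r : Fin n → ℂ),
    (∀ i, IsSemiRationalPolyhedron Λ (p i)) → ∑ i, r i • ind (p i) = 0 → ∑ i, r i • F (p i) = 0
  line : ∀ p, IsSemiRationalPolyhedron Λ p → ContainsLine p → F p = 0
  eq_sum : ∀ p, IsSemiRationalPolyhedron Λ p →
    ∀ f : (V →L[ℝ] ℂ) → ℂ, (f : GermV V) = F p →
      ∀ᶠ ξ in generic V, ∀ η : Module.Dual ℝ V, (∀ x, ξ x = ((η x : ℝ) : ℂ)) →
        SumConverges Λ L p η →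
          f ξ = ((∑' y : projectedLattice Λ L, sliceIntegral Λ L p η y : ℝ) : ℂ)

open Classical in
/-- The intermediate generating function `S^L_Λ(p)`. -/
def intermediateGF (Λ : Submodule ℤ V) (L : Submodule ℝ V) (p : Set V) : GermV V :=
  if h : ∃ F, IsIntermediateValuation Λ L F then h.choose p else 0

/-- `S^L(s + c)`. -/
def S (Λ : Submodule ℤ V) (L : Submodule ℝ V) (c : Set V) (s : V) : GermV V :=
  intermediateGF Λ L ((fun x => s + x) '' c)

/-- `M^L(s, c)(ξ) = e^{-⟨ξ, s⟩} S^L(s + c)(ξ)`. -/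
def M (Λ : Submodule ℤ V) (L : Submodule ℝ V) (c : Set V) (s : V) : GermV V :=
  expGerm (-s) * S Λ L c s

/-- The continuous generating function `I(p)(ξ) = ∫_p e^{⟨ξ, x⟩} dx`, which is the case `L = V`. -/
def I (Λ : Submodule ℤ V) (p : Set V) : GermV V :=
  intermediateGF Λ ⊤ p

end Intermediate

end ConeGF

end

/-!
The sum over `y ∈ Λ_{V/L}` of the Lebesgue measures on the slices `y + L` is a measure `ν` on `V`,
`sliceMeasure`, which is finite on bounded sets and invariant under `Λ`, and
`∑_y ∫_{p ∩ (y + L)} e^{⟨ξ, x⟩} dx` is the transform `∫_p e^{⟨ξ, x⟩} dν(x)`.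

*The valuation.* The difference operator `f ↦ f - f(· - w)`, `w ∈ Λ`, multiplies the transform of `f`
by `1 - e^{⟨ξ, w⟩}`, and a suitable product of such operators makes the indicator of a semi-rational
polyhedron bounded with bounded support, and zero if the polyhedron contains a line
(`exists_isTame_diffList`). A function of the first kind has a holomorphic transform; dividing this
by the corresponding factors `1 - e^{⟨ξ, w⟩}` defines `S^L` (`exists_isIntermediateValuation`).
Conversely an element of `ℳ_ℓ(V*)` is determined by its values at the real points of an open cone
(`eq_of_mem_merL_of_neg`), so `S^L(p)` can be computed where the sum converges.

*Decompositions.* A linear relation between the normals of half-spaces gives a relation between the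
indicators of their intersections. Modulo cones with lines it says that a facet normal of a simplicial
cone can be exchanged for another integral form (`ind_dualCone_mem_of_update`). Exchanging normals
for forms that vanish on `L` leads to cones with a face parallel to `L`
(`ind_dualCone_mem_of_parallel`), and exchanging them for short forms leads to unimodular cones
(`ind_dualCone_mem_of_unimodular`). A unimodular cone in `V / L` is pulled back to a simplicial cone
in `V` with the prescribed face, so that a decomposition of both kinds writes `[c]`, modulo cones with
lines, as a signed sum of simplicial cones with a face parallel to `L` and unimodular projection
(`Decomposition.ind_congr`).

*One simplicial cone.* Let `k` be such a cone, with edges `f_i` in `L` and further edges `g_j` whose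
projections `v_j` form a basis of `Λ_{V/L}`. The difference operators along the edges cut `s + k` down
to a half-open box, whose projection is a fundamental domain of `Λ_{V/L}`. So the box meets exactly
one slice, that of `s + τ(s)` with `τ(s) = ∑ {-s_j} g_j`, where `s_j` are the coordinates of the class
of `s` in the basis `v_j` and `{t}` is the fractional part (`transform_box`). Hence
`S^L(s + k)(ξ) = e^{⟨ξ, s + τ(s)⟩} G(ξ)` with `G` independent of `s` (`intermediateGF_simplicial`).
The functions `s ↦ {-s_j}` are exactly the `{⟨ψ, s⟩}` with `ψ` in `Ψ`. Expanding `e^{⟨ξ, τ(s)⟩}` shows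
that the component of degree `m` of `M^L(s, c)` has degree at most `m + d` in them, because `G` starts
in degree `-d` (`Decomposition.exists_hasComps_M`), and expanding `e^{⟨ξ, s⟩}` as well gives the
components of `S^L(s + c)` (`homComp_S_eq_sum`).

*The lowest component.* The component of degree `-d` only involves the constant terms of the
exponentials, so it is the one of `G`, namely `κ (-1)^d / (∏ ⟨ξ, f_i⟩ ∏ ⟨ξ, g_j⟩)` with `κ` the volume
of the parallelepiped on the `f_i`. As the `v_j` form a basis of the projected lattice, `κ` is also
the volume of the parallelepiped on all the edges (`latticeMeasure_unitBox_top`), and the fraction is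
`I(k)` (`I_coneHull`). Finally `I(c) ≠ 0` if `c` contains no line: `c` then lies in a simplicial cone
(`exists_subset_coneHull`), and at the real `η` that are negative on its edges `I(c)` is the integral
of `e^{⟨η, x⟩}` over `c`, which is positive (`I_ne_zero`).
-/

set_option linter.unusedSectionVars false

noncomputable section

namespace ConeGF

/-! ### Laurent expansions and homogeneous components -/

section Laurent

theorem HasSum.congr_eq {ι : Type*} {f g : ι → ℂ} {a b : ℂ} (h : HasSum f a) (hf : ∀ n, g n = f n)
    (hab : b = a) : HasSum g b := by
  rwa [funext hf, hab]

/-- Laurent coefficients are unique, although the expansions may be indexed from different starting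
points. -/
theorem HasLaurentExpansion.unique {g : ℂ → ℂ} {a b : ℤ → ℂ} (ha : HasLaurentExpansion g a)
    (hb : HasLaurentExpansion g b) : a = b := by
  obtain ⟨⟨k, hk⟩, ha⟩ := ha
  obtain ⟨⟨l, hl⟩, hb⟩ := hb
  -- A common starting index, lowered by one so that both power series vanish at `0`.
  set n₀ : ℤ := min k l - 1 with hn₀
  have key : ∀ c : ℤ → ℂ, (∀ m ≤ n₀, c m = 0) →
      (∀ᶠ τ in 𝓝[≠] (0 : ℂ), HasSum (fun m : ℤ => τ ^ m * c m) (g τ)) →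
      HasFPowerSeriesAt (fun τ => if τ = 0 then 0 else τ ^ (-n₀) * g τ)
        (FormalMultilinearSeries.ofScalars ℂ fun n : ℕ => c (n + n₀)) 0 := by
    intro c hc h
    rw [hasFPowerSeriesAt_iff]
    rw [eventually_nhdsWithin_iff] at h
    filter_upwards [h] with τ hτ
    rw [zero_add]
    simp only [FormalMultilinearSeries.coeff_ofScalars, smul_eq_mul]
    by_cases h0 : τ = 0
    · subst h0
      rw [if_pos rfl]
      refine HasSum.congr_eq hasSum_zero (fun n => ?_) rfl
      rcases n with _ | n
      · simp [hc n₀ le_rfl]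
      · simp
    · rw [if_neg h0]
      have h1 := (hτ h0).mul_left (τ ^ (-n₀))
      have hinj : Function.Injective fun n : ℕ => (n : ℤ) + n₀ := fun x y hxy => by
        simpa using hxy
      rw [← hinj.hasSum_iff] at h1
      · refine HasSum.congr_eq h1 (fun n => ?_) rfl
        simp only [Function.comp]
        rw [← mul_assoc, ← zpow_add₀ h0]
        simp
      · intro m hm
        have : m ≤ n₀ := by
          by_contra hcon
          exact hm ⟨(m - n₀).toNat, by dsimp only; omega⟩
        rw [hc m this, mul_zero, mul_zero]
  have h1 := key a (fun m hm => hk m (by omega)) ha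
  have h2 := key b (fun m hm => hl m (by omega)) hb
  have h3 := h1.eq_formalMultilinearSeries h2
  funext m
  by_cases hm : m ≤ n₀
  · rw [hk m (by omega), hl m (by omega)]
  · have h4 := congrArg (fun p => FormalMultilinearSeries.coeff p (m - n₀).toNat) h3
    simp only [FormalMultilinearSeries.coeff_ofScalars] at h4
    rwa [show ((m - n₀).toNat : ℤ) + n₀ = m by omega] at h4

theorem HasLaurentExpansion.laurentCoeff_eq {g : ℂ → ℂ} {a : ℤ → ℂ} (ha : HasLaurentExpansion g a)
    (m : ℤ) : laurentCoeff g m = a m := by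
  have h : ∃ a, HasLaurentExpansion g a := ⟨a, ha⟩
  rw [laurentCoeff, dif_pos h, h.choose_spec.unique ha]

/-- A power series expansion of `τ ^ N * g τ` gives the Laurent coefficients of `g`. -/
theorem laurentCoeff_eq_of_hasSum {g : ℂ → ℂ} {N : ℕ} {c : ℕ → ℂ}
    (h : ∀ᶠ τ in 𝓝[≠] (0 : ℂ), HasSum (fun n : ℕ => τ ^ n * c n) (τ ^ N * g τ)) (m : ℤ) :
    laurentCoeff g m = if 0 ≤ m + N then c (m + N).toNat else 0 := by
  refine HasLaurentExpansion.laurentCoeff_eq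
    (a := fun m => if 0 ≤ m + N then c (m + N).toNat else 0) ⟨⟨-N, fun m hm => ?_⟩, ?_⟩ m
  · exact if_neg (by omega)
  · filter_upwards [h, self_mem_nhdsWithin] with τ hτ h0
    replace h0 : τ ≠ 0 := h0
    have hinj : Function.Injective fun n : ℕ => (n : ℤ) - N := fun x y hxy => by
      simpa using hxy
    rw [← hinj.hasSum_iff]
    · have := hτ.mul_left (τ ^ (-N : ℤ))
      refine HasSum.congr_eq this (fun n => ?_) ?_
      · simp only [Function.comp]
        rw [if_pos (by omega), ← mul_assoc, ← zpow_natCast, ← zpow_add₀ h0]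
        congr 2
        · ring
        · omega
      · rw [← mul_assoc, ← zpow_natCast τ N, ← zpow_add₀ h0]; simp
    · intro m hm
      rw [if_neg, mul_zero]
      intro hcon
      exact hm ⟨(m + N).toNat, by dsimp only; omega⟩

end Laurent

/-! ### Germs and their homogeneous components -/

section Components

variable {V : Type*} [NormedAddCommGroup V] [NormedSpace ℝ V]

theorem generic_le_nhds : generic V ≤ 𝓝 0 := inf_le_left

theorem eventually_generic_ne {w : V} (hw : w ≠ 0) : ∀ᶠ ξ in generic V, ξ w ≠ 0 :=
  mem_inf_of_right (mem_iInf_of_mem (⟨w, hw⟩ : {w : V // w ≠ 0}) (mem_principal_self _))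

theorem eventually_generic_prod_ne {l : List V} (hl : ∀ x ∈ l, x ≠ 0) :
    ∀ᶠ ξ in generic V, (l.map fun x => ξ x).prod ≠ 0 := by
  induction l with
  | nil => simp
  | cons a l ih =>
    filter_upwards [eventually_generic_ne (hl a (by simp)), ih fun x hx => hl x (by simp [hx])]
      with ξ h1 h2
    simpa using ⟨h1, by simpa using h2⟩

/-- `F` is a germ all of whose homogeneous components have degree at least `-N`, the one of degree
`n - N` being `A n`: for generic `ξ`, the function `τ ↦ τ ^ N F(τ ξ)` is the sum of the power series
with coefficients `A n`. Clearing the pole lets the components be indexed by natural numbers. -/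
def HasComps (N : ℕ) (F : GermV V) (A : ℕ → GermV V) : Prop :=
  ∃ (f : (V →L[ℝ] ℂ) → ℂ) (a : ℕ → (V →L[ℝ] ℂ) → ℂ), F = (f : GermV V) ∧
    (∀ n, A n = (a n : GermV V)) ∧
    ∀ᶠ ξ in generic V, ∀ᶠ τ in 𝓝[≠] (0 : ℂ),
      HasSum (fun n : ℕ => τ ^ n * a n ξ) (τ ^ N * f (τ • ξ))

theorem HasComps.homComp_eq {N : ℕ} {F : GermV V} {A : ℕ → GermV V} (h : HasComps N F A) (m : ℤ) :
    homComp m F = if 0 ≤ m + N then A (m + N).toNat else 0 := by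
  obtain ⟨f, a, rfl, hA, h⟩ := h
  have : (if 0 ≤ m + N then A (m + N).toNat else 0) =
      ((fun ξ => if 0 ≤ m + N then a (m + N).toNat ξ else 0 : (V →L[ℝ] ℂ) → ℂ) : GermV V) := by
    split_ifs
    · exact hA _
    · rfl
  rw [this]
  refine Germ.coe_eq.2 ?_
  filter_upwards [h] with ξ hξ
  exact laurentCoeff_eq_of_hasSum hξ m

theorem HasComps.add {N : ℕ} {F G : GermV V} {A B : ℕ → GermV V} (hF : HasComps N F A)
    (hG : HasComps N G B) : HasComps N (F + G) (fun n => A n + B n) := by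
  obtain ⟨f, a, rfl, hA, hf⟩ := hF
  obtain ⟨g, b, rfl, hB, hg⟩ := hG
  refine ⟨f + g, fun n => a n + b n, rfl, fun n => by simp only [hA, hB]; rfl, ?_⟩
  filter_upwards [hf, hg] with ξ h1 h2
  filter_upwards [h1, h2] with τ h1 h2
  simpa only [Pi.add_apply, mul_add] using h1.add h2

theorem HasComps.smul {N : ℕ} {F : GermV V} {A : ℕ → GermV V} (hF : HasComps N F A) (c : ℂ) :
    HasComps N (c • F) (fun n => c • A n) := by
  obtain ⟨f, a, rfl, hA, hf⟩ := hF
  refine ⟨c • f, fun n => c • a n, rfl, fun n => by simp only [hA]; rfl, ?_⟩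
  filter_upwards [hf] with ξ h1
  filter_upwards [h1] with τ h1
  refine HasSum.congr_eq (h1.mul_left c) (fun n => ?_) ?_
  · simp only [Pi.smul_apply, smul_eq_mul]; ring
  · simp only [Pi.smul_apply, smul_eq_mul]; ring

theorem hasComps_zero (N : ℕ) : HasComps N (0 : GermV V) (fun _ => 0) := by
  refine ⟨0, fun _ => 0, rfl, fun n => rfl, ?_⟩
  simp [hasSum_zero]

theorem HasComps.sum {ι : Type*} (s : Finset ι) {N : ℕ} {F : ι → GermV V} {A : ι → ℕ → GermV V}
    (h : ∀ i ∈ s, HasComps N (F i) (A i)) :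
    HasComps N (∑ i ∈ s, F i) (fun n => ∑ i ∈ s, A i n) := by
  classical
  induction s using Finset.induction_on with
  | empty => simpa using hasComps_zero N
  | insert i s hi ih =>
    simp only [Finset.sum_insert hi]
    exact (h i (by simp)).add (ih fun j hj => h j (by simp [hj]))

/-- Multiplication by `e^{⟨ξ, x⟩}` is a Cauchy product with `∑ ⟨ξ, x⟩ ^ r / r!`. -/
theorem HasComps.expGerm_mul {N : ℕ} {F : GermV V} {A : ℕ → GermV V} (hF : HasComps N F A) (x : V) :
    HasComps N (expGerm x * F)
      (fun n => ∑ r ∈ Finset.range (n + 1), ((r.factorial : ℂ)⁻¹ • linGerm x ^ r) * A (n - r)) := by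
  obtain ⟨f, a, rfl, hA, hf⟩ := hF
  refine ⟨fun ξ => Complex.exp (ξ x) * f ξ,
    fun n => ∑ r ∈ Finset.range (n + 1),
      (fun ξ => ((r.factorial : ℂ)⁻¹ * (ξ x) ^ r) * a (n - r) ξ), rfl, fun n => ?_, ?_⟩
  · rw [show (((∑ r ∈ Finset.range (n + 1), fun ξ => ((r.factorial : ℂ)⁻¹ * (ξ x) ^ r) * a (n - r) ξ :
      (V →L[ℝ] ℂ) → ℂ)) : GermV V) = ∑ r ∈ Finset.range (n + 1),
        ((fun ξ => ((r.factorial : ℂ)⁻¹ * (ξ x) ^ r) * a (n - r) ξ : (V →L[ℝ] ℂ) → ℂ) : GermV V)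
      from map_sum (Germ.coeAddHom (generic V)) _ _]
    refine Finset.sum_congr rfl fun r _ => ?_
    rw [hA]; rfl
  · filter_upwards [hf] with ξ h1
    filter_upwards [h1] with τ h1
    have h2 : HasSum (fun n : ℕ => (τ * ξ x) ^ n / n.factorial) (Complex.exp (τ * ξ x)) := by
      rw [Complex.exp_eq_exp_ℂ]; exact NormedSpace.expSeries_div_hasSum_exp _
    have h3 := tsum_mul_tsum_eq_tsum_sum_range_of_summable_norm h2.summable.norm h1.summable.norm
    have h4 := (summable_norm_sum_mul_range_of_summable_norm h2.summable.norm
      h1.summable.norm).of_norm.hasSum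
    rw [← h3, h2.tsum_eq, h1.tsum_eq] at h4
    refine HasSum.congr_eq h4 (fun n => ?_) ?_
    · rw [Finset.sum_apply, Finset.mul_sum]
      refine Finset.sum_congr rfl fun r hr => ?_
      have : τ ^ n = τ ^ r * τ ^ (n - r) := by
        rw [← pow_add]; congr 1; have := Finset.mem_range.1 hr; omega
      rw [this]; ring
    · rw [show (τ • ξ) x = τ * ξ x from rfl]; ring

/-- The value of a homogeneous polynomial map at `ξ` is a polynomial in the `⟨ξ, e_i⟩`. -/
theorem multilinear_diag_mem_homPolyDual [FiniteDimensional ℝ V] (n : ℕ)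
    (p : MultilinearMap ℂ (fun _ : Fin n => V →L[ℝ] ℂ) ℂ) :
    (fun ξ => p fun _ => ξ) ∈ homPolyDual V n := by
  classical
  let e := Module.finBasis ℝ V
  let ε : Fin (Module.finrank ℝ V) → (V →L[ℝ] ℂ) := fun i =>
    Complex.ofRealCLM.comp (e.coord i).toContinuousLinearMap
  have hξ : ∀ ξ : V →L[ℝ] ℂ, ξ = ∑ i, ξ (e i) • ε i := by
    intro ξ
    ext x
    conv_lhs => rw [← e.sum_repr x]
    simp only [map_sum, ContinuousLinearMap.map_smul, _root_.sum_apply]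
    refine Finset.sum_congr rfl fun i _ => ?_
    simp [ε, mul_comm]
  have : (fun ξ : V →L[ℝ] ℂ => p fun _ => ξ) = ∑ r : Fin n → Fin (Module.finrank ℝ V),
      (p fun k => ε (r k)) • fun ξ : V →L[ℝ] ℂ => ((List.ofFn fun k => e (r k)).map fun x => ξ x).prod := by
    funext ξ
    have h1 : p (fun _ => ξ) = p fun _ : Fin n => ∑ i, ξ (e i) • ε i := by
      congr 1; funext _; exact hξ ξ
    rw [h1, MultilinearMap.map_sum, Finset.sum_apply]
    refine Finset.sum_congr rfl fun r _ => ?_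
    rw [MultilinearMap.map_smul_univ]
    simp [List.prod_ofFn, mul_comm]
  rw [this]
  exact Submodule.sum_mem _ fun r _ => Submodule.smul_mem _ _
    (Submodule.subset_span ⟨_, by simp, rfl⟩)

/-- The expansion of a holomorphic function along the complex line through `ξ`. -/
theorem hasSum_analyticAt_smul {φ : (V →L[ℝ] ℂ) → ℂ}
    {p : FormalMultilinearSeries ℂ (V →L[ℝ] ℂ) ℂ} (hp : HasFPowerSeriesAt φ p 0) (ξ : V →L[ℝ] ℂ) :
    ∀ᶠ τ in 𝓝 (0 : ℂ), HasSum (fun n : ℕ => τ ^ n * p n fun _ => ξ) (φ (τ • ξ)) := by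
  have ht : Tendsto (fun τ : ℂ => τ • ξ) (𝓝 (0 : ℂ)) (𝓝 0) := by
    have h : Tendsto (fun τ : ℂ => τ • ξ) (𝓝 (0 : ℂ)) (𝓝 ((0 : ℂ) • ξ)) :=
      (continuous_id.smul continuous_const).tendsto 0
    rwa [show (0 : ℂ) • ξ = 0 from zero_smul ℂ ξ] at h
  filter_upwards [ht.eventually hp.eventually_hasSum] with τ hτ
  rw [zero_add] at hτ
  refine HasSum.congr_eq hτ (fun n => ?_) rfl
  rw [(p n).map_smul_univ (fun _ => τ) (fun _ => ξ)]
  simp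

/-- A quotient of a holomorphic function by `N` linear forms has components of degree at least
`-N`, that of degree `-N` being the value of the numerator at `0` over the denominator. -/
theorem exists_hasComps [FiniteDimensional ℝ V] {w : List V} (hw : ∀ x ∈ w, x ≠ 0)
    {φ : (V →L[ℝ] ℂ) → ℂ} (hφ : AnalyticAt ℂ φ 0) :
    ∃ A : ℕ → GermV V, (∀ n : ℕ, A n ∈ ratHom ((n : ℤ) - w.length)) ∧
      HasComps w.length ((fun ξ => φ ξ / (w.map fun x => ξ x).prod : (V →L[ℝ] ℂ) → ℂ) : GermV V) A ∧
      A 0 = ((fun ξ => φ 0 / (w.map fun x => ξ x).prod : (V →L[ℝ] ℂ) → ℂ) : GermV V) := by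
  obtain ⟨p, hp⟩ := hφ
  refine ⟨fun n => ((fun ξ => (p n fun _ => ξ) / (w.map fun x => ξ x).prod : (V →L[ℝ] ℂ) → ℂ) :
    GermV V), fun n => ?_, ⟨_, _, rfl, fun n => rfl, ?_⟩, ?_⟩
  · exact Submodule.subset_span ⟨w, n, _, hw, by ring,
      multilinear_diag_mem_homPolyDual n (p n).toMultilinearMap, rfl⟩
  · filter_upwards [eventually_generic_prod_ne hw] with ξ hξ
    filter_upwards [(hasSum_analyticAt_smul hp ξ).filter_mono nhdsWithin_le_nhds,
      self_mem_nhdsWithin] with τ hτ h0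
    replace h0 : τ ≠ 0 := h0
    have hmap : (w.map fun x => (τ • ξ) x).prod = τ ^ w.length * (w.map fun x => ξ x).prod := by
      have : (fun x => (τ • ξ) x) = fun x => τ * ξ x := rfl
      rw [this, List.prod_map_mul]; simp
    refine HasSum.congr_eq (hτ.mul_right ((w.map fun x => ξ x).prod)⁻¹) (fun n => ?_) ?_
    · ring
    · rw [hmap]; field_simp
  · have h0 := hp.coeff_zero
    refine congrArg _ (funext fun ξ => ?_)
    rw [← h0 fun _ => ξ]

end Components

/-! ### Germs are determined by their values on a real cone -/

section Identity

variable {V : Type*} [NormedAddCommGroup V] [NormedSpace ℝ V]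

/-- A set of the generic filter contains, near `0`, the complement of the zero set of a finite product
of nonzero linear forms. -/
theorem exists_list_of_mem_generic {U : Set (V →L[ℝ] ℂ)} (hU : U ∈ generic V) :
    ∃ l : List V, (∀ x ∈ l, x ≠ 0) ∧ ∀ᶠ ξ in 𝓝 0, (l.map fun x => ξ x).prod ≠ 0 → ξ ∈ U := by
  obtain ⟨A, hA, B, hB, rfl⟩ := mem_inf_iff.1 hU
  rw [mem_iInf_finite] at hB
  obtain ⟨t, ht⟩ := hB
  rw [iInf_principal_finset, mem_principal] at ht
  refine ⟨t.toList.map Subtype.val, fun x hx => ?_, ?_⟩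
  · obtain ⟨y, -, rfl⟩ := List.mem_map.1 hx
    exact y.2
  · filter_upwards [hA] with ξ hξ hne
    refine ⟨hξ, ht (Set.mem_iInter₂.2 fun w hw h0 => hne ?_)⟩
    refine List.prod_eq_zero (List.mem_map.2 ⟨w, List.mem_map.2 ⟨w, by simpa using hw, rfl⟩, h0⟩)

theorem analyticAt_list_prod (l : List V) (ξ₀ : V →L[ℝ] ℂ) :
    AnalyticAt ℂ (fun ξ : V →L[ℝ] ℂ => (l.map fun x => ξ x).prod) ξ₀ := by
  induction l with
  | nil => exact analyticAt_const
  | cons a l ih =>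
    simp only [List.map_cons, List.prod_cons]
    refine AnalyticAt.mul ?_ ih
    let ev : (V →L[ℝ] ℂ) →L[ℂ] ℂ :=
      ⟨⟨⟨fun ξ => ξ a, fun _ _ => rfl⟩, fun _ _ => rfl⟩, (ContinuousLinearMap.apply ℝ ℂ a).continuous⟩
    exact ev.analyticAt ξ₀

variable [FiniteDimensional ℝ V] {ι : Type*} [Fintype ι] (b : Module.Basis ι ℝ V)

/-- The linear form `x` on the complexified dual as a linear polynomial in the coordinates
`⟨ξ, b_i⟩`. -/
def linPoly (x : V) : MvPolynomial ι ℂ :=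
  ∑ i, MvPolynomial.C ((b.repr x i : ℝ) : ℂ) * MvPolynomial.X i

theorem eval_linPoly (x : V) (ξ : V →L[ℝ] ℂ) :
    MvPolynomial.eval (fun i => ξ (b i)) (linPoly b x) = ξ x := by
  conv_rhs => rw [← b.sum_repr x]
  simp only [linPoly, map_sum, map_mul, MvPolynomial.eval_C, MvPolynomial.eval_X,
    ContinuousLinearMap.map_smul]
  exact Finset.sum_congr rfl fun i _ => (Complex.real_smul).symm

theorem linPoly_ne_zero {V : Type*} [NormedAddCommGroup V] [NormedSpace ℝ V] {ι : Type*}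
    [Fintype ι] (b : Module.Basis ι ℝ V) {x : V} (hx : x ≠ 0) : linPoly b x ≠ 0 := by
  classical
  intro h
  apply hx
  apply b.repr.injective
  ext i
  have := congrArg (MvPolynomial.eval (Pi.single i 1)) h
  simpa [linPoly, Pi.single_apply] using this

/-- A real linear form, as a point of the complexified dual. -/
def cplx (η : Module.Dual ℝ V) : V →L[ℝ] ℂ := Complex.ofRealCLM.comp η.toContinuousLinearMap

theorem cplx_apply (η : Module.Dual ℝ V) (x : V) : cplx η x = ((η x : ℝ) : ℂ) := rfl

/-- Polynomials are determined by their values at the `η` with `⟨η, b_i⟩ < 0`. -/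
theorem mvPolynomial_eq_zero_of_neg {p : MvPolynomial ι ℂ}
    (h : ∀ η : Module.Dual ℝ V, (∀ i, η (b i) < 0) →
      MvPolynomial.eval (fun i => cplx η (b i)) p = 0) : p = 0 := by
  refine MvPolynomial.funext_set (fun _ => (fun t : ℝ => (t : ℂ)) '' Set.Iio 0)
    (fun i => (Set.Iio_infinite 0).image (Complex.ofReal_injective.injOn)) fun x hx => ?_
  choose t ht htx using fun i => hx i (Set.mem_univ i)
  have := h (b.constr ℝ t) fun i => by
    rw [b.constr_basis]; exact ht i
  rw [map_zero, ← this]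
  have hx' : x = fun i => cplx (b.constr ℝ t) (b i) := by
    funext i
    rw [cplx_apply, b.constr_basis]
    exact (htx i).symm
  rw [hx']

theorem exists_mvPolynomial_of_mem_homPolyDual {n : ℕ} {P : (V →L[ℝ] ℂ) → ℂ}
    (hP : P ∈ homPolyDual V n) :
    ∃ p : MvPolynomial ι ℂ, ∀ ξ, P ξ = MvPolynomial.eval (fun i => ξ (b i)) p := by
  induction hP using Submodule.span_induction with
  | mem f hf =>
    obtain ⟨l, -, rfl⟩ := hf
    refine ⟨(l.map (linPoly b)).prod, fun ξ => ?_⟩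
    rw [map_list_prod, List.map_map]
    exact congrArg (fun f => (l.map f).prod) (funext fun x => (eval_linPoly b x ξ).symm)
  | zero => exact ⟨0, fun ξ => by simp⟩
  | add f g _ _ hf hg =>
    obtain ⟨p, hp⟩ := hf
    obtain ⟨q, hq⟩ := hg
    exact ⟨p + q, fun ξ => by simp [hp, hq]⟩
  | smul c f _ hf =>
    obtain ⟨p, hp⟩ := hf
    exact ⟨MvPolynomial.C c * p, fun ξ => by simp [hp]⟩

theorem tendsto_smul_cplx {V : Type*} [NormedAddCommGroup V] [NormedSpace ℝ V] (η : V →L[ℝ] ℂ) :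
    Tendsto (fun τ : ℂ => τ • η) (𝓝 (0 : ℂ)) (𝓝 0) := by
  have h : Tendsto (fun τ : ℂ => τ • η) (𝓝 (0 : ℂ)) (𝓝 ((0 : ℂ) • η)) :=
    (continuous_id.smul continuous_const).tendsto 0
  rwa [show (0 : ℂ) • η = 0 from zero_smul ℂ η] at h

theorem tendsto_cplx_smul (η : Module.Dual ℝ V) :
    Tendsto (fun t : ℝ => cplx (t • η)) (𝓝[>] 0) (𝓝 0) := by
  have h1 : Tendsto (fun t : ℝ => (t : ℂ)) (𝓝[>] (0 : ℝ)) (𝓝 0) := by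
    have := (Complex.continuous_ofReal.tendsto 0).mono_left (nhdsWithin_le_nhds (s := Set.Ioi (0 : ℝ)))
    simpa using this
  refine ((tendsto_smul_cplx (cplx η)).comp h1).congr fun t => ?_
  ext x
  simp [cplx_apply]

/-- A holomorphic function near `0` vanishing at the small real `η` with `⟨η, b_i⟩ < 0` is zero:
its homogeneous components are polynomials that vanish at all such `η`. -/
theorem eventually_eq_zero_of_neg {h : (V →L[ℝ] ℂ) → ℂ} (hh : AnalyticAt ℂ h 0)
    (h0 : ∀ᶠ ξ in 𝓝 0, ∀ η : Module.Dual ℝ V, ξ = cplx η → (∀ i, η (b i) < 0) → h ξ = 0) :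
    ∀ᶠ ξ in 𝓝 0, h ξ = 0 := by
  -- the terms of the Taylor expansion vanish identically
  obtain ⟨p, hp⟩ := hh
  have key : ∀ n ξ, (p n fun _ => ξ) = 0 := by
    intro n ξ
    obtain ⟨q, hq⟩ := exists_mvPolynomial_of_mem_homPolyDual b
      (multilinear_diag_mem_homPolyDual n (p n).toMultilinearMap)
    have hq0 : q = 0 := by
      refine mvPolynomial_eq_zero_of_neg b fun η hη => ?_
      rw [← hq]
      -- the restriction of `h` to the line through `η`
      have hps : HasFPowerSeriesAt (fun τ : ℂ => h (τ • cplx η))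
          (FormalMultilinearSeries.ofScalars ℂ fun n : ℕ => p n fun _ => cplx η) 0 := by
        rw [hasFPowerSeriesAt_iff]
        filter_upwards [hasSum_analyticAt_smul hp (cplx η)] with τ hτ
        simpa only [FormalMultilinearSeries.coeff_ofScalars, smul_eq_mul, zero_add] using hτ
      have hzero : ∀ᶠ τ in 𝓝 (0 : ℂ), h (τ • cplx η) = 0 := by
        -- the zeros of `h` on this line accumulate at `0`, along the positive multiples of `η`
        refine (hps.analyticAt.eventually_eq_zero_or_eventually_ne_zero).resolve_right fun hne => ?_
        have h1 : Tendsto (fun t : ℝ => (t : ℂ)) (𝓝[>] (0 : ℝ)) (𝓝[≠] 0) := by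
          refine tendsto_nhdsWithin_iff.2 ⟨?_, ?_⟩
          · have := (Complex.continuous_ofReal.tendsto 0).mono_left
              (nhdsWithin_le_nhds (s := Set.Ioi (0 : ℝ)))
            simpa using this
          · filter_upwards [self_mem_nhdsWithin] with t ht
            simpa using ne_of_gt ht
        obtain ⟨t, h2, h3, h4⟩ := ((h1.eventually hne).and
          (((tendsto_cplx_smul η).eventually h0).and self_mem_nhdsWithin)).exists
        have h5 : (t : ℂ) • cplx η = cplx (t • η) := by ext x; simp [cplx_apply]
        rw [h5] at h2
        exact h2 (h3 (t • η) rfl fun i => by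
          simpa using mul_neg_of_pos_of_neg (show 0 < t from h4) (hη i))
      have := hps.eq_zero_of_eventually hzero
      have := congrArg (fun p => FormalMultilinearSeries.coeff p n) this
      rw [FormalMultilinearSeries.coeff_ofScalars] at this
      exact this
    have := hq ξ
    rw [hq0, map_zero] at this
    exact this
  filter_upwards [hp.eventually_hasSum] with ξ hξ
  rw [zero_add] at hξ
  exact hξ.unique (HasSum.congr_eq hasSum_zero (fun n => key n ξ) rfl)

/-- Every set of the generic filter contains a real `η` with `⟨η, b_i⟩ < 0`. -/
theorem frequently_generic_neg :
    ∃ᶠ ξ in generic V, ∃ η : Module.Dual ℝ V, ξ = cplx η ∧ ∀ i, η (b i) < 0 := by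
  intro hcon
  obtain ⟨l, hl, hev⟩ := exists_list_of_mem_generic hcon
  -- the excluded hyperplanes are the zero set of a nonzero polynomial
  have hp : (l.map (linPoly b)).prod ≠ 0 := by
    rw [Ne, List.prod_eq_zero_iff]
    intro h
    obtain ⟨x, hx, h⟩ := List.mem_map.1 h
    exact linPoly_ne_zero b (hl x hx) h
  apply hp
  refine mvPolynomial_eq_zero_of_neg b fun η hη => ?_
  by_contra hne
  have hne' : ∀ x ∈ l, η x ≠ 0 := by
    intro x hx h0
    apply hne
    rw [map_list_prod, List.map_map]
    refine List.prod_eq_zero (List.mem_map.2 ⟨x, hx, ?_⟩)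
    rw [Function.comp_apply, eval_linPoly, cplx_apply, h0, Complex.ofReal_zero]
  -- where this polynomial does not vanish, a small multiple of `η` is in the given set
  obtain ⟨t, h1, h2⟩ := (((tendsto_cplx_smul η).eventually hev).and self_mem_nhdsWithin).exists
  replace h2 : 0 < t := h2
  refine h1 ?_ ⟨t • η, rfl, fun i => by simpa using mul_neg_of_pos_of_neg h2 (hη i)⟩
  rw [Ne, List.prod_eq_zero_iff]
  intro h
  obtain ⟨x, hx, h⟩ := List.mem_map.1 h
  rw [cplx_apply] at h
  have : t * η x = 0 := by exact_mod_cast h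
  exact (mul_ne_zero h2.ne' (hne' x hx)) this

/-- Two elements of `ℳ_ℓ(V*)` which agree at the real points `η` with `⟨η, b_i⟩ < 0` are equal. -/
theorem eq_of_mem_merL_of_neg {f g : (V →L[ℝ] ℂ) → ℂ} (hf : (f : GermV V) ∈ merL)
    (hg : (g : GermV V) ∈ merL)
    (h : ∀ᶠ ξ in generic V, ∀ η : Module.Dual ℝ V, ξ = cplx η → (∀ i, η (b i) < 0) → f ξ = g ξ) :
    (f : GermV V) = g := by
  obtain ⟨w, φ, hw, hφ, hfw⟩ := hf
  obtain ⟨u, ψ, hu, hψ, hgu⟩ := hg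
  replace hfw := Germ.coe_eq.1 hfw
  replace hgu := Germ.coe_eq.1 hgu
  -- clearing denominators gives a holomorphic function that vanishes outside of some hyperplanes
  have hcomb : ∀ᶠ ξ in generic V, ∀ η : Module.Dual ℝ V, ξ = cplx η → (∀ i, η (b i) < 0) →
      φ ξ * (u.map fun x => ξ x).prod - ψ ξ * (w.map fun x => ξ x).prod = 0 := by
    filter_upwards [h, hfw, hgu, eventually_generic_prod_ne hw, eventually_generic_prod_ne hu]
      with ξ h1 h2 h3 h4 h5 η hη hneg
    have := h1 η hη hneg
    rw [h2, h3, div_eq_div_iff h4 h5] at this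
    rw [this, sub_self]
  obtain ⟨l, hl, hev⟩ := exists_list_of_mem_generic hcomb
  -- the additional factor makes it vanish on these hyperplanes as well
  have hzero := eventually_eq_zero_of_neg b
    (h := fun ξ => (φ ξ * (u.map fun x => ξ x).prod - ψ ξ * (w.map fun x => ξ x).prod) *
      (l.map fun x => ξ x).prod)
    (((hφ.mul (analyticAt_list_prod u 0)).sub (hψ.mul (analyticAt_list_prod w 0))).mul
      (analyticAt_list_prod l 0)) (by
    filter_upwards [hev] with ξ hξ η hη hneg
    by_cases h0 : (l.map fun x => ξ x).prod = 0
    · rw [h0, mul_zero]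
    · rw [hξ h0 η hη hneg, zero_mul])
  refine Germ.coe_eq.2 ?_
  filter_upwards [hfw, hgu, eventually_generic_prod_ne hw, eventually_generic_prod_ne hu,
    eventually_generic_prod_ne hl, generic_le_nhds hzero] with ξ h2 h3 h4 h5 h6 h7
  rw [h2, h3, div_eq_div_iff h4 h5]
  exact sub_eq_zero.1 ((mul_eq_zero.1 h7).resolve_right h6)

end Identity

/-! ### The factors `1 - e^z` -/

section Todd

/-- The holomorphic function `z / (e^z - 1)` near `0`, with value `1` at `0`. -/
def todd (z : ℂ) : ℂ := (dslope Complex.exp 0 z)⁻¹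

theorem dslope_exp_zero : dslope Complex.exp 0 0 = 1 := by simp [dslope_same]

theorem todd_zero : todd 0 = 1 := by rw [todd, dslope_exp_zero, inv_one]

theorem analyticAt_todd : AnalyticAt ℂ todd 0 := by
  obtain ⟨p, hp⟩ := (Complex.differentiable_exp.analyticAt 0)
  exact (AnalyticAt.inv ⟨_, hp.has_fpower_series_dslope_fslope⟩ (by rw [dslope_exp_zero]; exact one_ne_zero))

theorem inv_one_sub_exp {z : ℂ} (hz : z ≠ 0) : (1 - Complex.exp z)⁻¹ = -todd z * z⁻¹ := by
  rw [todd, dslope_of_ne _ hz, slope_def_field, Complex.exp_zero, sub_zero, inv_div, ← neg_sub,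
    inv_neg]
  field_simp

variable {V : Type*} [NormedAddCommGroup V] [NormedSpace ℝ V]

/-- The function `ξ ↦ ∏ -todd ⟨ξ, x⟩`, the numerator of `∏ (1 - e^{⟨ξ, x⟩})⁻¹`. -/
def toddProd (l : List V) (ξ : V →L[ℝ] ℂ) : ℂ := (l.map fun x => -todd (ξ x)).prod

theorem analyticAt_toddProd (l : List V) : AnalyticAt ℂ (toddProd l) 0 := by
  induction l with
  | nil => exact analyticAt_const
  | cons a l ih =>
    have : toddProd (a :: l) = fun ξ => -todd (ξ a) * toddProd l ξ := by
      funext ξ; simp [toddProd]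
    rw [this]
    refine AnalyticAt.mul (AnalyticAt.neg ?_) ih
    let ev : (V →L[ℝ] ℂ) →L[ℂ] ℂ :=
      ⟨⟨⟨fun ξ => ξ a, fun _ _ => rfl⟩, fun _ _ => rfl⟩, (ContinuousLinearMap.apply ℝ ℂ a).continuous⟩
    exact AnalyticAt.comp (f := ev) (g := todd) (by simpa using analyticAt_todd) (ev.analyticAt 0)

theorem toddProd_zero (l : List V) : toddProd l 0 = (-1) ^ l.length := by
  simp [toddProd, todd_zero]

theorem inv_prod_one_sub_exp {l : List V} {ξ : V →L[ℝ] ℂ} (hξ : (l.map fun x => ξ x).prod ≠ 0) :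
    ((l.map fun x => 1 - Complex.exp (ξ x)).prod)⁻¹ = toddProd l ξ / (l.map fun x => ξ x).prod := by
  induction l with
  | nil => simp [toddProd]
  | cons a l ih =>
    simp only [List.map_cons, List.prod_cons, toddProd] at hξ ih ⊢
    obtain ⟨h1, h2⟩ := mul_ne_zero_iff.1 hξ
    rw [mul_inv, ih h2, inv_one_sub_exp h1]
    field_simp

end Todd

/-! ### Inclusion-exclusion for half-spaces -/

section HalfSpaces

variable {W : Type*} [AddCommGroup W] [Module ℝ W] {ι : Type*}

/-- The intersection of the half-spaces `⟨η_i, x⟩ ≤ b_i`, `i ∈ s`. -/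
def halfSpaces (η : ι → Module.Dual ℝ W) (b : ι → ℝ) (s : Finset ι) : Set W :=
  {x | ∀ i ∈ s, η i x ≤ b i}

open Classical in
theorem ind_halfSpaces (η : ι → Module.Dual ℝ W) (b : ι → ℝ) (s : Finset ι) (x : W) :
    ind (halfSpaces η b s) x = ∏ i ∈ s, if η i x ≤ b i then (1 : ℂ) else 0 := by
  rw [Finset.prod_ite_zero, ind, Set.indicator_apply]
  by_cases h : ∀ i ∈ s, η i x ≤ b i
  · rw [if_pos h, if_pos (show x ∈ halfSpaces η b s from h)]; simp
  · rw [if_neg h, if_neg (show x ∉ halfSpaces η b s from h)]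

/-- If no point violates all the inequalities indexed by `E` and satisfies those indexed by `T`, then
expanding `∏_{i ∈ E} (1 - [η_i ≤ b_i]) ∏_{i ∈ T} [η_i ≤ b_i] = 0` gives a relation. -/
theorem sum_powerset_ind_halfSpaces [DecidableEq ι] {η : ι → Module.Dual ℝ W} {b : ι → ℝ}
    {E T : Finset ι} (hET : Disjoint E T)
    (h : ∀ x, (∀ i ∈ T, η i x ≤ b i) → ∃ i ∈ E, η i x ≤ b i) :
    ∑ A ∈ E.powerset, (-1 : ℤ) ^ A.card • ind (halfSpaces η b (A ∪ T)) = 0 := by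
  classical
  funext x
  rw [Finset.sum_apply, Pi.zero_apply]
  set f : ι → ℂ := fun i => if η i x ≤ b i then (1 : ℂ) else 0 with hf
  have h1 : ∀ A ∈ E.powerset, ((-1 : ℤ) ^ A.card • ind (halfSpaces η b (A ∪ T))) x =
      (∏ i ∈ A, -f i) * ∏ i ∈ T, f i := by
    intro A hA
    rw [Pi.smul_apply, ind_halfSpaces,
      Finset.prod_union (hET.mono_left (Finset.mem_powerset.1 hA)), Finset.prod_neg]
    simp [hf, mul_assoc]
  rw [Finset.sum_congr rfl h1, ← Finset.sum_mul]
  have h2 : ∑ A ∈ E.powerset, ∏ i ∈ A, -f i = ∏ i ∈ E, (1 + -f i) := by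
    rw [Finset.prod_one_add]
  rw [h2]
  by_cases hT : ∀ i ∈ T, η i x ≤ b i
  · obtain ⟨i, hi, hx⟩ := h x hT
    rw [Finset.prod_eq_zero hi (by simp [hf, hx]), zero_mul]
  · push Not at hT
    obtain ⟨i, hi, hx⟩ := hT
    rw [Finset.prod_eq_zero (s := T) hi (by simp [hf, hx]), mul_zero]

/-- The indicator of an intersection of half-spaces is an integral combination of indicators of
intersections of half-spaces with linearly independent normals: a linear relation between the normals
shows that some inequalities are never violated together when the others hold. -/
theorem ind_halfSpaces_mem_closure (η : ι → Module.Dual ℝ W) (b : ι → ℝ) (s : Finset ι) :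
    ind (halfSpaces η b s) ∈ AddSubgroup.closure
      {f | ∃ t ⊆ s, LinearIndepOn ℝ η (t : Set ι) ∧ f = ind (halfSpaces η b t)} := by
  classical
  induction s using Finset.strongInduction with
  | H s ih =>
    by_cases hli : LinearIndepOn ℝ η (s : Set ι)
    · exact AddSubgroup.subset_closure ⟨s, subset_rfl, hli, rfl⟩
    -- a set `E` of inequalities that are not all violated where the others hold
    have key : ∃ E ⊆ s, ∀ x, (∀ i ∈ s \ E, η i x ≤ b i) → ∃ i ∈ E, η i x ≤ b i := by
      rw [linearIndepOn_finset_iff] at hli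
      push Not at hli
      obtain ⟨c, hc, i₀, hi₀, hci₀⟩ := hli
      have hneg : ∀ c : ι → ℝ, ∑ i ∈ s, c i • η i = 0 → ∑ i ∈ s, (-c) i • η i = 0 := by
        intro c hc
        have : ∑ i ∈ s, (-c) i • η i = -∑ i ∈ s, c i • η i := by
          ext x
          simp [LinearMap.sum_apply]
        rw [this, hc, neg_zero]
      -- a relation `∑ c_i η_i = 0`, with the sign chosen such that `∑ c_i b_i ≥ 0`; if all the
      -- inequalities with `c_i > 0` are violated while the others hold, then the terms of
      -- `∑ c_i (η_i x - b_i) = -∑ c_i b_i ≤ 0` are nonnegative, and either the right hand side is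
      -- negative or some term, one with `c_i > 0`, is positive
      obtain ⟨c, hc, hpos, hor⟩ : ∃ c : ι → ℝ, ∑ i ∈ s, c i • η i = 0 ∧ 0 ≤ ∑ i ∈ s, c i * b i ∧
          ((∃ i ∈ s, 0 < c i) ∨ 0 < ∑ i ∈ s, c i * b i) := by
        rcases lt_trichotomy (∑ i ∈ s, c i * b i) 0 with h | h | h
        · refine ⟨-c, hneg c hc, ?_, Or.inr ?_⟩ <;> simp [h, h.le]
        · rcases lt_or_gt_of_ne hci₀ with h' | h'
          · exact ⟨-c, hneg c hc, by simp [h], Or.inl ⟨i₀, hi₀, by simpa using h'⟩⟩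
          · exact ⟨c, hc, by simp [h], Or.inl ⟨i₀, hi₀, h'⟩⟩
        · exact ⟨c, hc, h.le, Or.inr h⟩
      refine ⟨s.filter fun i => 0 < c i, Finset.filter_subset _ _, fun x hx => ?_⟩
      by_contra hcon
      push Not at hcon
      have h0 : ∑ i ∈ s, c i * (η i x - b i) ≤ 0 := by
        have := congrArg (fun f : Module.Dual ℝ W => f x) hc
        simp only [LinearMap.sum_apply, LinearMap.smul_apply, smul_eq_mul, LinearMap.zero_apply]
          at this
        simp only [mul_sub, Finset.sum_sub_distrib, this]
        linarith
      have hterm : ∀ i ∈ s, 0 ≤ c i * (η i x - b i) := by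
        intro i hi
        by_cases hci : 0 < c i
        · exact mul_nonneg hci.le (by linarith [hcon i (Finset.mem_filter.2 ⟨hi, hci⟩)])
        · refine mul_nonneg_of_nonpos_of_nonpos (not_lt.1 hci) ?_
          linarith [hx i (Finset.mem_sdiff.2 ⟨hi, fun h => hci (Finset.mem_filter.1 h).2⟩)]
      rcases hor with ⟨i, hi, hci⟩ | hor
      · have : 0 < c i * (η i x - b i) :=
          mul_pos hci (by linarith [hcon i (Finset.mem_filter.2 ⟨hi, hci⟩)])
        have := Finset.single_le_sum hterm hi
        linarith
      · have := congrArg (fun f : Module.Dual ℝ W => f x) hc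
        simp only [LinearMap.sum_apply, LinearMap.smul_apply, smul_eq_mul, LinearMap.zero_apply]
          at this
        have h3 := Finset.sum_nonneg hterm
        simp only [mul_sub, Finset.sum_sub_distrib, this] at h3
        linarith
    obtain ⟨E, hE, hx⟩ := key
    have hrel := sum_powerset_ind_halfSpaces (Finset.disjoint_sdiff) hx
    -- the term `A = E` is the given intersection; all others have fewer inequalities
    rw [← Finset.sum_erase_add _ _ (Finset.mem_powerset_self E), Finset.union_sdiff_of_subset hE]
      at hrel
    have hmem : (-1 : ℤ) ^ E.card • ind (halfSpaces η b s) ∈ AddSubgroup.closure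
        {f | ∃ t ⊆ s, LinearIndepOn ℝ η (t : Set ι) ∧ f = ind (halfSpaces η b t)} := by
      rw [← neg_eq_of_add_eq_zero_right hrel]
      refine neg_mem (sum_mem fun A hA => zsmul_mem ?_ _)
      obtain ⟨hAE, hA⟩ := Finset.mem_erase.1 hA
      replace hA := Finset.mem_powerset.1 hA
      have hss : A ∪ s \ E ⊂ s := by
        refine Finset.ssubset_iff_subset_ne.2
          ⟨Finset.union_subset (hA.trans hE) Finset.sdiff_subset, fun h => hAE ?_⟩
        refine hA.antisymm fun i hi => ?_
        have := h ▸ hE hi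
        rcases Finset.mem_union.1 this with h' | h'
        · exact h'
        · exact absurd hi (Finset.mem_sdiff.1 h').2
      refine AddSubgroup.closure_mono ?_ (ih _ hss)
      rintro f ⟨t, ht, hli, rfl⟩
      exact ⟨t, ht.trans hss.1, hli, rfl⟩
    have := zsmul_mem hmem ((-1 : ℤ) ^ E.card)
    rwa [smul_smul, ← mul_pow, neg_one_mul, neg_neg, one_pow, one_smul] at this

end HalfSpaces

/-! ### Integral linear algebra -/

section Integral

variable {W : Type*} [AddCommGroup W] [Module ℝ W] {κ : Type*} [Fintype κ]
  {B : Module.Basis κ ℝ W} {Λ : Submodule ℤ W}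

theorem exists_int_vec_ne_zero {α β : Type*} [Fintype α] [Fintype β] (A : Matrix β α ℤ)
    (h : Fintype.card β < Fintype.card α) : ∃ n : α → ℤ, n ≠ 0 ∧ A.mulVec n = 0 := by
  classical
  by_contra! hcon
  refine h.not_ge (card_le_of_injective ℤ A.mulVecLin ?_)
  rw [injective_iff_map_eq_zero]
  intro n hn
  by_contra hne
  exact hcon n hne hn

theorem add_mem_dualLattice {η θ : Module.Dual ℝ W} (hη : η ∈ dualLattice Λ)
    (hθ : θ ∈ dualLattice Λ) : η + θ ∈ dualLattice Λ := fun v hv => by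
  obtain ⟨m, hm⟩ := hη v hv
  obtain ⟨n, hn⟩ := hθ v hv
  exact ⟨m + n, by simp [hm, hn]⟩

theorem zsmul_mem_dualLattice {η : Module.Dual ℝ W} (hη : η ∈ dualLattice Λ) (n : ℤ) :
    (n : ℝ) • η ∈ dualLattice Λ := fun v hv => by
  obtain ⟨m, hm⟩ := hη v hv
  exact ⟨n * m, by simp [hm]⟩

theorem neg_mem_dualLattice {η : Module.Dual ℝ W} (hη : η ∈ dualLattice Λ) :
    -η ∈ dualLattice Λ := by
  have := zsmul_mem_dualLattice hη (-1)
  rwa [show ((-1 : ℤ) : ℝ) • η = -η by ext x; simp] at this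

theorem sum_mem_dualLattice {α : Type*} (s : Finset α) {η : α → Module.Dual ℝ W}
    (hη : ∀ i ∈ s, η i ∈ dualLattice Λ) : ∑ i ∈ s, η i ∈ dualLattice Λ := fun v hv => by
  choose! n hn using fun i hi => hη i hi v hv
  exact ⟨∑ i ∈ s, n i, by simpa using Finset.sum_congr rfl hn⟩

theorem mem_dualLattice_of_basis (hB : Submodule.span ℤ (Set.range B) = Λ) {η : Module.Dual ℝ W}
    (h : ∀ k, ∃ n : ℤ, η (B k) = n) : η ∈ dualLattice Λ := by
  intro v hv
  rw [← hB] at hv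
  induction hv using Submodule.span_induction with
  | mem x hx => obtain ⟨k, rfl⟩ := hx; exact h k
  | zero => exact ⟨0, by simp⟩
  | add x y _ _ hx hy =>
    obtain ⟨m, hm⟩ := hx
    obtain ⟨n, hn⟩ := hy
    exact ⟨m + n, by simp [hm, hn]⟩
  | smul a x _ hx =>
    obtain ⟨m, hm⟩ := hx
    exact ⟨a * m, by rw [map_zsmul, hm]; simp⟩

theorem repr_eq_int (hB : Submodule.span ℤ (Set.range B) = Λ) {v : W} (hv : v ∈ Λ) (k : κ) :
    ∃ n : ℤ, B.repr v k = n := by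
  have : B.coord k ∈ dualLattice Λ := mem_dualLattice_of_basis hB fun j => by
    classical
    exact ⟨if j = k then 1 else 0, by simp [Finsupp.single_apply]⟩
  exact this v hv

theorem coord_mem_dualLattice (hB : Submodule.span ℤ (Set.range B) = Λ) (k : κ) :
    B.coord k ∈ dualLattice Λ := fun _ hv => repr_eq_int hB hv k

theorem mem_of_repr_eq_int (hB : Submodule.span ℤ (Set.range B) = Λ) {v : W}
    (h : ∀ k, ∃ n : ℤ, B.repr v k = n) : v ∈ Λ := by
  choose n hn using h
  rw [← B.sum_repr v, ← hB]
  refine Submodule.sum_mem _ fun k _ => ?_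
  rw [hn, Int.cast_smul_eq_zsmul]
  exact Submodule.smul_mem _ _ (Submodule.subset_span ⟨k, rfl⟩)

theorem basis_mem (hB : Submodule.span ℤ (Set.range B) = Λ) (k : κ) : B k ∈ Λ := by
  rw [← hB]; exact Submodule.subset_span ⟨k, rfl⟩

/-- Fewer integral forms than the rank have a common nonzero zero in the lattice. -/
theorem exists_lattice_ne_zero (hB : Submodule.span ℤ (Set.range B) = Λ) {α : Type*} [Fintype α]
    {η : α → Module.Dual ℝ W} (hη : ∀ i, η i ∈ dualLattice Λ)
    (h : Fintype.card α < Fintype.card κ) : ∃ v ∈ Λ, v ≠ 0 ∧ ∀ i, η i v = 0 := by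
  choose A hA using fun i k => hη i (B k) (basis_mem hB k)
  obtain ⟨n, hn, hAn⟩ := exists_int_vec_ne_zero (Matrix.of A) h
  refine ⟨∑ k, (n k : ℝ) • B k, ?_, fun h0 => hn ?_, fun i => ?_⟩
  · refine mem_of_repr_eq_int hB fun k => ⟨n k, by rw [B.repr_sum_self]⟩
  · funext k
    have := congrArg (fun v => B.repr v k) h0
    simp only [B.repr_sum_self, map_zero, Finsupp.coe_zero, Pi.zero_apply] at this
    exact_mod_cast this
  · have := congrFun hAn i
    simp only [Matrix.mulVec, dotProduct, Matrix.of_apply, Pi.zero_apply] at this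
    rw [map_sum]
    simp only [map_smul, hA, smul_eq_mul]
    have h2 : ((∑ k, A i k * n k : ℤ) : ℝ) = 0 := by rw [this]; simp
    push_cast at h2
    simpa only [mul_comm] using h2

/-- More lattice vectors than the rank satisfy a nontrivial integral relation. -/
theorem exists_int_relation (hB : Submodule.span ℤ (Set.range B) = Λ) {α : Type*} [Fintype α]
    {u : α → W} (hu : ∀ a, u a ∈ Λ) (h : Fintype.card κ < Fintype.card α) :
    ∃ n : α → ℤ, n ≠ 0 ∧ ∑ a, (n a : ℝ) • u a = 0 := by
  choose A hA using fun (j : κ) (a : α) => repr_eq_int hB (hu a) j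
  obtain ⟨n, hn, hAn⟩ := exists_int_vec_ne_zero (Matrix.of A) h
  refine ⟨n, hn, ?_⟩
  apply B.repr.injective
  ext j
  have := congrFun hAn j
  simp only [Matrix.mulVec, dotProduct, Matrix.of_apply, Pi.zero_apply] at this
  simp only [map_sum, map_smul, Finsupp.coe_finsetSum, Finset.sum_apply, Finsupp.smul_apply,
    hA, smul_eq_mul, map_zero, Finsupp.coe_zero, Pi.zero_apply]
  have h2 : ((∑ a, A j a * n a : ℤ) : ℝ) = 0 := by rw [this]; simp
  push_cast at h2
  simpa only [mul_comm] using h2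

/-- Fewer lattice vectors than the rank are annihilated by a nonzero integral form. -/
theorem exists_dual_ne_zero (hB : Submodule.span ℤ (Set.range B) = Λ) {α : Type*} [Fintype α]
    {u : α → W} (hu : ∀ a, u a ∈ Λ) (h : Fintype.card α < Fintype.card κ) :
    ∃ θ ∈ dualLattice Λ, θ ≠ 0 ∧ ∀ a, θ (u a) = 0 := by
  choose A hA using fun (a : α) (j : κ) => repr_eq_int hB (hu a) j
  obtain ⟨n, hn, hAn⟩ := exists_int_vec_ne_zero (Matrix.of A) h
  refine ⟨∑ k, (n k : ℝ) • B.coord k, sum_mem_dualLattice _ fun k _ =>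
    zsmul_mem_dualLattice (coord_mem_dualLattice hB k) _, fun h0 => hn ?_, fun a => ?_⟩
  · funext k
    classical
    have := congrArg (fun f : Module.Dual ℝ W => f (B k)) h0
    simpa [LinearMap.sum_apply, Finsupp.single_apply] using this
  · have := congrFun hAn a
    simp only [Matrix.mulVec, dotProduct, Matrix.of_apply, Pi.zero_apply] at this
    have h2 : ((∑ k, A a k * n k : ℤ) : ℝ) = 0 := by rw [this]; simp
    push_cast at h2
    rw [← h2, LinearMap.sum_apply]
    refine Finset.sum_congr rfl fun k _ => ?_
    rw [LinearMap.smul_apply, B.coord_apply, hA, smul_eq_mul, mul_comm]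

/-- The coordinates of lattice vectors in a basis of lattice vectors have bounded denominators. -/
theorem exists_smul_coord_mem (hB : Submodule.span ℤ (Set.range B) = Λ) {ι : Type*} [Fintype ι]
    (v : Module.Basis ι ℝ W) (hv : ∀ i, v i ∈ Λ) :
    ∃ N : ℕ, 0 < N ∧ ∀ i, (N : ℝ) • v.coord i ∈ dualLattice Λ := by
  classical
  have key : ∀ k, ∃ m : ℤ, m ≠ 0 ∧ ∀ i, ∃ n : ℤ, m * v.repr (B k) i = n := by
    intro k
    -- the `d + 1` lattice vectors `B k` and `v i` satisfy an integral relation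
    have hcard : Fintype.card κ = Fintype.card ι := Fintype.card_congr (B.indexEquiv v)
    obtain ⟨n, hn, hrel⟩ := exists_int_relation hB (u := fun a : Option ι => a.elim (B k) v)
      (fun a => by
        cases a
        · exact basis_mem hB k
        · exact hv _) (by simp [hcard])
    rw [Fintype.sum_option] at hrel
    simp only [Option.elim_none, Option.elim_some] at hrel
    have hcoord : ∀ i, n none * v.repr (B k) i + n (some i) = 0 := by
      intro i
      have := congrArg (fun x => v.repr x i) hrel
      simpa [v.repr_sum_self, Finsupp.single_apply] using this
    refine ⟨n none, fun h0 => hn ?_, fun i => ⟨-n (some i), ?_⟩⟩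
    · funext a
      cases a with
      | none => exact h0
      | some i =>
        have := hcoord i
        rw [h0] at this
        simpa using this
    · push_cast
      linarith [hcoord i]
  choose m hm hmn using key
  refine ⟨∏ k, (m k).natAbs, Finset.prod_pos fun k _ => Int.natAbs_pos.2 (hm k), fun i =>
    mem_dualLattice_of_basis hB fun k => ?_⟩
  obtain ⟨n, hn⟩ := hmn k i
  have h1 : (m k : ℤ) ∣ ((∏ k, (m k).natAbs : ℕ) : ℤ) :=
    Int.natAbs_dvd.1 (Int.natCast_dvd_natCast.2 (Finset.dvd_prod_of_mem _ (Finset.mem_univ k)))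
  obtain ⟨q, hq⟩ := h1
  refine ⟨q * n, ?_⟩
  have hq' : ((∏ k, (m k).natAbs : ℕ) : ℝ) = m k * q := by
    rw [← Int.cast_natCast, hq, Int.cast_mul]
  rw [LinearMap.smul_apply, hq', smul_eq_mul, Module.Basis.coord_apply]
  push_cast
  rw [← hn]
  ring

theorem eq_zero_of_linearIndependent_dual [FiniteDimensional ℝ W] {ι : Type*} [Fintype ι]
    {η : ι → Module.Dual ℝ W} (hli : LinearIndependent ℝ η)
    (hcard : Fintype.card ι = Module.finrank ℝ W) {x : W} (hx : ∀ i, η i x = 0) : x = 0 := by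
  have hspan : Submodule.span ℝ (Set.range η) = ⊤ :=
    hli.span_eq_top_of_card_eq_finrank' (by rw [hcard, Subspace.dual_finrank_eq])
  rw [← Module.forall_dual_apply_eq_zero_iff ℝ]
  intro φ
  have : φ ∈ Submodule.span ℝ (Set.range η) := hspan ▸ Submodule.mem_top
  induction this using Submodule.span_induction with
  | mem y hy => obtain ⟨i, rfl⟩ := hy; exact hx i
  | zero => simp
  | add y z _ _ hy hz => simp [hy, hz]
  | smul a y _ hy => simp [hy]

/-- A basis of the dual space consisting of integral forms is dual, up to negative factors, to a basis
consisting of lattice vectors. -/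
theorem exists_basis_of_linearIndependent_dual (hB : Submodule.span ℤ (Set.range B) = Λ)
    {ι : Type*} [Fintype ι] {η : ι → Module.Dual ℝ W} (hη : ∀ i, η i ∈ dualLattice Λ)
    (hli : LinearIndependent ℝ η) (hcard : Fintype.card ι = Fintype.card κ) :
    ∃ v : Module.Basis ι ℝ W, (∀ i, v i ∈ Λ) ∧ (∀ i, η i (v i) < 0) ∧
      (∀ i j, i ≠ j → η i (v j) = 0) ∧ ∀ i x, η i x = v.repr x i * η i (v i) := by
  classical
  have : FiniteDimensional ℝ W := Module.Finite.of_basis B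
  have hd : Fintype.card κ = Module.finrank ℝ W := (Module.finrank_eq_card_basis B).symm
  have key : ∀ j, ∃ v ∈ Λ, η j v < 0 ∧ ∀ i, i ≠ j → η i v = 0 := by
    intro j
    obtain ⟨v, hv, hv0, hker⟩ := exists_lattice_ne_zero hB (η := fun i : {i // i ≠ j} => η i)
      (fun i => hη i) (by
        rw [← hcard]; exact Fintype.card_subtype_lt (x := j) (by simp))
    have hj : η j v ≠ 0 := by
      intro h0
      refine hv0 (eq_zero_of_linearIndependent_dual hli (hcard.trans hd) fun i => ?_)
      by_cases hij : i = j
      · rw [hij, h0]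
      · exact hker ⟨i, hij⟩
    rcases lt_or_gt_of_ne hj with h | h
    · exact ⟨v, hv, h, fun i hi => hker ⟨i, hi⟩⟩
    · exact ⟨-v, neg_mem hv, by simpa using h, fun i hi => by simpa using hker ⟨i, hi⟩⟩
  choose v hv hneg hzero using key
  have hvli : LinearIndependent ℝ v := by
    rw [Fintype.linearIndependent_iff]
    intro g hg i
    have := congrArg (η i) hg
    rw [map_sum, Finset.sum_eq_single i, map_zero, map_smul, smul_eq_mul] at this
    · exact (mul_eq_zero.1 this).resolve_right (hneg i).ne
    · intro j _ hj
      rw [map_smul, hzero j i hj.symm, smul_zero]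
    · simp
  let w := basisOfLinearIndependentOfCardEqFinrank' v hvli (hcard.trans hd)
  have hw : ∀ i, w i = v i := fun i => by simp [w]
  refine ⟨w, fun i => hw i ▸ hv i, fun i => hw i ▸ hneg i, fun i j hij => ?_, fun i x => ?_⟩
  · rw [hw]; exact hzero j i hij
  · conv_lhs => rw [← w.sum_repr x]
    rw [map_sum, Finset.sum_eq_single i, map_smul, smul_eq_mul]
    · intro j _ hj
      rw [map_smul, hw, hzero j i hj.symm, smul_zero]
    · simp

end Integral

/-! ### Signed decompositions of cones -/

section ConeDecomposition

variable {W : Type*} [AddCommGroup W] [Module ℝ W] {κ : Type*} [Fintype κ]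
  {B : Module.Basis κ ℝ W} {Λ : Submodule ℤ W}

/-- The span of the indicator functions of rational cones containing lines. -/
def lineSpan (Λ : Submodule ℤ W) : Submodule ℂ (W → ℂ) :=
  Submodule.span ℂ {h : W → ℂ | ∃ k : Set W, IsRationalCone Λ k ∧ ContainsLine k ∧ h = ind k}

/-- The cone with facet normals `η_i`. -/
def dualCone {ι : Type*} (η : ι → Module.Dual ℝ W) : Set W := {x | ∀ i, η i x ≤ 0}

/-- The integral combinations of functions in `𝒮`, modulo cones containing lines. -/
def coneGroup (Λ : Submodule ℤ W) (𝒮 : Set (W → ℂ)) : AddSubgroup (W → ℂ) :=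
  AddSubgroup.closure 𝒮 ⊔ (lineSpan Λ).toAddSubgroup

theorem exists_signs_of_mem_coneGroup {𝒮 : Set (W → ℂ)} {f : W → ℂ} (hf : f ∈ coneGroup Λ 𝒮) :
    ∃ (n : ℕ) (sign : Fin n → ℤˣ) (g : Fin n → W → ℂ), (∀ i, g i ∈ 𝒮) ∧
      CongrModLines Λ f (∑ i, ((sign i : ℤ) : ℂ) • g i) := by
  obtain ⟨a, ha, b, hb, rfl⟩ := AddSubgroup.mem_sup.1 hf
  suffices h : ∃ (n : ℕ) (sign : Fin n → ℤˣ) (g : Fin n → W → ℂ), (∀ i, g i ∈ 𝒮) ∧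
      a = ∑ i, ((sign i : ℤ) : ℂ) • g i by
    obtain ⟨n, sign, g, hg, h⟩ := h
    refine ⟨n, sign, g, hg, ?_⟩
    rw [CongrModLines, ← h, add_sub_cancel_left]
    exact hb
  clear hf hb b
  induction ha using AddSubgroup.closure_induction with
  | mem x hx => exact ⟨1, fun _ => 1, fun _ => x, fun _ => hx, by simp⟩
  | zero => exact ⟨0, Fin.elim0, Fin.elim0, fun i => i.elim0, by simp⟩
  | add x y _ _ hx hy =>
    obtain ⟨m, s, g, hg, rfl⟩ := hx
    obtain ⟨n, t, h, hh, rfl⟩ := hy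
    refine ⟨m + n, Fin.append s t, Fin.append g h, fun i => ?_, ?_⟩
    · refine Fin.addCases (fun i => ?_) (fun i => ?_) i
      · simpa using hg i
      · simpa using hh i
    · simp [Fin.sum_univ_add]
  | neg x _ hx =>
    obtain ⟨m, s, g, hg, rfl⟩ := hx
    exact ⟨m, fun i => -s i, g, hg, by simp⟩

theorem isRationalCone_halfSpaces {ι : Type*} {η : ι → Module.Dual ℝ W}
    (hη : ∀ i, η i ∈ dualLattice Λ) (s : Finset ι) : IsRationalCone Λ (halfSpaces η 0 s) := by
  refine ⟨η '' s, s.finite_toSet.image η, ?_, ?_⟩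
  · rintro _ ⟨i, -, rfl⟩; exact hη i
  · ext x; simp [halfSpaces]

theorem isRationalCone_dualCone {ι : Type*} [Finite ι] {η : ι → Module.Dual ℝ W}
    (hη : ∀ i, η i ∈ dualLattice Λ) : IsRationalCone Λ (dualCone η) := by
  refine ⟨Set.range η, Set.finite_range η, ?_, ?_⟩
  · rintro _ ⟨i, rfl⟩; exact hη i
  · ext x; simp [dualCone]

theorem exists_forall_eq_zero_of_card_lt (hB : Submodule.span ℤ (Set.range B) = Λ) {ι : Type*}
    {η : ι → Module.Dual ℝ W} (hη : ∀ i, η i ∈ dualLattice Λ) {s : Finset ι}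
    (hs : s.card < Fintype.card κ) : ∃ v ∈ Λ, v ≠ 0 ∧ ∀ i ∈ s, η i v = 0 := by
  obtain ⟨v, hv, h0, h⟩ := exists_lattice_ne_zero hB (η := fun i : s => η i) (fun i => hη i)
    (by simpa using hs)
  exact ⟨v, hv, h0, fun i hi => h ⟨i, hi⟩⟩

theorem ind_halfSpaces_mem_lineSpan (hB : Submodule.span ℤ (Set.range B) = Λ) {ι : Type*}
    {η : ι → Module.Dual ℝ W} (hη : ∀ i, η i ∈ dualLattice Λ) {s : Finset ι}
    (hs : s.card < Fintype.card κ) : ind (halfSpaces η 0 s) ∈ lineSpan Λ := by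
  obtain ⟨v, -, h0, h⟩ := exists_forall_eq_zero_of_card_lt hB hη hs
  refine Submodule.subset_span ⟨_, isRationalCone_halfSpaces hη s, ⟨0, v, h0, fun t i hi => ?_⟩, rfl⟩
  simp [h i hi]

/-- Every rational cone is a signed combination of simplicial cones. -/
theorem ind_mem_of_dualCone_mem (hB : Submodule.span ℤ (Set.range B) = Λ) {G : AddSubgroup (W → ℂ)}
    (hG : (lineSpan Λ).toAddSubgroup ≤ G)
    (h : ∀ η : κ → Module.Dual ℝ W, (∀ i, η i ∈ dualLattice Λ) → LinearIndependent ℝ η →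
      ind (dualCone η) ∈ G) {c : Set W} (hc : IsRationalCone Λ c) : ind c ∈ G := by
  obtain ⟨H, hfin, hH, rfl⟩ := hc
  have : FiniteDimensional ℝ W := Module.Finite.of_basis B
  have hmem := ind_halfSpaces_mem_closure (Subtype.val : H → Module.Dual ℝ W) 0
    (@Finset.univ H hfin.fintype)
  have hset : halfSpaces (Subtype.val : H → Module.Dual ℝ W) 0 (@Finset.univ H hfin.fintype) =
      {x | ∀ η ∈ H, η x ≤ 0} := by
    ext x; simp [halfSpaces]
  rw [hset] at hmem
  refine (AddSubgroup.closure_le G).2 ?_ hmem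
  rintro f ⟨t, -, hli, rfl⟩
  rcases lt_or_ge t.card (Fintype.card κ) with ht | ht
  · exact hG (ind_halfSpaces_mem_lineSpan hB (η := (Subtype.val : H → Module.Dual ℝ W)) (fun i => hH i i.2) ht)
  · have hle := LinearIndependent.fintype_card_le_finrank (b := fun i : t => (i : H).1) hli
    rw [Subspace.dual_finrank_eq, Module.finrank_eq_card_basis B, Fintype.card_coe] at hle
    let e : κ ≃ t := Fintype.equivOfCardEq (by rw [Fintype.card_coe]; exact ht.antisymm hle)
    have : halfSpaces (Subtype.val : H → Module.Dual ℝ W) 0 t =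
        dualCone fun k => ((e k : H) : Module.Dual ℝ W) := by
      ext x
      refine ⟨fun hx k => hx _ (e k).2, fun hx i hi => ?_⟩
      simpa using hx (e.symm ⟨i, hi⟩)
    rw [this]
    exact h _ (fun k => hH _ (e k : H).2) (hli.comp e e.injective)

omit [AddCommGroup W] [Module ℝ W] in
/-- A relation with coefficients `±1` expresses each of its terms by the others. -/
theorem mem_of_sum_powerset_eq_zero {ι : Type*} {G : AddSubgroup (W → ℂ)}
    {f : Finset ι → W → ℂ} {P : Finset (Finset ι)}
    (h : ∑ A ∈ P, (-1 : ℤ) ^ A.card • f A = 0) {A₀ : Finset ι} (hA₀ : A₀ ∈ P)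
    (hf : ∀ A ∈ P, A ≠ A₀ → f A ∈ G) : f A₀ ∈ G := by
  classical
  rw [← Finset.sum_erase_add _ _ hA₀] at h
  have h1 : (-1 : ℤ) ^ A₀.card • f A₀ ∈ G := by
    rw [← neg_eq_of_add_eq_zero_right h]
    exact neg_mem (sum_mem fun A hA => zsmul_mem
      (hf A (Finset.mem_erase.1 hA).2 (Finset.mem_erase.1 hA).1) _)
  have := zsmul_mem h1 ((-1 : ℤ) ^ A₀.card)
  rwa [smul_smul, ← mul_pow, neg_one_mul, neg_neg, one_pow, one_smul] at this

/-- The exchange step: modulo cones with lines, the facet normals of a simplicial cone can be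
exchanged, one at a time, for an integral form `θ = ∑ a_i η_i`, as soon as some `a_i` is positive. It
follows from the two relations given by the positive and the negative part of `∑ a_i η_i - θ = 0`. -/
theorem ind_dualCone_mem_of_update [DecidableEq κ] (hB : Submodule.span ℤ (Set.range B) = Λ)
    {G : AddSubgroup (W → ℂ)} (hG : (lineSpan Λ).toAddSubgroup ≤ G) {η : κ → Module.Dual ℝ W}
    (hη : ∀ i, η i ∈ dualLattice Λ) {θ : Module.Dual ℝ W} (hθ : θ ∈ dualLattice Λ) {a : κ → ℝ}
    (ha : θ = ∑ i, a i • η i) (hpos : ∃ i, 0 < a i)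
    (hup : ∀ j, a j ≠ 0 → ind (dualCone (Function.update η j θ)) ∈ G) : ind (dualCone η) ∈ G := by
  set ηo : Option κ → Module.Dual ℝ W := fun o => o.elim θ η with hηo
  have hηo' : ∀ o, ηo o ∈ dualLattice Λ := by
    intro o; cases o
    · exact hθ
    · exact hη _
  have hnone : halfSpaces ηo 0 (Finset.univ.erase none) = dualCone η := by
    ext x
    refine ⟨fun hx i => hx (some i) (by simp), fun hx o ho => ?_⟩
    cases o with
    | none => simp at ho
    | some i => exact hx i
  have hsome : ∀ j, halfSpaces ηo 0 (Finset.univ.erase (some j)) =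
      dualCone (Function.update η j θ) := by
    intro j
    ext x
    refine ⟨fun hx i => ?_, fun hx o ho => ?_⟩
    · by_cases hij : i = j
      · subst hij
        simpa [hηo] using hx none (by simp)
      · rw [Function.update_of_ne hij]
        exact hx (some i) (by simpa using hij)
    · cases o with
      | none => simpa [hηo] using hx j
      | some i =>
        have hij : i ≠ j := by simpa using ho
        simpa [hηo, Function.update_of_ne hij] using hx i
  have hθx : ∀ x, θ x = ∑ i, a i * η i x := fun x => by
    rw [ha, LinearMap.sum_apply]; simp
  -- a proper subset of the inequalities lacks one of them or gives a cone with a line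
  have hsub : ∀ U : Finset (Option κ), U ≠ Finset.univ →
      (∀ o, U = Finset.univ.erase o → ind (halfSpaces ηo 0 U) ∈ G) →
      ind (halfSpaces ηo 0 U) ∈ G := by
    intro U hU h
    by_cases hcard : U.card < Fintype.card κ
    · exact hG (ind_halfSpaces_mem_lineSpan hB hηo' hcard)
    · obtain ⟨o, ho⟩ : ∃ o, o ∉ U := by
        by_contra! hcon
        exact hU (Finset.eq_univ_of_forall hcon)
      refine h o (Finset.eq_of_subset_of_card_le (fun p hp => ?_) ?_)
      · exact Finset.mem_erase.2 ⟨fun h => ho (h ▸ hp), Finset.mem_univ p⟩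
      · rw [Finset.card_erase_of_mem (Finset.mem_univ o), Finset.card_univ, Fintype.card_option]
        omega
  -- the positive part: if `η_i x > 0` for all `a_i > 0`, and `η_i x ≤ 0` for the others, then
  -- `θ x > 0`; this expresses the intersection of all the half-spaces by smaller ones
  have hall : ind (halfSpaces ηo 0 Finset.univ) ∈ G := by
    set E : Finset (Option κ) := Finset.univ.filter fun o => ∃ i, o = some i ∧ 0 < a i with hE
    have hrel := sum_powerset_ind_halfSpaces (η := ηo) (b := 0) (E := E) (T := Eᶜ)
      disjoint_compl_right (fun x hx => by
        by_contra! hcon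
        have h1 : ∀ i, 0 < a i → 0 < η i x := fun i hi => hcon (some i) (by simp [hE, hi])
        have h2 : ∀ i, ¬ 0 < a i → η i x ≤ 0 := fun i hi => hx (some i) (by simpa [hE] using hi)
        have h3 : θ x ≤ 0 := hx none (by simp [hE])
        have h4 : 0 < θ x := by
          rw [hθx]
          obtain ⟨i, hi⟩ := hpos
          refine Finset.sum_pos' (fun j _ => ?_) ⟨i, Finset.mem_univ i, mul_pos hi (h1 i hi)⟩
          by_cases hj : 0 < a j
          · exact (mul_pos hj (h1 j hj)).le
          · exact mul_nonneg_of_nonpos_of_nonpos (not_lt.1 hj) (h2 j hj)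
        linarith)
    have := mem_of_sum_powerset_eq_zero (G := G) (f := fun A => ind (halfSpaces ηo 0 (A ∪ Eᶜ)))
      hrel (Finset.mem_powerset_self E) (fun A hA hAE => by
        have hAE' := Finset.mem_powerset.1 hA
        have hEA : ∀ o ∈ E, o ∈ A ∪ Eᶜ → o ∈ A := fun o ho h => by
          rcases Finset.mem_union.1 h with h | h
          · exact h
          · exact absurd ho (Finset.mem_compl.1 h)
        refine hsub _ (fun h => hAE (hAE'.antisymm fun o ho => hEA o ho (h ▸ Finset.mem_univ o))) ?_
        intro o ho
        have hoE : o ∈ E := by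
          by_contra hcon
          have : o ∈ A ∪ Eᶜ := Finset.mem_union_right _ (Finset.mem_compl.2 hcon)
          rw [ho] at this
          simp at this
        obtain ⟨i, rfl, hi⟩ := (Finset.mem_filter.1 hoE).2
        rw [ho, hsome]
        exact hup i hi.ne')
    simpa using this
  -- the negative part: if `θ x > 0` and `η_i x > 0` for all `a_i < 0`, then not all the other `η_i x` are
  -- nonpositive; here the term that omits only `θ` is the given cone
  set E : Finset (Option κ) :=
    insert none (Finset.univ.filter fun o => ∃ i, o = some i ∧ a i < 0) with hE
  have hrel := sum_powerset_ind_halfSpaces (η := ηo) (b := 0) (E := E) (T := Eᶜ)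
    disjoint_compl_right (fun x hx => by
      by_contra! hcon
      have h1 : ∀ i, a i < 0 → 0 < η i x := fun i hi => hcon (some i) (by simp [hE, hi])
      have h2 : ∀ i, ¬ a i < 0 → η i x ≤ 0 := fun i hi => hx (some i) (by simpa [hE] using hi)
      have h3 : 0 < θ x := hcon none (by simp [hE])
      have h4 : θ x ≤ 0 := by
        rw [hθx]
        refine Finset.sum_nonpos fun j _ => ?_
        by_cases hj : a j < 0
        · exact mul_nonpos_of_nonpos_of_nonneg hj.le (h1 j hj).le
        · exact mul_nonpos_of_nonneg_of_nonpos (not_lt.1 hj) (h2 j hj)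
      linarith)
  have hunion : E.erase none ∪ Eᶜ = Finset.univ.erase none := by
    ext o
    have hnE : none ∈ E := Finset.mem_insert_self _ _
    cases o with
    | none => simp [hnE]
    | some i => by_cases ho : some i ∈ E <;> simp [ho]
  have := mem_of_sum_powerset_eq_zero (G := G) (f := fun A => ind (halfSpaces ηo 0 (A ∪ Eᶜ)))
    (A₀ := E.erase none) hrel (Finset.mem_powerset.2 (Finset.erase_subset _ _)) (fun A hA hAE => by
      have hAE' := Finset.mem_powerset.1 hA
      by_cases huniv : A ∪ Eᶜ = Finset.univ
      · rw [huniv]; exact hall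
      refine hsub _ huniv fun o ho => ?_
      have hoE : o ∈ E := by
        by_contra hcon
        have : o ∈ A ∪ Eᶜ := Finset.mem_union_right _ (Finset.mem_compl.2 hcon)
        rw [ho] at this
        simp at this
      cases o with
      | none =>
        refine absurd ?_ hAE
        ext p
        refine ⟨fun hp => Finset.mem_erase.2 ⟨?_, hAE' hp⟩, fun hp => ?_⟩
        · rintro rfl
          have : none ∈ A ∪ Eᶜ := Finset.mem_union_left _ hp
          rw [ho] at this
          simp at this
        · have h1 : p ∈ A ∪ Eᶜ := by rw [ho]; simpa using (Finset.mem_erase.1 hp).1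
          rcases Finset.mem_union.1 h1 with h | h
          · exact h
          · exact absurd (Finset.mem_erase.1 hp).2 (Finset.mem_compl.1 h)
      | some i =>
        rw [ho, hsome]
        have hi : a i < 0 := by simpa [hE] using hoE
        exact hup i hi.ne)
  rwa [hunion, hnone] at this

end ConeDecomposition

/-! ### Cones with a face parallel to a subspace, and unimodular cones -/

section ExistsDecomposition

variable {W : Type*} [AddCommGroup W] [Module ℝ W] {κ : Type*} [Fintype κ]
  {B : Module.Basis κ ℝ W} {Λ : Submodule ℤ W}

theorem det_update_sum [DecidableEq κ] {E : Type*} [AddCommGroup E] [Module ℝ E]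
    (e : Module.Basis κ ℝ E) (η : κ → E) (a : κ → ℝ) (j : κ) :
    e.det (Function.update η j (∑ i, a i • η i)) = a j * e.det η := by
  rw [AlternatingMap.map_update_sum, Finset.sum_eq_single j]
  · rw [AlternatingMap.map_update_smul, Function.update_eq_self, smul_eq_mul]
  · intro i _ hij
    rw [AlternatingMap.map_update_smul, AlternatingMap.map_update_self _ _ hij.symm, smul_zero]
  · simp

theorem linearIndependent_iff_det_ne_zero [DecidableEq κ] {E : Type*} [AddCommGroup E] [Module ℝ E]
    (e : Module.Basis κ ℝ E) (η : κ → E) : LinearIndependent ℝ η ↔ e.det η ≠ 0 := by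
  rw [← isUnit_iff_ne_zero, ← e.is_basis_iff_det]
  refine ⟨fun h => ⟨h, ?_⟩, fun h => h.1⟩
  have : FiniteDimensional ℝ E := Module.Finite.of_basis e
  exact h.span_eq_top_of_card_eq_finrank' (Module.finrank_eq_card_basis e).symm

theorem exists_eq_sum_of_linearIndependent {E : Type*} [AddCommGroup E] [Module ℝ E]
    (e : Module.Basis κ ℝ E) {η : κ → E} (h : LinearIndependent ℝ η) (θ : E) :
    ∃ a : κ → ℝ, θ = ∑ i, a i • η i := by
  have : FiniteDimensional ℝ E := Module.Finite.of_basis e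
  let b := basisOfLinearIndependentOfCardEqFinrank' η h (Module.finrank_eq_card_basis e).symm
  refine ⟨b.repr θ, ?_⟩
  conv_lhs => rw [← b.sum_repr θ]
  simp [b]

/-- Every simplicial cone is a signed combination of simplicial cones with a face parallel to `L`:
an integral form `θ` vanishing on `L`, and on the edges opposite to the facets already parallel to
`L`, can only be exchanged for the normal of another facet. -/
theorem ind_dualCone_mem_of_parallel (hB : Submodule.span ℤ (Set.range B) = Λ)
    {G : AddSubgroup (W → ℂ)} (hG : (lineSpan Λ).toAddSubgroup ≤ G) {L : Submodule ℝ W}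
    (hL : IsRationalSubspace Λ L)
    (h : ∀ η : κ → Module.Dual ℝ W, (∀ i, η i ∈ dualLattice Λ) → LinearIndependent ℝ η →
      Set.ncard {i | ∃ x ∈ L, η i x ≠ 0} ≤ Module.finrank ℝ L → ind (dualCone η) ∈ G)
    {η : κ → Module.Dual ℝ W} (hη : ∀ i, η i ∈ dualLattice Λ) (hli : LinearIndependent ℝ η) :
    ind (dualCone η) ∈ G := by
  classical
  have : FiniteDimensional ℝ W := Module.Finite.of_basis B
  induction hn : Set.ncard {i | ∃ x ∈ L, η i x ≠ 0} using Nat.strong_induction_on generalizing η with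
  | _ n ih =>
  by_cases hle : Set.ncard {i | ∃ x ∈ L, η i x ≠ 0} ≤ Module.finrank ℝ L
  · exact h η hη hli hle
  -- `θ` has to vanish on a basis of `L` and on the edges `v i` with `η i` zero on `L`; these are
  -- fewer conditions than the dimension, as more than `dim L` normals are nonzero on `L`
  obtain ⟨v, hv, hneg, hzero, hrepr⟩ := exists_basis_of_linearIndependent_dual hB hη hli rfl
  obtain ⟨u, hu, huspan, -⟩ := Submodule.exists_fun_fin_finrank_span_eq ℝ ((L : Set W) ∩ (Λ : Set W))
  have hcomp : Fintype.card {i // ¬ ∃ x ∈ L, η i x ≠ 0} +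
      Set.ncard {i | ∃ x ∈ L, η i x ≠ 0} = Fintype.card κ := by
    have h1 : Set.ncard {i | ∃ x ∈ L, η i x ≠ 0} = Fintype.card {i // ∃ x ∈ L, η i x ≠ 0} := by
      rw [← Nat.card_coe_set_eq, Nat.card_eq_fintype_card]; rfl
    rw [h1, Fintype.card_subtype_compl]
    have := Fintype.card_subtype_le fun i => ∃ x ∈ L, η i x ≠ 0
    omega
  obtain ⟨θ, hθ, hθ0, hθu⟩ := exists_dual_ne_zero hB
    (u := Sum.elim u fun i : {i // ¬ ∃ x ∈ L, η i x ≠ 0} => v i)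
    (fun a => by
      cases a with
      | inl a => exact (hu a).2
      | inr i => exact hv i)
    (by
      rw [Fintype.card_sum, Fintype.card_fin, hL]
      omega)
  have hθL : ∀ x ∈ L, θ x = 0 := by
    intro x hx
    rw [← hL, ← huspan] at hx
    induction hx using Submodule.span_induction with
    | mem y hy => obtain ⟨a, rfl⟩ := hy; exact hθu (Sum.inl a)
    | zero => simp
    | add y z _ _ hy hz => simp [hy, hz]
    | smul a y _ hy => simp [hy]
  obtain ⟨a, ha⟩ := exists_eq_sum_of_linearIndependent B.dualBasis hli θ
  have hav : ∀ j, θ (v j) = a j * η j (v j) := by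
    intro j
    rw [ha, LinearMap.sum_apply, Finset.sum_eq_single j]
    · simp
    · intro i _ hij
      simp [hzero i j hij]
    · simp
  -- only a normal that is nonzero on `L` is exchanged, which lowers the number of these
  have hstep : ∀ (θ : Module.Dual ℝ W) (a : κ → ℝ), θ ∈ dualLattice Λ → (∀ x ∈ L, θ x = 0) →
      θ = ∑ i, a i • η i → (∀ j, θ (v j) = a j * η j (v j)) →
      (∀ i : {i // ¬ ∃ x ∈ L, η i x ≠ 0}, θ (v i) = 0) →
      (∃ i, 0 < a i) → ind (dualCone η) ∈ G := by
    intro θ a hθ hθL ha hav hθv hpos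
    refine ind_dualCone_mem_of_update hB hG hη hθ ha hpos fun j hj => ?_
    have hjL : ∃ x ∈ L, η j x ≠ 0 := by
      by_contra hcon
      have := hθv ⟨j, hcon⟩
      rw [hav] at this
      exact mul_ne_zero hj (hneg j).ne this
    refine ih (Set.ncard {i | ∃ x ∈ L, Function.update η j θ i x ≠ 0}) ?_ (fun i => ?_) ?_ rfl
    · rw [← hn]
      refine Set.ncard_lt_ncard ?_ (Set.toFinite _)
      refine (Set.ssubset_iff_of_subset fun i hi => ?_).2 ⟨j, hjL, fun hcon => ?_⟩
      · obtain ⟨x, hx, hne⟩ := hi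
        by_cases hij : i = j
        · subst hij; exact hjL
        · rw [Function.update_of_ne hij] at hne
          exact ⟨x, hx, hne⟩
      · obtain ⟨x, hx, hne⟩ := hcon
        rw [Function.update_self] at hne
        exact hne (hθL x hx)
    · by_cases hij : i = j
      · subst hij; simpa using hθ
      · rw [Function.update_of_ne hij]; exact hη i
    · rw [linearIndependent_iff_det_ne_zero B.dualBasis, ha, det_update_sum]
      exact mul_ne_zero hj ((linearIndependent_iff_det_ne_zero B.dualBasis η).1 hli)
  have hex : ∃ i, a i ≠ 0 := by
    by_contra! hcon
    exact hθ0 (by rw [ha]; simp [hcon])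
  obtain ⟨i, hi⟩ := hex
  rcases lt_or_gt_of_ne hi with hi | hi
  · refine hstep (-θ) (-a) (neg_mem_dualLattice hθ) (fun x hx => by simp [hθL x hx]) ?_
      (fun j => by simp [hav]) (fun i => by simpa using hθu (Sum.inr i)) ⟨i, by simpa using hi⟩
    ext x
    simp [ha, LinearMap.sum_apply]
  · exact hstep θ a hθ hθL ha hav (fun i => hθu (Sum.inr i)) ⟨i, hi⟩

/-- Every simplicial cone is a signed combination of unimodular cones: if its facet normals do not
span the dual lattice, one of them can be exchanged for an integral form whose coefficients in the
normals lie in `[0, 1)`, which lowers the index. -/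
theorem ind_dualCone_mem_of_unimodular (hB : Submodule.span ℤ (Set.range B) = Λ)
    {G : AddSubgroup (W → ℂ)} (hG : (lineSpan Λ).toAddSubgroup ≤ G)
    (h : ∀ η : κ → Module.Dual ℝ W, (∀ i, η i ∈ dualLattice Λ) → LinearIndependent ℝ η →
      (∀ k, ∃ n : κ → ℤ, B.coord k = ∑ i, (n i : ℝ) • η i) → ind (dualCone η) ∈ G)
    {η : κ → Module.Dual ℝ W} (hη : ∀ i, η i ∈ dualLattice Λ) (hli : LinearIndependent ℝ η) :
    ind (dualCone η) ∈ G := by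
  classical
  -- the determinant of the normals in the dual lattice basis, up to sign their index, is an integer
  have hint : ∀ η : κ → Module.Dual ℝ W, (∀ i, η i ∈ dualLattice Λ) →
      ∃ z : ℤ, B.dualBasis.det η = z := by
    intro η hη
    choose A hA using fun i k => hη i (B k) (basis_mem hB k)
    refine ⟨(Matrix.of fun k i => A i k).det, ?_⟩
    rw [Module.Basis.det_apply, Int.cast_det]
    congr 1
    ext k i
    rw [Module.Basis.toMatrix_apply, Module.Basis.dualBasis_repr, hA]
    rfl
  obtain ⟨z, hz⟩ := hint η hη
  induction hn : z.natAbs using Nat.strong_induction_on generalizing η z with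
  | _ n ih =>
  by_cases hspan : ∀ k, ∃ n : κ → ℤ, B.coord k = ∑ i, (n i : ℝ) • η i
  · exact h η hη hli hspan
  push Not at hspan
  obtain ⟨k, hk⟩ := hspan
  obtain ⟨a, ha⟩ := exists_eq_sum_of_linearIndependent B.dualBasis hli (B.coord k)
  -- a vector of the dual lattice outside the span of the normals, reduced modulo this span
  set θ : Module.Dual ℝ W := ∑ i, Int.fract (a i) • η i with hθ
  have hθΛ : θ ∈ dualLattice Λ := by
    have : θ = B.coord k + ∑ i, ((-⌊a i⌋ : ℤ) : ℝ) • η i := by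
      rw [ha, hθ, ← Finset.sum_add_distrib]
      refine Finset.sum_congr rfl fun i _ => ?_
      rw [← add_smul, Int.fract]
      push_cast
      rfl
    rw [this]
    exact add_mem_dualLattice (coord_mem_dualLattice hB k)
      (sum_mem_dualLattice _ fun i _ => zsmul_mem_dualLattice (hη i) _)
  have hpos : ∃ i, 0 < Int.fract (a i) := by
    by_contra! hcon
    refine hk (fun i => ⌊a i⌋) ?_
    rw [ha]
    refine Finset.sum_congr rfl fun i _ => ?_
    have := (hcon i).antisymm (Int.fract_nonneg _)
    rw [Int.fract, sub_eq_zero] at this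
    rw [← this]
  refine ind_dualCone_mem_of_update hB hG hη hθΛ hθ hpos fun j hj => ?_
  have hη' : ∀ i, Function.update η j θ i ∈ dualLattice Λ := by
    intro i
    by_cases hij : i = j
    · subst hij; simpa using hθΛ
    · rw [Function.update_of_ne hij]; exact hη i
  -- the exchange multiplies the determinant by a coefficient of `θ`, which is less than `1`
  have hdet : B.dualBasis.det (Function.update η j θ) = Int.fract (a j) * B.dualBasis.det η := by
    rw [hθ, det_update_sum]
  have hne := (linearIndependent_iff_det_ne_zero B.dualBasis η).1 hli
  obtain ⟨z', hz'⟩ := hint _ hη'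
  refine ih z'.natAbs ?_ hη' ?_ z' hz' rfl
  · rw [← hn]
    zify
    have : |(z' : ℝ)| < |(z : ℝ)| := by
      rw [← hz', ← hz, hdet, abs_mul, abs_of_nonneg (Int.fract_nonneg _)]
      exact mul_lt_of_lt_one_left (abs_pos.2 hne) (Int.fract_lt_one _)
    exact_mod_cast this
  · rw [linearIndependent_iff_det_ne_zero B.dualBasis, hdet]
    exact mul_ne_zero hj hne

theorem dualCone_eq_coneHull {ι : Type*} [Fintype ι] {η : ι → Module.Dual ℝ W}
    {v : Module.Basis ι ℝ W} (hneg : ∀ i, η i (v i) < 0)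
    (hrepr : ∀ i x, η i x = v.repr x i * η i (v i)) : dualCone η = coneHull v := by
  ext x
  refine ⟨fun hx => ⟨v.repr x, fun i => ?_, (v.sum_repr x).symm⟩, ?_⟩
  · have := hx i
    rw [hrepr] at this
    by_contra! hcon
    exact absurd (mul_pos_of_neg_of_neg hcon (hneg i)) (not_lt.2 this)
  · rintro ⟨t, ht, rfl⟩ i
    rw [hrepr, v.repr_sum_self]
    exact mul_nonpos_of_nonneg_of_nonpos (ht i) (hneg i).le

theorem mem_coneHull_basis {ι : Type*} [Fintype ι] {v : Module.Basis ι ℝ W} {x : W} :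
    x ∈ coneHull v ↔ ∀ i, 0 ≤ v.repr x i := by
  refine ⟨?_, fun h => ⟨v.repr x, h, (v.sum_repr x).symm⟩⟩
  rintro ⟨t, ht, rfl⟩ i
  rw [v.repr_sum_self]
  exact ht i

/-- The quotient lattice is spanned by a basis of the quotient space. -/
theorem exists_basis_projectedLattice (hB : Submodule.span ℤ (Set.range B) = Λ) {L : Submodule ℝ W}
    (hL : IsRationalSubspace Λ L) :
    ∃ C : Module.Basis (Fin (Module.finrank ℝ (W ⧸ L))) ℝ (W ⧸ L),
      Submodule.span ℤ (Set.range C) = projectedLattice Λ L := by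
  have : FiniteDimensional ℝ W := Module.Finite.of_basis B
  have hfg : (projectedLattice Λ L).FG := by
    refine Submodule.FG.map _ ?_
    rw [← hB]
    exact Submodule.fg_span (Set.finite_range B)
  have : Module.Finite ℤ (projectedLattice Λ L) := Module.Finite.of_fg hfg
  have : Module.IsTorsionFree ℤ (projectedLattice Λ L) := by
    have : Module.IsTorsionFree ℤ (W ⧸ L) := .trans ℝ
    exact (projectedLattice Λ L).subtype_injective.moduleIsTorsionFree _ fun _ _ => rfl
  have : Module.Free ℤ (projectedLattice Λ L) := Module.free_of_finite_type_torsion_free'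
  let c := Module.finBasis ℤ (projectedLattice Λ L)
  set r := Module.finrank ℤ (projectedLattice Λ L)
  have hcspan : Submodule.span ℤ (Set.range fun i => (c i : W ⧸ L)) = projectedLattice Λ L := by
    have := congrArg (Submodule.map (projectedLattice Λ L).subtype) c.span_eq
    rw [Submodule.map_span, Submodule.map_top, Submodule.range_subtype, ← Set.range_comp] at this
    exact this
  have htop : ⊤ ≤ Submodule.span ℝ (Set.range fun i => (c i : W ⧸ L)) := by
    rintro y -
    obtain ⟨x, rfl⟩ := L.mkQ_surjective y
    rw [← B.sum_repr x, map_sum]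
    refine Submodule.sum_mem _ fun k _ => ?_
    rw [map_smul]
    refine Submodule.smul_mem _ _ ?_
    have h1 : L.mkQ (B k) ∈ projectedLattice Λ L := ⟨B k, basis_mem hB k, rfl⟩
    rw [← hcspan] at h1
    exact Submodule.span_subset_span ℤ ℝ _ h1
  -- if the rank were larger, lifts of the `c i` and a basis of `L` in `L ∩ Λ` would satisfy an
  -- integral relation; here rationality of `L` is needed
  have hle : r ≤ Module.finrank ℝ (W ⧸ L) := by
    by_contra! hlt
    choose g hg hgc using fun i => (c i).2
    obtain ⟨u, hu, huspan, huli⟩ :=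
      Submodule.exists_fun_fin_finrank_span_eq ℝ ((L : Set W) ∩ (Λ : Set W))
    have hdim := L.finrank_quotient_add_finrank
    have hL' : Module.finrank ℝ (Submodule.span ℝ ((L : Set W) ∩ (Λ : Set W))) =
      Module.finrank ℝ L := by rw [hL]
    rw [Module.finrank_eq_card_basis B] at hdim
    obtain ⟨n, hn, hrel⟩ := exists_int_relation hB (u := Sum.elim u g)
      (fun a => by
        cases a with
        | inl a => exact (hu a).2
        | inr i => exact hg i)
      (by rw [Fintype.card_sum, Fintype.card_fin, Fintype.card_fin]; omega)
    rw [Fintype.sum_sum_type] at hrel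
    simp only [Sum.elim_inl, Sum.elim_inr] at hrel
    have h1 : ∑ i, n (Sum.inr i) • c i = 0 := by
      have h2 := congrArg L.mkQ hrel
      rw [map_add, map_zero, map_sum, map_sum, Finset.sum_eq_zero, zero_add] at h2
      · apply Subtype.ext
        rw [Submodule.coe_sum, Submodule.coe_zero, ← h2]
        refine Finset.sum_congr rfl fun i _ => ?_
        rw [Submodule.coe_smul, map_smul, Int.cast_smul_eq_zsmul, ← hgc i]
        rfl
      · intro a _
        rw [map_smul, Submodule.mkQ_apply, (Submodule.Quotient.mk_eq_zero L).2 (hu a).1, smul_zero]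
    have h2 := Fintype.linearIndependent_iff.1 c.linearIndependent _ h1
    simp only [h2, Int.cast_zero, zero_smul, Finset.sum_const_zero, add_zero] at hrel
    have h3 := Fintype.linearIndependent_iff.1 huli _ hrel
    apply hn
    funext a
    cases a with
    | inl a => exact_mod_cast h3 a
    | inr i => exact h2 i
  have hge : Module.finrank ℝ (W ⧸ L) ≤ r := by
    have := finrank_range_le_card (R := ℝ) fun i => (c i : W ⧸ L)
    rw [Set.finrank, top_le_iff.1 htop, finrank_top, Fintype.card_fin] at this
    exact this
  have hr : r = Module.finrank ℝ (W ⧸ L) := hle.antisymm hge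
  let e := finCongr hr
  refine ⟨Module.Basis.mk (v := fun i => (c (e.symm i) : W ⧸ L)) ?_ ?_, ?_⟩
  · exact (linearIndependent_of_top_le_span_of_card_eq_finrank htop (by simpa using hr)).comp _
      e.symm.injective
  · have : Set.range (fun i => (c (e.symm i) : W ⧸ L)) = Set.range fun i => (c i : W ⧸ L) :=
      e.symm.surjective.range_comp fun i => (c i : W ⧸ L)
    rw [this]
    exact htop
  · rw [Module.Basis.coe_mk]
    refine Eq.trans (congrArg _ ?_) hcspan
    exact e.symm.surjective.range_comp fun i => (c i : W ⧸ L)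

end ExistsDecomposition

/-! ### Bases adapted to a subspace -/

section AdaptedBasis

variable {W : Type*} [AddCommGroup W] [Module ℝ W] {L : Submodule ℝ W} {ι₁ ι₂ : Type*} [Fintype ι₁]
  [Fintype ι₂]

theorem linearIndependent_sumElim_lift (f : Module.Basis ι₁ ℝ L) (v : Module.Basis ι₂ ℝ (W ⧸ L))
    {g : ι₂ → W} (hg : ∀ k, L.mkQ (g k) = v k) :
    LinearIndependent ℝ (Sum.elim (fun i => (f i : W)) g) := by
  rw [Fintype.linearIndependent_iff]
  intro a ha
  rw [Fintype.sum_sum_type] at ha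
  simp only [Sum.elim_inl, Sum.elim_inr] at ha
  have h1 : ∀ i, L.mkQ (f i : W) = 0 := fun i => by simp
  have h2 := congrArg L.mkQ ha
  simp only [map_add, map_sum, map_smul, h1, hg, smul_zero, Finset.sum_const_zero, zero_add,
    map_zero] at h2
  have h3 := Fintype.linearIndependent_iff.1 v.linearIndependent _ h2
  simp only [h3, zero_smul, Finset.sum_const_zero, add_zero] at ha
  have h4 : ∑ i, a (Sum.inl i) • f i = 0 := by
    apply Subtype.ext
    rw [Submodule.coe_sum, Submodule.coe_zero, ← ha]
    rfl
  have h5 := Fintype.linearIndependent_iff.1 f.linearIndependent _ h4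
  rintro (i | k)
  · exact h5 i
  · exact h3 k

theorem top_le_span_sumElim_lift (f : Module.Basis ι₁ ℝ L) (v : Module.Basis ι₂ ℝ (W ⧸ L))
    {g : ι₂ → W} (hg : ∀ k, L.mkQ (g k) = v k) :
    ⊤ ≤ Submodule.span ℝ (Set.range (Sum.elim (fun i => (f i : W)) g)) := by
  rintro x -
  have hy : x - ∑ k, v.repr (L.mkQ x) k • g k ∈ L := by
    rw [← Submodule.Quotient.mk_eq_zero, ← Submodule.mkQ_apply, map_sub, map_sum]
    simp only [map_smul, hg]
    rw [v.sum_repr, sub_self]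
  have hx : x = ((∑ i, f.repr ⟨_, hy⟩ i • f i : L) : W) + ∑ k, v.repr (L.mkQ x) k • g k := by
    rw [f.sum_repr]; simp
  rw [hx, Submodule.coe_sum]
  refine add_mem (sum_mem fun i _ => ?_) (sum_mem fun k _ => ?_)
  · exact Submodule.smul_mem _ _ (Submodule.subset_span ⟨Sum.inl i, rfl⟩)
  · exact Submodule.smul_mem _ _ (Submodule.subset_span ⟨Sum.inr k, rfl⟩)

/-- The basis of `W` made of a basis of `L` and lifts of a basis of `W / L`. -/
def adaptedBasis (f : Module.Basis ι₁ ℝ L) (v : Module.Basis ι₂ ℝ (W ⧸ L)) (g : ι₂ → W)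
    (hg : ∀ k, L.mkQ (g k) = v k) : Module.Basis (ι₁ ⊕ ι₂) ℝ W :=
  Module.Basis.mk (linearIndependent_sumElim_lift f v hg) (top_le_span_sumElim_lift f v hg)

variable (f : Module.Basis ι₁ ℝ L) (v : Module.Basis ι₂ ℝ (W ⧸ L)) {g : ι₂ → W}
    (hg : ∀ k, L.mkQ (g k) = v k)

theorem adaptedBasis_inl (i : ι₁) : adaptedBasis f v g hg (Sum.inl i) = f i := by
  simp [adaptedBasis]

theorem adaptedBasis_inr (k : ι₂) : adaptedBasis f v g hg (Sum.inr k) = g k := by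
  simp [adaptedBasis]

theorem eq_sum_adaptedBasis (x : W) :
    x = ∑ i, (adaptedBasis f v g hg).repr x (Sum.inl i) • (f i : W) +
      ∑ k, (adaptedBasis f v g hg).repr x (Sum.inr k) • g k := by
  conv_lhs => rw [← (adaptedBasis f v g hg).sum_repr x, Fintype.sum_sum_type]
  simp only [adaptedBasis_inl, adaptedBasis_inr]

theorem adaptedBasis_repr_inr (x : W) (k : ι₂) :
    (adaptedBasis f v g hg).repr x (Sum.inr k) = v.repr (L.mkQ x) k := by
  have h1 : ∀ i, L.mkQ (f i : W) = 0 := fun i => by simp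
  have := congrArg L.mkQ (eq_sum_adaptedBasis f v hg x)
  simp only [map_add, map_sum, map_smul, h1, hg, smul_zero, Finset.sum_const_zero, zero_add] at this
  rw [this, v.repr_sum_self]

end AdaptedBasis

/-! ### Pulling back cones from a quotient -/

section Pullback

variable {W : Type*} [AddCommGroup W] [Module ℝ W] {κ : Type*} [Fintype κ]
  {B : Module.Basis κ ℝ W} {Λ : Submodule ℤ W} {L : Submodule ℝ W} {ι : Type*} [Fintype ι]
  (e : Module.Basis ι ℝ W) (face : Set ι)

/-- The points of `W` whose coordinates along the edges of the face are nonnegative and whose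
projection to `W / L` lies in `u`. -/
def pullCone (L : Submodule ℝ W) (u : Set (W ⧸ L)) : Set W :=
  {x | (∀ j ∈ face, 0 ≤ e.repr x j) ∧ L.mkQ x ∈ u}

/-- The linear extension of `pullCone` from indicators to functions. -/
def pullFun (L : Submodule ℝ W) : (W ⧸ L → ℂ) →ₗ[ℂ] (W → ℂ) where
  toFun h x := ind {x | ∀ j ∈ face, 0 ≤ e.repr x j} x * h (L.mkQ x)
  map_add' h k := by funext x; simp [mul_add]
  map_smul' c h := by funext x; simp [mul_left_comm]

theorem pullFun_ind (u : Set (W ⧸ L)) : pullFun e face L (ind u) = ind (pullCone e face L u) := by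
  classical
  funext x
  simp only [pullFun, ind, LinearMap.coe_mk, AddHom.coe_mk, Set.indicator_apply, pullCone,
    Set.mem_ofPred_eq, Pi.one_apply]
  by_cases h1 : ∀ j ∈ face, 0 ≤ e.repr x j
  · by_cases h2 : L.mkQ x ∈ u
    · rw [if_pos h1, if_pos h2, if_pos ⟨h1, h2⟩, one_mul]
    · rw [if_neg h2, mul_zero, if_neg fun h => h2 h.2]
  · rw [if_neg h1, zero_mul, if_neg fun h => h1 h.1]

theorem isRationalCone_pullCone (hB : Submodule.span ℤ (Set.range B) = Λ) (he : ∀ i, e i ∈ Λ)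
    {u : Set (W ⧸ L)} (hu : IsRationalCone (projectedLattice Λ L) u) :
    IsRationalCone Λ (pullCone e face L u) := by
  obtain ⟨N, hN, hNe⟩ := exists_smul_coord_mem hB e he
  obtain ⟨H, hfin, hH, rfl⟩ := hu
  refine ⟨(fun η => η.comp L.mkQ) '' H ∪ (fun j => -((N : ℝ) • e.coord j)) '' face,
    (hfin.image _).union ((Set.toFinite face).image _), ?_, ?_⟩
  · rintro η (⟨θ, hθ, rfl⟩ | ⟨j, -, rfl⟩)
    · exact fun x hx => hH θ hθ (L.mkQ x) ⟨x, hx, rfl⟩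
    · exact neg_mem_dualLattice (hNe j)
  · have hN' : (0 : ℝ) < N := by exact_mod_cast hN
    have hiff : ∀ x j, (-((N : ℝ) • e.coord j)) x ≤ 0 ↔ 0 ≤ e.repr x j := by
      intro x j
      rw [LinearMap.neg_apply, LinearMap.smul_apply, smul_eq_mul, e.coord_apply, neg_nonpos]
      exact mul_nonneg_iff_of_pos_left hN'
    ext x
    refine ⟨fun hx η hη => ?_, fun hx => ⟨fun j hj => ?_, fun θ hθ => ?_⟩⟩
    · rcases hη with ⟨θ, hθ, rfl⟩ | ⟨j, hj, rfl⟩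
      · exact hx.2 θ hθ
      · exact (hiff x j).2 (hx.1 j hj)
    · exact (hiff x j).1 (hx _ (Or.inr ⟨j, hj, rfl⟩))
    · exact hx _ (Or.inl ⟨θ, hθ, rfl⟩)

variable {e face}

theorem repr_eq_zero_of_mem (hspan : Submodule.span ℝ (e '' face) = L) {x : W} (hx : x ∈ L) {j : ι}
    (hj : j ∉ face) : e.repr x j = 0 := by
  rw [← hspan] at hx
  by_contra hne
  exact hj (e.mem_span_image.1 hx (Finsupp.mem_support_iff.2 hne))

/-- Every class modulo `L` has a representative without components along the edges of the face. -/
theorem exists_lift (hspan : Submodule.span ℝ (e '' face) = L) (y : W ⧸ L) :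
    ∃ x, L.mkQ x = y ∧ ∀ j ∈ face, e.repr x j = 0 := by
  classical
  obtain ⟨x, rfl⟩ := L.mkQ_surjective y
  refine ⟨∑ j, (if j ∈ face then 0 else e.repr x j) • e j, ?_, fun j hj => ?_⟩
  · rw [← sub_eq_zero, ← map_sub, Submodule.mkQ_apply, Submodule.Quotient.mk_eq_zero]
    have hsub : ∑ j, (if j ∈ face then 0 else e.repr x j) • e j - x =
        ∑ j, ((if j ∈ face then 0 else e.repr x j) • e j - e.repr x j • e j) := by
      rw [Finset.sum_sub_distrib, e.sum_repr]
    rw [hsub]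
    refine sum_mem fun j _ => ?_
    by_cases hj : j ∈ face
    · rw [if_pos hj, zero_smul, zero_sub]
      exact neg_mem (Submodule.smul_mem _ _ (hspan ▸ Submodule.subset_span ⟨j, hj, rfl⟩))
    · rw [if_neg hj, sub_self]; exact zero_mem _
  · rw [e.repr_sum_self, if_pos hj]

/-- The pullback respects congruence modulo cones with lines: a line in the projected cone lifts to a
line in the pullback, if the lifts are chosen without components along the edges of the face. -/
theorem pullFun_congr (hB : Submodule.span ℤ (Set.range B) = Λ) (he : ∀ i, e i ∈ Λ)
    (hspan : Submodule.span ℝ (e '' face) = L) {h k : W ⧸ L → ℂ}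
    (hhk : CongrModLines (projectedLattice Λ L) h k) :
    CongrModLines Λ (pullFun e face L h) (pullFun e face L k) := by
  rw [CongrModLines, ← map_sub]
  change h - k ∈ Submodule.comap (pullFun e face L) (lineSpan Λ)
  refine Submodule.span_le.2 ?_ hhk
  rintro _ ⟨u, hu, ⟨y, w, hw, hline⟩, rfl⟩
  obtain ⟨x, hx, hxf⟩ := exists_lift hspan y
  obtain ⟨z, hz, hzf⟩ := exists_lift hspan w
  rw [SetLike.mem_coe, Submodule.mem_comap, pullFun_ind]
  refine Submodule.subset_span ⟨_, isRationalCone_pullCone e face hB he hu, ⟨x, z, ?_, ?_⟩, rfl⟩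
  · rintro rfl
    exact hw (by rw [← hz, map_zero])
  · intro t
    refine ⟨fun j hj => ?_, ?_⟩
    · simp [hxf j hj, hzf j hj]
    · rw [map_add, map_smul, hx, hz]
      exact hline t

theorem pullCone_image_coneHull (hspan : Submodule.span ℝ (e '' face) = L) :
    pullCone e face L (L.mkQ '' coneHull e) = coneHull e := by
  ext x
  refine ⟨?_, fun hx => ⟨fun j _ => mem_coneHull_basis.1 hx j, x, hx, rfl⟩⟩
  rintro ⟨h1, z, hz, hzx⟩
  refine mem_coneHull_basis.2 fun j => ?_
  by_cases hj : j ∈ face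
  · exact h1 j hj
  · have hmem : x - z ∈ L := by
      rw [← Submodule.Quotient.mk_eq_zero, ← Submodule.mkQ_apply, map_sub, hzx, sub_self]
    have := repr_eq_zero_of_mem hspan hmem hj
    rw [map_sub, Finsupp.sub_apply, sub_eq_zero] at this
    rw [this]
    exact mem_coneHull_basis.1 hz j

theorem isRationalCone_image_coneHull (hB : Submodule.span ℤ (Set.range B) = Λ)
    (he : ∀ i, e i ∈ Λ) (hspan : Submodule.span ℝ (e '' face) = L) :
    IsRationalCone (projectedLattice Λ L) (L.mkQ '' coneHull e) := by
  obtain ⟨N, hN, hNe⟩ := exists_smul_coord_mem hB e he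
  have hN' : (0 : ℝ) < N := by exact_mod_cast hN
  have hker : ∀ j : {j // j ∉ face}, L ≤ LinearMap.ker (-((N : ℝ) • e.coord j)) := by
    intro j x hx
    simp [repr_eq_zero_of_mem hspan hx j.2]
  refine ⟨Set.range fun j : {j // j ∉ face} => L.liftQ (-((N : ℝ) • e.coord j)) (hker j),
    Set.finite_range _, ?_, ?_⟩
  · rintro _ ⟨j, rfl⟩ _ ⟨x, hx, rfl⟩
    exact neg_mem_dualLattice (hNe j) x hx
  · ext y
    constructor
    · rintro ⟨x, hx, rfl⟩ _ ⟨j, rfl⟩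
      have := mem_coneHull_basis.1 hx j
      simp only [Submodule.mkQ_apply, Submodule.liftQ_apply, LinearMap.neg_apply,
        LinearMap.smul_apply, smul_eq_mul, e.coord_apply]
      have := mul_nonneg hN'.le this
      linarith
    · intro hy
      obtain ⟨x, rfl, hx⟩ := exists_lift hspan y
      refine ⟨x, mem_coneHull_basis.2 fun j => ?_, rfl⟩
      by_cases hj : j ∈ face
      · rw [hx j hj]
      · have := hy _ ⟨⟨j, hj⟩, rfl⟩
        simp only [Submodule.mkQ_apply, Submodule.liftQ_apply, LinearMap.neg_apply,
          LinearMap.smul_apply, smul_eq_mul, e.coord_apply] at this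
        by_contra! hcon
        have := mul_neg_of_pos_of_neg hN' hcon
        linarith

/-- The edges of the face as a basis of `L`. -/
def faceBasis (hspan : Submodule.span ℝ (e '' face) = L) : Module.Basis face ℝ L :=
  Module.Basis.mk (v := fun j : face => (⟨e j, hspan ▸ Submodule.subset_span ⟨j, j.2, rfl⟩⟩ : L))
    (by
      refine LinearIndependent.of_comp L.subtype ?_
      exact e.linearIndependent.comp _ Subtype.val_injective)
    (by
      rintro ⟨x, hx⟩ -
      have h1 := hx
      rw [← hspan, Set.image_eq_range] at h1
      have : Submodule.span ℝ (Set.range fun j : face => e j) =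
          (Submodule.span ℝ (Set.range fun j : face =>
            (⟨e j, hspan ▸ Submodule.subset_span ⟨j, j.2, rfl⟩⟩ : L))).map L.subtype := by
        rw [Submodule.map_span, ← Set.range_comp]; rfl
      rw [this] at h1
      obtain ⟨y, hy, hyx⟩ := h1
      rwa [← show y = ⟨x, hx⟩ from Subtype.ext hyx])

theorem faceBasis_apply (hspan : Submodule.span ℝ (e '' face) = L) (j : face) :
    ((faceBasis hspan j : L) : W) = e j := by simp [faceBasis]

/-- The pullback of a simplicial cone is the cone on the edges of the face and the lifts of the edges
without components along the face. -/
theorem pullCone_coneHull [Fintype face] (hspan : Submodule.span ℝ (e '' face) = L) {ι₂ : Type*}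
    [Fintype ι₂] (v : Module.Basis ι₂ ℝ (W ⧸ L)) {g : ι₂ → W} (hg : ∀ k, L.mkQ (g k) = v k)
    (hgf : ∀ k, ∀ j ∈ face, e.repr (g k) j = 0) :
    pullCone e face L (coneHull v) = coneHull (adaptedBasis (faceBasis hspan) v g hg) := by
  classical
  ext x
  have hinl : ∀ j : face, (adaptedBasis (faceBasis hspan) v g hg).repr x (Sum.inl j) =
      e.repr x j := by
    intro j
    conv_rhs => rw [eq_sum_adaptedBasis (faceBasis hspan) v hg x]
    simp only [map_add, map_sum, map_smul, faceBasis_apply, Finsupp.add_apply,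
      Finsupp.coe_finsetSum, Finset.sum_apply, Finsupp.smul_apply, hgf _ j j.2, smul_zero,
      Finset.sum_const_zero, add_zero]
    rw [Finset.sum_eq_single j]
    · simp
    · intro i _ hij
      have : (i : ι) ≠ j := fun h => hij (Subtype.ext h)
      simp [this]
    · simp
  rw [mem_coneHull_basis]
  refine ⟨?_, fun h => ⟨fun j hj => ?_, mem_coneHull_basis.2 fun k => ?_⟩⟩
  · rintro ⟨h1, h2⟩ (j | k)
    · rw [hinl]; exact h1 j j.2
    · rw [adaptedBasis_repr_inr]; exact mem_coneHull_basis.1 h2 k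
  · rw [← hinl ⟨j, hj⟩]; exact h _
  · rw [← adaptedBasis_repr_inr (faceBasis hspan) v hg]; exact h _

end Pullback

/-! ### Existence of decompositions -/

section Decompositions

variable {W : Type*} [AddCommGroup W] [Module ℝ W] {κ : Type*} [Fintype κ]
  {B : Module.Basis κ ℝ W} {Λ : Submodule ℤ W} {L : Submodule ℝ W}

/-- In terms of edges, a simplicial cone has a face parallel to `L` when its facets that are not
parallel to `L` are at most `dim L` in number: the edges opposite to these facets span `L`. -/
theorem exists_parallel_decomposition (hB : Submodule.span ℤ (Set.range B) = Λ)
    (hL : IsRationalSubspace Λ L) {c : Set W} (hc : IsRationalCone Λ c) :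
    ind c ∈ coneGroup Λ {h | ∃ (v : Module.Basis κ ℝ W) (face : Set κ), (∀ i, v i ∈ Λ) ∧
      Submodule.span ℝ (v '' face) = L ∧ h = ind (coneHull v)} := by
  classical
  have : FiniteDimensional ℝ W := Module.Finite.of_basis B
  refine ind_mem_of_dualCone_mem hB le_sup_right (fun η hη hli => ?_) hc
  refine ind_dualCone_mem_of_parallel hB le_sup_right hL (fun η hη hli hcard => ?_) hη hli
  obtain ⟨v, hv, hneg, -, hrepr⟩ := exists_basis_of_linearIndependent_dual hB hη hli rfl
  refine AddSubgroup.mem_sup_left (AddSubgroup.subset_closure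
    ⟨v, {i | ∃ x ∈ L, η i x ≠ 0}, hv, ?_, congrArg ind (dualCone_eq_coneHull hneg hrepr)⟩)
  refine (Submodule.eq_of_le_of_finrank_le (fun x hx => ?_) ?_).symm
  · rw [← v.sum_repr x]
    refine sum_mem fun i _ => ?_
    by_cases hi : ∃ x ∈ L, η i x ≠ 0
    · exact Submodule.smul_mem _ _ (Submodule.subset_span ⟨i, hi, rfl⟩)
    · push Not at hi
      have := hi x hx
      rw [hrepr] at this
      rw [(mul_eq_zero.1 this).resolve_right (hneg i).ne, zero_smul]
      exact zero_mem _
  · refine le_trans ?_ hcard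
    refine (finrank_span_le_card _).trans ?_
    rw [← Set.ncard_eq_toFinset_card']
    exact Set.ncard_image_le (Set.toFinite _)

theorem exists_unimodular_decomposition (hB : Submodule.span ℤ (Set.range B) = Λ) {c : Set W}
    (hc : IsRationalCone Λ c) :
    ind c ∈ coneGroup Λ {h | ∃ u : Module.Basis κ ℝ W, Submodule.span ℤ (Set.range u) = Λ ∧
      h = ind (coneHull u)} := by
  classical
  refine ind_mem_of_dualCone_mem hB le_sup_right (fun η hη hli => ?_) hc
  refine ind_dualCone_mem_of_unimodular hB le_sup_right (fun η hη hli hspan => ?_) hη hli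
  obtain ⟨v, hv, hneg, hzero, hrepr⟩ := exists_basis_of_linearIndependent_dual hB hη hli rfl
  -- the basis dual to the `-η i`, which generates the lattice as the normals generate the dual one
  let u : Module.Basis κ ℝ W := v.unitsSMul fun i => Units.mk0 (-(η i (v i)))⁻¹
    (inv_ne_zero (neg_ne_zero.2 (hneg i).ne))
  have hu : ∀ i, u i = (-(η i (v i)))⁻¹ • v i := fun i => by
    simp only [u, Module.Basis.unitsSMul_apply]; rfl
  have huu : ∀ i j, η i (u j) = if i = j then -1 else 0 := by
    intro i j
    rw [hu, map_smul, smul_eq_mul]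
    split_ifs with hij
    · subst hij; field_simp [(hneg i).ne]
    · rw [hzero i j hij, mul_zero]
  have hurepr : ∀ i x, η i x = u.repr x i * η i (u i) := by
    intro i x
    conv_lhs => rw [← u.sum_repr x]
    rw [map_sum, Finset.sum_eq_single i, map_smul, smul_eq_mul]
    · intro j _ hj
      rw [map_smul, huu, if_neg hj.symm, smul_zero]
    · simp
  refine AddSubgroup.mem_sup_left (AddSubgroup.subset_closure ⟨u, ?_, congrArg ind
    (dualCone_eq_coneHull (fun i => by rw [huu, if_pos rfl]; norm_num) hurepr)⟩)
  refine le_antisymm (Submodule.span_le.2 ?_) fun x hx => ?_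
  · rintro _ ⟨j, rfl⟩
    refine mem_of_repr_eq_int hB fun k => ?_
    obtain ⟨n, hn⟩ := hspan k
    refine ⟨-n j, ?_⟩
    rw [← B.coord_apply, hn, LinearMap.sum_apply, Finset.sum_eq_single j]
    · simp [huu]
    · intro i _ hij
      simp [huu, hij]
    · simp
  · rw [← u.sum_repr x]
    refine sum_mem fun i _ => ?_
    obtain ⟨n, hn⟩ := hη i x hx
    rw [hurepr, huu, if_pos rfl, mul_neg_one, neg_eq_iff_eq_neg] at hn
    rw [hn, ← Int.cast_neg, Int.cast_smul_eq_zsmul]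
    exact Submodule.smul_mem _ _ (Submodule.subset_span ⟨i, rfl⟩)

theorem nonempty_decomposition (hB : Submodule.span ℤ (Set.range B) = Λ)
    (hL : IsRationalSubspace Λ L) {c : Set W} (hc : IsRationalCone Λ c) :
    Nonempty (Decomposition Λ L c) := by
  have : FiniteDimensional ℝ W := Module.Finite.of_basis B
  let e : κ ≃ Fin (Module.finrank ℝ W) := Fintype.equivFinOfCardEq (Module.finrank_eq_card_basis B).symm
  have hB' : Submodule.span ℤ (Set.range (B.reindex e)) = Λ := by rw [B.range_reindex, hB]
  obtain ⟨C, hC⟩ := exists_basis_projectedLattice hB hL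
  obtain ⟨n, sign, g, hg, hcongr⟩ :=
    exists_signs_of_mem_coneGroup (exists_parallel_decomposition hB' hL hc)
  choose gen face hgen hspan hgeq using hg
  have hu := fun i => exists_signs_of_mem_coneGroup
    (exists_unimodular_decomposition hC (isRationalCone_image_coneHull hB (hgen i) (hspan i)))
  choose un usign ug hug hucongr using hu
  choose ugen hugen hugeq using hug
  refine ⟨⟨n, sign, gen, hgen, face, hspan, ?_, un, usign, ugen, hugen, fun i => ?_⟩⟩
  · simpa only [← hgeq] using hcongr
  · simpa only [← hugeq] using hucongr i

/-- A decomposition into cones with a face parallel to `L` and decompositions of their projections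
combine to a decomposition into simplicial cones with unimodular projections. -/
theorem Decomposition.ind_congr (hB : Submodule.span ℤ (Set.range B) = Λ) {c : Set W}
    (D : Decomposition Λ L c) :
    CongrModLines Λ (ind c) (∑ i, ∑ a, (((D.sign i : ℤ) : ℂ) * ((D.usign i a : ℤ) : ℂ)) •
      ind (pullCone (D.gen i) (D.face i) L (coneHull (D.ugen i a)))) := by
  have h1 : ind c - ∑ i, ((D.sign i : ℤ) : ℂ) • ind (coneHull (D.gen i)) ∈ lineSpan Λ := D.congr
  have h2 : ∀ i, ind (coneHull (D.gen i)) - ∑ a, ((D.usign i a : ℤ) : ℂ) •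
      ind (pullCone (D.gen i) (D.face i) L (coneHull (D.ugen i a))) ∈ lineSpan Λ := by
    intro i
    have := pullFun_congr hB (D.gen_mem i) (D.span_face i) (D.ucongr i)
    rw [pullFun_ind, pullCone_image_coneHull (D.span_face i), map_sum] at this
    simp only [map_smul, pullFun_ind] at this
    exact this
  have h3 := add_mem h1 (Submodule.sum_mem (lineSpan Λ) fun i (_ : i ∈ Finset.univ) =>
    Submodule.smul_mem _ ((D.sign i : ℤ) : ℂ) (h2 i))
  change _ ∈ lineSpan Λ
  convert h3 using 1
  simp only [smul_sub, Finset.sum_sub_distrib, Finset.smul_sum, smul_smul]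
  abel

end Decompositions

/-! ### Difference operators along lattice vectors -/

section Difference

variable {V : Type*} [AddCommGroup V]

/-- The difference operator `f ↦ f - f(· - w)`. -/
def diffOp (w : V) : (V → ℂ) →ₗ[ℂ] (V → ℂ) where
  toFun f x := f x - f (x - w)
  map_add' f g := by funext x; simp only [Pi.add_apply]; ring
  map_smul' c f := by funext x; simp only [Pi.smul_apply, smul_eq_mul, RingHom.id_apply]; ring

theorem diffOp_apply (w : V) (f : V → ℂ) (x : V) : diffOp w f x = f x - f (x - w) := rfl

theorem diffOp_comm (v w : V) (f : V → ℂ) : diffOp v (diffOp w f) = diffOp w (diffOp v f) := by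
  funext x
  simp only [diffOp_apply, sub_sub, add_comm v w]
  ring

/-- The composition of the difference operators along the vectors of a list. -/
def diffList (l : List V) : (V → ℂ) →ₗ[ℂ] (V → ℂ) := l.foldr (fun w T => diffOp w ∘ₗ T) LinearMap.id

theorem diffList_cons (w : V) (l : List V) (f : V → ℂ) :
    diffList (w :: l) f = diffOp w (diffList l f) := rfl

theorem diffList_append (l l' : List V) (f : V → ℂ) :
    diffList (l ++ l') f = diffList l (diffList l' f) := by
  induction l with
  | nil => rfl
  | cons w l ih => rw [List.cons_append, diffList_cons, ih, diffList_cons]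

theorem diffList_perm {l l' : List V} (h : l.Perm l') (f : V → ℂ) : diffList l f = diffList l' f := by
  induction h with
  | nil => rfl
  | cons w _ ih => rw [diffList_cons, diffList_cons, ih]
  | swap v w l => simp only [diffList_cons]; exact diffOp_comm _ _ _
  | trans _ _ ih₁ ih₂ => rw [ih₁, ih₂]

end Difference

/-! ### Polyhedra are killed by difference operators, up to bounded functions -/

section Tame

variable {V : Type*} [NormedAddCommGroup V] [NormedSpace ℝ V] [MeasurableSpace V] [BorelSpace V]

/-- Bounded measurable functions with bounded support. -/
def IsTame (f : V → ℂ) : Prop :=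
  Measurable f ∧ (∃ C, ∀ x, ‖f x‖ ≤ C) ∧ ∃ R, ∀ x, R < ‖x‖ → f x = 0

theorem isTame_zero : IsTame (0 : V → ℂ) :=
  ⟨measurable_const, ⟨0, fun _ => by simp⟩, 0, fun _ _ => rfl⟩

theorem IsTame.add {f g : V → ℂ} (hf : IsTame f) (hg : IsTame g) : IsTame (f + g) := by
  obtain ⟨hf1, ⟨C, hC⟩, R, hR⟩ := hf
  obtain ⟨hg1, ⟨C', hC'⟩, R', hR'⟩ := hg
  refine ⟨hf1.add hg1, ⟨C + C', fun x => (norm_add_le _ _).trans (add_le_add (hC x) (hC' x))⟩,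
    max R R', fun x hx => ?_⟩
  rw [Pi.add_apply, hR x ((le_max_left _ _).trans_lt hx), hR' x ((le_max_right _ _).trans_lt hx),
    add_zero]

theorem IsTame.smul {f : V → ℂ} (hf : IsTame f) (c : ℂ) : IsTame (c • f) := by
  obtain ⟨hf1, ⟨C, hC⟩, R, hR⟩ := hf
  refine ⟨hf1.const_smul c, ⟨‖c‖ * C, fun x => ?_⟩, R, fun x hx => ?_⟩
  · rw [Pi.smul_apply, norm_smul]
    exact mul_le_mul_of_nonneg_left (hC x) (norm_nonneg c)
  · rw [Pi.smul_apply, hR x hx, smul_zero]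

theorem measurable_diffOp {f : V → ℂ} (hf : Measurable f) (w : V) : Measurable (diffOp w f) :=
  hf.sub (hf.comp (continuous_id.sub continuous_const).measurable)

theorem measurable_diffList {f : V → ℂ} (hf : Measurable f) (l : List V) :
    Measurable (diffList l f) := by
  induction l with
  | nil => exact hf
  | cons w l ih => exact measurable_diffOp ih w

theorem exists_bound_diffList {f : V → ℂ} (hf : ∃ C, ∀ x, ‖f x‖ ≤ C) (l : List V) :
    ∃ C, ∀ x, ‖diffList l f x‖ ≤ C := by
  induction l with
  | nil => exact hf
  | cons w l ih =>
    obtain ⟨C, hC⟩ := ih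
    exact ⟨C + C, fun x => (norm_sub_le _ _).trans (add_le_add (hC x) (hC _))⟩

theorem IsTame.diffOp {f : V → ℂ} (hf : IsTame f) (w : V) : IsTame (diffOp w f) := by
  obtain ⟨h1, h2, R, hR⟩ := hf
  refine ⟨measurable_diffOp h1 w, exists_bound_diffList h2 [w], R + ‖w‖, fun x hx => ?_⟩
  rw [diffOp_apply, hR x (by linarith [norm_nonneg w]), hR (x - w), sub_zero]
  have := norm_sub_norm_le x w
  linarith

theorem IsTame.diffList {f : V → ℂ} (hf : IsTame f) (l : List V) : IsTame (diffList l f) := by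
  induction l with
  | nil => exact hf
  | cons w l ih => exact ih.diffOp w

variable [FiniteDimensional ℝ V] {κ : Type*} [Fintype κ] {B : Module.Basis κ ℝ V} {Λ : Submodule ℤ V}

theorem isClosed_halfSpaces {ι : Type*} (η : ι → Module.Dual ℝ V) (b : ι → ℝ) (s : Finset ι) :
    IsClosed (halfSpaces η b s) := by
  have : halfSpaces η b s = ⋂ i ∈ s, {x | η i x ≤ b i} := by ext x; simp [halfSpaces]
  rw [this]
  exact isClosed_biInter fun i _ =>
    isClosed_le (LinearMap.continuous_of_finiteDimensional _) continuous_const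

theorem IsSemiRationalPolyhedron.eq_halfSpaces {p : Set V} (hp : IsSemiRationalPolyhedron Λ p) :
    ∃ s : Finset (dualLattice Λ × ℝ), p = halfSpaces (fun h => h.1.1) (fun h => h.2) s := by
  classical
  obtain ⟨H, hfin, hH, rfl⟩ := hp
  refine ⟨hfin.toFinset.attach.image fun h => (⟨h.1.1, hH _ (hfin.mem_toFinset.1 h.2)⟩, h.1.2), ?_⟩
  ext x
  refine ⟨fun hx i hi => ?_, fun hx h hh => ?_⟩
  · obtain ⟨h, -, rfl⟩ := Finset.mem_image.1 hi
    exact hx h.1 (hfin.mem_toFinset.1 h.2)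
  · exact hx (⟨h.1, hH h hh⟩, h.2) (Finset.mem_image.2
      ⟨⟨h, hfin.mem_toFinset.2 hh⟩, Finset.mem_attach _ _, rfl⟩)

theorem IsSemiRationalPolyhedron.measurableSet {p : Set V} (hp : IsSemiRationalPolyhedron Λ p) :
    MeasurableSet p := by
  obtain ⟨s, rfl⟩ := hp.eq_halfSpaces
  exact (isClosed_halfSpaces _ _ s).measurableSet

theorem measurable_ind {p : Set V} (hp : MeasurableSet p) : Measurable (ind p) :=
  measurable_one.indicator hp

theorem norm_ind_le (p : Set V) (x : V) : ‖ind p x‖ ≤ 1 := by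
  classical
  rw [ind, Set.indicator_apply]
  split_ifs <;> simp

/-- A simplicial polyhedron becomes a half-open box under the difference operators along its edges. -/
theorem isTame_diffList_simplicial {ι : Type*} [Fintype ι] {η : ι → Module.Dual ℝ V} {b : ι → ℝ}
    {v : Module.Basis ι ℝ V} (hneg : ∀ i, η i (v i) < 0) (hzero : ∀ i j, i ≠ j → η i (v j) = 0)
    (hrepr : ∀ i x, η i x = v.repr x i * η i (v i)) :
    IsTame (diffList (Finset.univ.toList.map v) (ind (halfSpaces η b Finset.univ))) := by
  classical
  set f : V → ℂ := ind (halfSpaces η b Finset.univ) with hf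
  refine ⟨measurable_diffList (measurable_ind (isClosed_halfSpaces _ _ _).measurableSet) _,
    exists_bound_diffList ⟨1, norm_ind_le _⟩ _, ?_⟩
  -- the support stays in the polyhedron
  have hupper : ∀ l : List ι, ∀ x, (∃ i, b i < η i x) → diffList (l.map v) f x = 0 := by
    intro l
    induction l with
    | nil =>
      rintro x ⟨i, hi⟩
      refine Set.indicator_of_notMem (fun hx => ?_) _
      exact absurd (hx i (Finset.mem_univ i)) (not_le.2 hi)
    | cons j l ih =>
      rintro x ⟨i, hi⟩
      rw [List.map_cons, diffList_cons, diffOp_apply, ih x ⟨i, hi⟩, ih (x - v j) ⟨i, ?_⟩, sub_zero]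
      rw [map_sub]
      by_cases hij : i = j
      · subst hij; linarith [hneg i]
      · rw [hzero i j hij]; linarith
  -- deep inside, the function does not change along `v i` before the operator of `v i` is applied
  have hdeep : ∀ i, ∀ l : List ι, i ∉ l → ∀ x, η i x ≤ b i + η i (v i) →
      diffList (l.map v) f (x - v i) = diffList (l.map v) f x := by
    intro i l
    induction l with
    | nil =>
      intro _ x hx
      have hiff : x - v i ∈ halfSpaces η b Finset.univ ↔ x ∈ halfSpaces η b Finset.univ := by
        refine forall_congr' fun j => forall_congr' fun _ => ?_
        rw [map_sub]
        by_cases hij : j = i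
        · subst hij
          exact ⟨fun _ => by linarith [hneg j], fun _ => by linarith⟩
        · rw [hzero j i hij, sub_zero]
      change ind _ _ = ind _ _
      rw [ind, Set.indicator_apply, Set.indicator_apply]
      simp only [hiff]
      rfl
    | cons j l ih =>
      intro hil x hx
      rw [List.mem_cons, not_or] at hil
      rw [List.map_cons, diffList_cons, diffOp_apply, diffOp_apply, ih hil.2 x hx,
        sub_right_comm, ih hil.2 (x - v j) (by rw [map_sub, hzero i j hil.1, sub_zero]; exact hx)]
  have hlower : ∀ i x, η i x ≤ b i + η i (v i) →
      diffList (Finset.univ.toList.map v) f x = 0 := by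
    intro i x hx
    have hperm : (Finset.univ : Finset ι).toList.Perm (i :: (Finset.univ : Finset ι).toList.erase i) :=
      List.perm_cons_erase (by simp)
    rw [diffList_perm (hperm.map v), List.map_cons, diffList_cons, diffOp_apply, hdeep i _ _ x hx,
      sub_self]
    exact (Finset.nodup_toList _).not_mem_erase
  refine ⟨∑ i, (max |b i| |b i + η i (v i)| / |η i (v i)|) * ‖v i‖, fun x hx => ?_⟩
  by_contra hne
  have h1 : ∀ i, b i + η i (v i) < η i x := fun i => by
    by_contra! h
    exact hne (hlower i x h)
  have h2 : ∀ i, η i x ≤ b i := fun i => by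
    by_contra! h
    exact hne (hupper _ x ⟨i, h⟩)
  refine absurd hx (not_lt.2 ?_)
  conv_lhs => rw [← v.sum_repr x]
  refine (norm_sum_le _ _).trans (Finset.sum_le_sum fun i _ => ?_)
  rw [norm_smul, Real.norm_eq_abs]
  refine mul_le_mul_of_nonneg_right ?_ (norm_nonneg _)
  have h3 : v.repr x i = η i x / η i (v i) := by rw [hrepr]; field_simp [(hneg i).ne]
  rw [h3, abs_div]
  refine div_le_div_of_nonneg_right ?_ (abs_nonneg _)
  rw [abs_le]
  constructor
  · have := neg_abs_le (b i + η i (v i))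
    linarith [h1 i, le_max_right |b i| |b i + η i (v i)|]
  · exact (h2 i).trans ((le_abs_self _).trans (le_max_left _ _))

/-- Some product of difference operators along lattice vectors makes the indicator of a semi-rational
polyhedron bounded with bounded support, and zero if the polyhedron contains a line. -/
theorem exists_isTame_diffList (hB : Submodule.span ℤ (Set.range B) = Λ) {p : Set V}
    (hp : IsSemiRationalPolyhedron Λ p) :
    ∃ l : List V, (∀ w ∈ l, w ∈ Λ ∧ w ≠ 0) ∧ IsTame (diffList l (ind p)) ∧
      (ContainsLine p → diffList l (ind p) = 0) := by
  classical
  obtain ⟨s, rfl⟩ := hp.eq_halfSpaces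
  set η : dualLattice Λ × ℝ → Module.Dual ℝ V := fun h => h.1.1 with hη
  set b : dualLattice Λ × ℝ → ℝ := fun h => h.2 with hb
  have hd : Module.finrank ℝ V = Fintype.card κ := Module.finrank_eq_card_basis B
  -- the direction of a line in the polyhedron is annihilated by all the normals
  have hdir : ContainsLine (halfSpaces η b s) → ∃ w : V, w ≠ 0 ∧ ∀ i ∈ s, η i w = 0 := by
    rintro ⟨x, w, hw, hline⟩
    refine ⟨w, hw, fun i hi => ?_⟩
    by_contra hne
    have := hline ((b i + 1 - η i x) / η i w) i hi
    rw [map_add, map_smul, smul_eq_mul, div_mul_cancel₀ _ hne] at this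
    linarith
  have hmem := ind_halfSpaces_mem_closure η b s
  -- the direction of the line only enters through `hdir`, so that the claim can be proved for the
  -- terms of the decomposition instead of the polyhedron itself
  generalize ContainsLine (halfSpaces η b s) = Q at hdir ⊢
  generalize ind (halfSpaces η b s) = F at hmem ⊢
  induction hmem using AddSubgroup.closure_induction with
  | mem f hf =>
    obtain ⟨t, hts, hli, rfl⟩ := hf
    -- with fewer than `d` normals, the intersection is invariant under a lattice vector; with `d`
    -- independent normals it is simplicial, and then there is no line
    rcases lt_or_ge t.card (Fintype.card κ) with ht | ht
    · obtain ⟨v, hv, hv0, h⟩ := exists_forall_eq_zero_of_card_lt hB (η := η) (fun i => i.1.2) ht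
      have hzero : diffList [v] (ind (halfSpaces η b t)) = 0 := by
        funext x
        have hiff : x - v ∈ halfSpaces η b t ↔ x ∈ halfSpaces η b t := by
          refine forall_congr' fun j => forall_congr' fun hj => ?_
          rw [map_sub, h j hj, sub_zero]
        change ind _ _ - ind _ _ = 0
        rw [ind, Set.indicator_apply, Set.indicator_apply]
        simp only [hiff]
        exact sub_self _
      exact ⟨[v], by simpa using ⟨hv, hv0⟩, hzero ▸ isTame_zero, fun _ => hzero⟩
    · have hle := LinearIndependent.fintype_card_le_finrank (b := fun i : t => η i) hli
      rw [Subspace.dual_finrank_eq, hd, Fintype.card_coe] at hle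
      have hcard : Fintype.card t = Fintype.card κ := by
        rw [Fintype.card_coe]; exact hle.antisymm ht
      obtain ⟨v, hv, hneg, hzero, hrepr⟩ := exists_basis_of_linearIndependent_dual hB
        (η := fun i : t => η i) (fun i => i.1.1.2) hli hcard
      refine ⟨Finset.univ.toList.map v, ?_, ?_, ?_⟩
      · intro w hw
        obtain ⟨i, -, rfl⟩ := List.mem_map.1 hw
        exact ⟨hv i, v.ne_zero i⟩
      · have := isTame_diffList_simplicial (b := fun i : t => b i) hneg hzero hrepr
        have hset : halfSpaces (fun i : t => η i) (fun i : t => b i) Finset.univ =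
            halfSpaces η b t := by
          ext x; simp [halfSpaces]
        rwa [hset] at this
      · intro hq
        obtain ⟨w, hw, hw0⟩ := hdir hq
        exact absurd (eq_zero_of_linearIndependent_dual (η := fun i : t => η i) hli
          (hcard.trans hd.symm) fun i => hw0 i (hts i.2)) hw
  | zero => exact ⟨[], by simp, isTame_zero, fun _ => rfl⟩
  | add f g _ _ hf hg =>
    obtain ⟨l, hl, hlt, hl0⟩ := hf
    obtain ⟨l', hl', hlt', hl0'⟩ := hg
    have h1 : diffList (l ++ l') (f + g) = diffList l' (diffList l f) +
        diffList l (diffList l' g) := by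
      rw [map_add, diffList_append l l' g, diffList_perm List.perm_append_comm f, diffList_append]
    refine ⟨l ++ l', fun w hw => ?_, ?_, fun hq => ?_⟩
    · rcases List.mem_append.1 hw with h | h
      · exact hl w h
      · exact hl' w h
    · rw [h1]; exact (hlt.diffList l').add (hlt'.diffList l)
    · rw [h1, hl0 hq, hl0' hq, map_zero, map_zero, add_zero]
  | neg f _ hf =>
    obtain ⟨l, hl, hlt, hl0⟩ := hf
    refine ⟨l, hl, ?_, fun hq => by rw [map_neg, hl0 hq, neg_zero]⟩
    rw [map_neg, ← neg_one_smul ℂ]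
    exact hlt.smul (-1)

end Tame

/-! ### The measure on the slices -/

section SliceMeasure

variable {V : Type*} [NormedAddCommGroup V] [NormedSpace ℝ V] [FiniteDimensional ℝ V]
  [MeasurableSpace V] [BorelSpace V] {κ : Type*} [Fintype κ] {B : Module.Basis κ ℝ V}
  {Λ : Submodule ℤ V} {L : Submodule ℝ V}

theorem mkQ_out (y : V ⧸ L) : L.mkQ (Quotient.out y) = y := Quotient.out_eq' y

/-- The integral coordinates on the quotient lattice. -/
def projEquiv {ι : Type*} [Fintype ι] (C : Module.Basis ι ℝ (V ⧸ L))
    (hC : Submodule.span ℤ (Set.range C) = projectedLattice Λ L) :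
    projectedLattice Λ L ≃ (ι → ℤ) :=
  (LinearEquiv.ofEq _ _ hC.symm).toEquiv.trans (C.restrictScalars ℤ).equivFun.toEquiv

theorem repr_eq_projEquiv {ι : Type*} [Fintype ι] (C : Module.Basis ι ℝ (V ⧸ L))
    (hC : Submodule.span ℤ (Set.range C) = projectedLattice Λ L) (y : projectedLattice Λ L) (k : ι) :
    C.repr y k = (projEquiv C hC y k : ℝ) := by
  have := C.restrictScalars_repr_apply ℤ (LinearEquiv.ofEq _ _ hC.symm y) k
  exact this.symm

theorem countable_projectedLattice (hB : Submodule.span ℤ (Set.range B) = Λ)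
    (hL : IsRationalSubspace Λ L) : Countable (projectedLattice Λ L) := by
  obtain ⟨C, hC⟩ := exists_basis_projectedLattice hB hL
  exact (projEquiv C hC).injective.countable

/-- The parametrization of the slice `y + L` by `L`. -/
def sliceMap (L : Submodule ℝ V) (y : V ⧸ L) (u : L) : V := Quotient.out y + (u : V)

theorem isClosedEmbedding_sliceMap (y : V ⧸ L) : IsClosedEmbedding (sliceMap L y) :=
  (Homeomorph.addLeft (Quotient.out y)).isClosedEmbedding.comp
    (L.closed_of_finiteDimensional.isClosedEmbedding_subtypeVal)

theorem measurable_sliceMap (y : V ⧸ L) : Measurable (sliceMap L y) :=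
  (isClosedEmbedding_sliceMap y).continuous.measurable

instance : (latticeMeasure Λ L).IsAddLeftInvariant := by
  unfold latticeMeasure; infer_instance

instance : IsFiniteMeasureOnCompacts (latticeMeasure Λ L) := by
  unfold latticeMeasure
  exact IsFiniteMeasureOnCompacts.smul _ ENNReal.ofReal_ne_top

/-- The sum over `y ∈ Λ_{V/L}` of the Lebesgue measures on the slices `y + L`. -/
def sliceMeasure (Λ : Submodule ℤ V) (L : Submodule ℝ V) : Measure V :=
  Measure.sum fun y : projectedLattice Λ L => (latticeMeasure Λ L).map (sliceMap L y)

/-- The measure on a slice does not depend on the chosen representative. -/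
theorem map_sliceMap {y : V ⧸ L} {x : V} (hx : L.mkQ x = y) :
    (latticeMeasure Λ L).map (sliceMap L y) = (latticeMeasure Λ L).map (fun u : L => x + u) := by
  have hmem : Quotient.out y - x ∈ L := by
    rw [← Submodule.Quotient.mk_eq_zero, ← Submodule.mkQ_apply, map_sub, mkQ_out, hx, sub_self]
  have hinv := map_add_left_eq_self (latticeMeasure Λ L) ⟨_, hmem⟩
  conv_rhs => rw [← hinv]
  rw [Measure.map_map (by fun_prop) (measurable_const_add _)]
  congr 1
  funext u
  simp only [Function.comp, sliceMap, Submodule.coe_add]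
  abel

/-- The measure on the slices is invariant under the vectors that project to the lattice. -/
theorem map_add_sliceMeasure (hB : Submodule.span ℤ (Set.range B) = Λ)
    (hL : IsRationalSubspace Λ L) {v : V} (hv : L.mkQ v ∈ projectedLattice Λ L) :
    (sliceMeasure Λ L).map (fun x => x + v) = sliceMeasure Λ L := by
  have := countable_projectedLattice hB hL
  have h : ∀ y : V ⧸ L, ((latticeMeasure Λ L).map (sliceMap L y)).map (fun x => x + v) =
      (latticeMeasure Λ L).map (sliceMap L (y + L.mkQ v)) := by
    intro y
    rw [map_sliceMap (y := y + L.mkQ v) (x := Quotient.out y + v) (by rw [map_add, mkQ_out]),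
      Measure.map_map (measurable_add_const v) (measurable_sliceMap y)]
    congr 1
    funext u
    simp only [Function.comp, sliceMap]
    abel
  rw [sliceMeasure, Measure.map_sum (measurable_add_const v).aemeasurable]
  simp only [h]
  exact Measure.sum_comp_equiv (Equiv.addRight (⟨L.mkQ v, hv⟩ : projectedLattice Λ L))
    fun y : projectedLattice Λ L => (latticeMeasure Λ L).map (sliceMap L y)

/-- The measure on the slices is finite on bounded sets, since a ball meets only finitely many slices,
each in a bounded set. -/
theorem sliceMeasure_closedBall_lt_top (hB : Submodule.span ℤ (Set.range B) = Λ)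
    (hL : IsRationalSubspace Λ L) (R : ℝ) : sliceMeasure Λ L (Metric.closedBall 0 R) < ⊤ := by
  classical
  have : ProperSpace V := FiniteDimensional.proper ℝ V
  obtain ⟨C, hC⟩ := exists_basis_projectedLattice hB hL
  have := countable_projectedLattice hB hL
  let ℓ : Fin (Module.finrank ℝ (V ⧸ L)) → V →L[ℝ] ℝ := fun k =>
    ((C.coord k).comp L.mkQ).toContinuousLinearMap
  let N : Fin (Module.finrank ℝ (V ⧸ L)) → ℤ := fun k => ⌈‖ℓ k‖ * R⌉
  have hfin : (projEquiv C hC ⁻¹' Set.Icc (-N) N).Finite :=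
    (Set.finite_Icc _ _).preimage (projEquiv C hC).injective.injOn
  rw [sliceMeasure, Measure.sum_apply _ Metric.isClosed_closedBall.measurableSet,
    tsum_eq_sum (s := hfin.toFinset)]
  · refine ENNReal.sum_lt_top.2 fun y _ => ?_
    rw [Measure.map_apply (measurable_sliceMap _) Metric.isClosed_closedBall.measurableSet]
    exact ((isClosedEmbedding_sliceMap _).isCompact_preimage
      (isCompact_closedBall 0 R)).measure_lt_top
  · intro y hy
    rw [Measure.map_apply (measurable_sliceMap _) Metric.isClosed_closedBall.measurableSet]
    convert measure_empty (μ := latticeMeasure Λ L)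
    rw [Set.eq_empty_iff_forall_notMem]
    intro u hu
    apply hy
    rw [Set.Finite.mem_toFinset, Set.mem_preimage]
    have hk : ∀ k, |(projEquiv C hC y k : ℝ)| ≤ N k := by
      intro k
      have h1 : L.mkQ (sliceMap L y u) = y := by
        rw [sliceMap, map_add, mkQ_out]; simp
      have h2 : (projEquiv C hC y k : ℝ) = ℓ k (sliceMap L y u) := by
        rw [← repr_eq_projEquiv]
        change _ = C.repr (L.mkQ (sliceMap L y u)) k
        rw [h1]
      rw [h2, ← Real.norm_eq_abs]
      refine ((ℓ k).le_opNorm _).trans (le_trans ?_ (Int.le_ceil _))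
      exact mul_le_mul_of_nonneg_left (by simpa using hu) (norm_nonneg _)
    constructor
    · intro k
      have := (abs_le.1 (hk k)).1
      rw [Pi.neg_apply]
      exact_mod_cast this
    · intro k
      have := (abs_le.1 (hk k)).2
      exact_mod_cast this

theorem integrableOn_map_sliceMap {p : Set V} (hp : MeasurableSet p) (η : Module.Dual ℝ V)
    (y : V ⧸ L) :
    Integrable (fun x => Real.exp (η x)) (((latticeMeasure Λ L).map (sliceMap L y)).restrict p) ↔
      IntegrableOn (fun u : L => Real.exp (η (Quotient.out y + (u : V)))) (slice L p y)
        (latticeMeasure Λ L) := by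
  rw [Measure.restrict_map (measurable_sliceMap y) hp,
    (isClosedEmbedding_sliceMap y).measurableEmbedding.integrable_map_iff]
  rfl

theorem integral_map_sliceMap {p : Set V} (hp : MeasurableSet p) (η : Module.Dual ℝ V) (y : V ⧸ L) :
    ∫ x, Real.exp (η x) ∂(((latticeMeasure Λ L).map (sliceMap L y)).restrict p) =
      sliceIntegral Λ L p η y := by
  rw [Measure.restrict_map (measurable_sliceMap y) hp,
    (isClosedEmbedding_sliceMap y).measurableEmbedding.integral_map]
  rfl

/-- Convergence of the sum over the slices is integrability for the measure on the slices. -/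
theorem SumConverges.integrableOn (hB : Submodule.span ℤ (Set.range B) = Λ)
    (hL : IsRationalSubspace Λ L) {p : Set V} (hp : MeasurableSet p) {η : Module.Dual ℝ V}
    (h : SumConverges Λ L p η) : IntegrableOn (fun x => Real.exp (η x)) p (sliceMeasure Λ L) := by
  have := countable_projectedLattice hB hL
  rw [IntegrableOn, sliceMeasure, Measure.restrict_sum _ hp]
  refine integrable_sum_measure
    (fun y => (integrableOn_map_sliceMap (Λ := Λ) (L := L) hp η (y : V ⧸ L)).2
      (h.1 (y : V ⧸ L) y.2)) ?_
  refine h.2.congr fun y => ?_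
  simp only [Real.norm_eq_abs, Real.abs_exp]
  exact (integral_map_sliceMap (Λ := Λ) (L := L) hp η (y : V ⧸ L)).symm

theorem tsum_sliceIntegral {p : Set V} (hp : MeasurableSet p) {η : Module.Dual ℝ V}
    (h : IntegrableOn (fun x => Real.exp (η x)) p (sliceMeasure Λ L)) :
    ∑' y : projectedLattice Λ L, sliceIntegral Λ L p η y =
      ∫ x in p, Real.exp (η x) ∂(sliceMeasure Λ L) := by
  rw [IntegrableOn, sliceMeasure, Measure.restrict_sum _ hp] at h
  have h2 := (hasSum_integral_measure h).tsum_eq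
  rw [sliceMeasure, Measure.restrict_sum _ hp, ← h2]
  exact tsum_congr fun y => (integral_map_sliceMap (Λ := Λ) (L := L) hp η (y : V ⧸ L)).symm

end SliceMeasure

/-! ### The Laplace transform and the valuation -/

section Transform

variable {V : Type*} [NormedAddCommGroup V] [NormedSpace ℝ V] [FiniteDimensional ℝ V]
  [MeasurableSpace V] [BorelSpace V]

/-- The transform `ξ ↦ ∫ f(x) e^{⟨ξ, x⟩} dν(x)`. -/
def transform (ν : Measure V) (f : V → ℂ) (ξ : V →L[ℝ] ℂ) : ℂ := ∫ x, f x * Complex.exp (ξ x) ∂ν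

variable {ν : Measure V}

/-- For a measure invariant under `w`, the difference operator along `w` multiplies the transform by
`1 - e^{⟨ξ, w⟩}`. -/
theorem diffOp_transform {w : V} (hν : ν.map (fun x => x + w) = ν) {f : V → ℂ} {ξ : V →L[ℝ] ℂ}
    (hf : Integrable (fun x => f x * Complex.exp (ξ x)) ν) :
    Integrable (fun x => diffOp w f x * Complex.exp (ξ x)) ν ∧
      transform ν (diffOp w f) ξ = (1 - Complex.exp (ξ w)) * transform ν f ξ := by
  have hemb : MeasurableEmbedding fun x : V => x + w := (MeasurableEquiv.addRight w).measurableEmbedding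
  have hcomp : (fun x => f (x - w) * Complex.exp (ξ x)) ∘ (fun x => x + w) =
      fun x => Complex.exp (ξ w) * (f x * Complex.exp (ξ x)) := by
    funext x
    simp only [Function.comp, add_sub_cancel_right, map_add, Complex.exp_add]
    ring
  have hint : Integrable (fun x => f (x - w) * Complex.exp (ξ x)) ν := by
    rw [← hν, hemb.integrable_map_iff, hcomp]
    exact hf.const_mul _
  have hval : ∫ x, f (x - w) * Complex.exp (ξ x) ∂ν = Complex.exp (ξ w) * transform ν f ξ := by
    conv_lhs => rw [← hν]
    rw [hemb.integral_map, transform, ← integral_const_mul]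
    exact integral_congr_ae (Eventually.of_forall fun x => congrFun hcomp x)
  have heq : (fun x => diffOp w f x * Complex.exp (ξ x)) =
      fun x => f x * Complex.exp (ξ x) - f (x - w) * Complex.exp (ξ x) := by
    funext x; rw [diffOp_apply, sub_mul]
  refine ⟨heq ▸ hf.sub hint, ?_⟩
  rw [transform, heq, integral_sub hf hint, hval, transform]
  ring

theorem diffList_transform {l : List V} (hν : ∀ w ∈ l, ν.map (fun x => x + w) = ν) {f : V → ℂ}
    {ξ : V →L[ℝ] ℂ} (hf : Integrable (fun x => f x * Complex.exp (ξ x)) ν) :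
    Integrable (fun x => diffList l f x * Complex.exp (ξ x)) ν ∧
      transform ν (diffList l f) ξ =
        (l.map fun w => 1 - Complex.exp (ξ w)).prod * transform ν f ξ := by
  induction l with
  | nil => exact ⟨hf, by simp [diffList]⟩
  | cons w l ih =>
    obtain ⟨h1, h2⟩ := ih fun w hw => hν w (by simp [hw])
    obtain ⟨h3, h4⟩ := diffOp_transform (hν w (by simp)) h1
    exact ⟨h3, by rw [diffList_cons, h4, h2, List.map_cons, List.prod_cons, mul_assoc]⟩

variable (hfin : ∀ R, ν (Metric.closedBall 0 R) < ⊤)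

include hfin in
theorem IsTame.integrable {f : V → ℂ} (hf : IsTame f) : Integrable f ν := by
  obtain ⟨hm, ⟨C, hC⟩, R, hR⟩ := hf
  have : IntegrableOn f (Metric.closedBall 0 R) ν :=
    Measure.integrableOn_of_bounded (hfin R).ne hm.aestronglyMeasurable (Eventually.of_forall hC)
  refine (integrableOn_iff_integrable_of_support_subset fun x hx => ?_).1 this
  by_contra hcon
  exact hx (hR x (by simpa using hcon))

theorem IsTame.mul_exp {f : V → ℂ} (hf : IsTame f) (ξ : V →L[ℝ] ℂ) :
    IsTame fun x => f x * Complex.exp (ξ x) := by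
  obtain ⟨hm, ⟨C, hC⟩, R, hR⟩ := hf
  refine ⟨hm.mul (Complex.continuous_exp.comp ξ.continuous).measurable,
    ⟨C * Real.exp (‖ξ‖ * R), fun x => ?_⟩, R, fun x hx => by simp only [hR x hx, zero_mul]⟩
  by_cases hx : R < ‖x‖
  · change ‖f x * _‖ ≤ _
    rw [hR x hx, zero_mul, norm_zero]
    exact mul_nonneg ((norm_nonneg _).trans (hC x)) (Real.exp_pos _).le
  · change ‖f x * _‖ ≤ _
    rw [norm_mul, Complex.norm_exp]
    refine mul_le_mul (hC x) (Real.exp_le_exp.2 ?_) (Real.exp_pos _).le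
      ((norm_nonneg _).trans (hC x))
    exact (Complex.re_le_norm _).trans ((ξ.le_opNorm x).trans
      (mul_le_mul_of_nonneg_left (not_lt.1 hx) (norm_nonneg _)))

include hfin in
/-- The transform of a bounded function with bounded support is holomorphic: it is the exponential in
the Banach algebra of continuous functions on a ball, composed with continuous linear maps. -/
theorem IsTame.analyticAt_transform {f : V → ℂ} (hf : IsTame f) :
    AnalyticAt ℂ (transform ν f) 0 := by
  have hint := hf.integrable hfin
  obtain ⟨hm, -, R, hR⟩ := hf
  have : ProperSpace V := FiniteDimensional.proper ℝ V
  set K : Set V := Metric.closedBall 0 R with hK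
  have : CompactSpace K := isCompact_iff_compactSpace.1 (isCompact_closedBall 0 R)
  have hKm : MeasurableSet K := Metric.isClosed_closedBall.measurableSet
  let ev : (V →L[ℝ] ℂ) →L[ℂ] C(K, ℂ) := LinearMap.mkContinuous
    { toFun := fun ξ => ⟨fun x => ξ x, ξ.continuous.comp continuous_subtype_val⟩
      map_add' := fun _ _ => rfl
      map_smul' := fun _ _ => rfl } (max R 0) (fun ξ => by
        rw [ContinuousMap.norm_le _ (by positivity)]
        intro x
        refine (ξ.le_opNorm x).trans ?_
        rw [mul_comm]
        refine mul_le_mul_of_nonneg_right (le_max_of_le_left ?_) (norm_nonneg _)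
        exact mem_closedBall_zero_iff.1 x.2)
  set νK : Measure K := ν.comap Subtype.val with hνK
  have hintK : Integrable (fun x : K => f x) νK := by
    have := (MeasurableEmbedding.subtype_coe hKm).integrableOn_range_iff_comap (f := f) (μ := ν)
    rw [Subtype.range_coe] at this
    exact this.1 hint.integrableOn
  have hintKh : ∀ h : C(K, ℂ), Integrable (fun x : K => f x * h x) νK := fun h =>
    hintK.mul_bdd (c := ‖h‖) h.continuous.aestronglyMeasurable
      (Eventually.of_forall fun x => h.norm_coe_le_norm x)
  let Φ : C(K, ℂ) →L[ℂ] ℂ := LinearMap.mkContinuous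
    { toFun := fun h => ∫ x : K, f x * h x ∂νK
      map_add' := fun h k => by
        simp only [ContinuousMap.add_apply, mul_add]
        exact integral_add (hintKh h) (hintKh k)
      map_smul' := fun c h => by
        simp only [ContinuousMap.smul_apply, smul_eq_mul, RingHom.id_apply, ← integral_const_mul]
        exact integral_congr_ae (Eventually.of_forall fun x => by ring_nf) }
    (∫ x : K, ‖f x‖ ∂νK) (fun h => by
      refine (norm_integral_le_integral_norm _).trans ?_
      rw [← integral_mul_const]
      refine integral_mono (hintKh h).norm (hintK.norm.mul_const _) fun x => ?_
      simp only [norm_mul]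
      exact mul_le_mul_of_nonneg_left (h.norm_coe_le_norm x) (norm_nonneg _))
  have heq : transform ν f = fun ξ => Φ (NormedSpace.exp (ev ξ)) := by
    funext ξ
    have h1 : ∀ x : K, (NormedSpace.exp (ev ξ)) x = Complex.exp (ξ x) := by
      intro x
      have := NormedSpace.map_exp (ContinuousMap.evalAlgHom ℂ ℂ x)
        (continuous_eval_const x) (ev ξ)
      rw [Complex.exp_eq_exp_ℂ]
      exact this
    change _ = ∫ x : K, f x * (NormedSpace.exp (ev ξ)) x ∂νK
    simp only [h1]
    rw [integral_subtype_comap hKm fun x => f x * Complex.exp (ξ x), transform,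
      setIntegral_eq_integral_of_forall_compl_eq_zero]
    intro x hx
    rw [hR x (by simpa [hK] using hx), zero_mul]
  rw [heq]
  have h1 : AnalyticAt ℂ (fun ξ => NormedSpace.exp (ev ξ)) 0 :=
    AnalyticAt.comp (NormedSpace.exp_analytic (𝕂 := ℂ) (ev 0)) (ev.analyticAt 0)
  exact (Φ.analyticAt _).comp h1

end Transform

/-! ### Existence of the intermediate generating function -/

section CutGF

variable {V : Type*} [NormedAddCommGroup V] [NormedSpace ℝ V] [FiniteDimensional ℝ V]
  [MeasurableSpace V] [BorelSpace V]

theorem tendsto_generic_apply {w : V} (hw : w ≠ 0) :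
    Tendsto (fun ξ : V →L[ℝ] ℂ => ξ w) (generic V) (𝓝[≠] 0) := by
  refine tendsto_nhdsWithin_iff.2 ⟨?_, eventually_generic_ne hw⟩
  have : Continuous fun ξ : V →L[ℝ] ℂ => ξ w := by fun_prop
  simpa using (this.tendsto 0).mono_left generic_le_nhds

theorem eventually_prod_one_sub_exp_ne {l : List V} (hl : ∀ w ∈ l, w ≠ 0) :
    ∀ᶠ ξ : V →L[ℝ] ℂ in generic V, (l.map fun w => 1 - Complex.exp (ξ w)).prod ≠ 0 := by
  induction l with
  | nil => simp
  | cons w l ih =>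
    have h0 : ∀ᶠ z in 𝓝[≠] (0 : ℂ), Complex.exp z ≠ 1 :=
      (Complex.hasDerivAt_exp 0).eventually_ne (by simp)
    filter_upwards [ih fun x hx => hl x (by simp [hx]),
      (tendsto_generic_apply (hl w (by simp))).eventually h0] with ξ h1 h2
    rw [List.map_cons, List.prod_cons]
    exact mul_ne_zero (sub_ne_zero.2 (Ne.symm h2)) h1

/-- The germ obtained from the transform of `∏_{w ∈ l} (1 - T_w) f`, where `T_w` is the translation
by `w`, by dividing by `∏_{w ∈ l} (1 - e^{⟨ξ, w⟩})`. -/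
def cutGF (ν : Measure V) (f : V → ℂ) (l : List V) : GermV V :=
  ((fun ξ => transform ν (diffList l f) ξ * ((l.map fun w => 1 - Complex.exp (ξ w)).prod)⁻¹ :
    (V →L[ℝ] ℂ) → ℂ) : GermV V)

/-- `l` is a list of nonzero vectors of `Λ` for which `∏_{w ∈ l} (1 - T_w) f` is bounded with bounded
support. -/
def IsCut (Λ : Submodule ℤ V) (f : V → ℂ) (l : List V) : Prop :=
  (∀ w ∈ l, w ∈ Λ ∧ w ≠ 0) ∧ IsTame (diffList l f)

/-- `G` is the germ `cutGF ν f l` for some admissible list `l`. For an invariant measure it does not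
depend on `l`, by `HasCutGF.unique`, and it is additive in `f`. -/
def HasCutGF (Λ : Submodule ℤ V) (ν : Measure V) (f : V → ℂ) (G : GermV V) : Prop :=
  ∃ l, IsCut Λ f l ∧ cutGF ν f l = G

variable {Λ : Submodule ℤ V} {ν : Measure V} (hfin : ∀ R, ν (Metric.closedBall 0 R) < ⊤)
  (hinv : ∀ w ∈ Λ, ν.map (fun x => x + w) = ν)

theorem IsCut.append {f : V → ℂ} {l l' : List V} (h : IsCut Λ f l) (h' : ∀ w ∈ l', w ∈ Λ ∧ w ≠ 0) :
    IsCut Λ f (l' ++ l) := by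
  refine ⟨fun w hw => (List.mem_append.1 hw).elim (h' w) (h.1 w), ?_⟩
  rw [diffList_append]
  exact h.2.diffList _

theorem IsCut.perm {f : V → ℂ} {l l' : List V} (h : IsCut Λ f l) (hp : l.Perm l') :
    IsCut Λ f l' :=
  ⟨fun w hw => h.1 w (hp.mem_iff.2 hw), by rw [← diffList_perm hp]; exact h.2⟩

theorem cutGF_perm {f : V → ℂ} {l l' : List V} (hp : l.Perm l') : cutGF ν f l = cutGF ν f l' := by
  unfold cutGF
  rw [diffList_perm hp]
  congr 1
  funext ξ
  rw [(hp.map _).prod_eq]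

include hfin hinv in
/-- Further difference operators do not change the germ: the factors they contribute to the transform
and to the denominator cancel. -/
theorem IsCut.cutGF_append {f : V → ℂ} {l l' : List V} (h : IsCut Λ f l)
    (h' : ∀ w ∈ l', w ∈ Λ ∧ w ≠ 0) : cutGF ν f (l' ++ l) = cutGF ν f l := by
  refine Germ.coe_eq.2 ?_
  filter_upwards [eventually_prod_one_sub_exp_ne fun w hw => (h' w hw).2] with ξ hξ
  rw [diffList_append, (diffList_transform (fun w hw => hinv w (h' w hw).1)
    ((h.2.mul_exp ξ).integrable hfin)).2, List.map_append, List.prod_append, mul_inv]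
  field_simp

include hfin hinv in
theorem HasCutGF.unique {f : V → ℂ} {G G' : GermV V} (h : HasCutGF Λ ν f G)
    (h' : HasCutGF Λ ν f G') : G = G' := by
  obtain ⟨l, hl, rfl⟩ := h
  obtain ⟨l', hl', rfl⟩ := h'
  rw [← hl.cutGF_append hfin hinv hl'.1, ← hl'.cutGF_append hfin hinv hl.1]
  exact cutGF_perm List.perm_append_comm

theorem hasCutGF_zero : HasCutGF Λ ν 0 0 :=
  ⟨[], ⟨by simp, isTame_zero⟩, Germ.coe_eq.2 (Eventually.of_forall fun ξ => by
    simp [diffList, transform])⟩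

include hfin hinv in
theorem HasCutGF.add {f f' : V → ℂ} {G G' : GermV V} (h : HasCutGF Λ ν f G)
    (h' : HasCutGF Λ ν f' G') : HasCutGF Λ ν (f + f') (G + G') := by
  obtain ⟨l, hl, rfl⟩ := h
  obtain ⟨l', hl', rfl⟩ := h'
  have h1 := hl.append hl'.1
  have h2 := (hl'.append hl.1).perm (List.perm_append_comm (l₁ := l) (l₂ := l'))
  refine ⟨l' ++ l, ⟨h1.1, by rw [map_add]; exact h1.2.add h2.2⟩, ?_⟩
  rw [← hl.cutGF_append hfin hinv hl'.1, ← hl'.cutGF_append hfin hinv hl.1,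
    cutGF_perm (List.perm_append_comm (l₁ := l) (l₂ := l'))]
  refine Germ.coe_eq.2 (Eventually.of_forall fun ξ => ?_)
  simp only [map_add, transform, Pi.add_apply, add_mul]
  rw [integral_add ((h1.2.mul_exp ξ).integrable hfin) ((h2.2.mul_exp ξ).integrable hfin), add_mul]

theorem HasCutGF.smul {f : V → ℂ} {G : GermV V} (h : HasCutGF Λ ν f G) (r : ℂ) :
    HasCutGF Λ ν (r • f) (r • G) := by
  obtain ⟨l, hl, rfl⟩ := h
  refine ⟨l, ⟨hl.1, by rw [map_smul]; exact hl.2.smul r⟩, ?_⟩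
  refine Germ.coe_eq.2 (Eventually.of_forall fun ξ => ?_)
  simp only [map_smul, transform, Pi.smul_apply, smul_eq_mul, mul_assoc, integral_const_mul]
  rfl

include hfin hinv in
theorem HasCutGF.sum {ι : Type*} (s : Finset ι) {f : ι → V → ℂ} {G : ι → GermV V}
    (h : ∀ i ∈ s, HasCutGF Λ ν (f i) (G i)) : HasCutGF Λ ν (∑ i ∈ s, f i) (∑ i ∈ s, G i) := by
  classical
  induction s using Finset.induction_on with
  | empty => simpa using hasCutGF_zero
  | insert i s hi ih =>
    rw [Finset.sum_insert hi, Finset.sum_insert hi]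
    exact (h i (by simp)).add hfin hinv (ih fun j hj => h j (by simp [hj]))

include hfin in
theorem IsCut.cutGF_mem {f : V → ℂ} {l : List V} (h : IsCut Λ f l) : cutGF ν f l ∈ merL := by
  refine ⟨l, fun ξ => transform ν (diffList l f) ξ * toddProd l ξ, fun w hw => (h.1 w hw).2,
    (h.2.analyticAt_transform hfin).mul (analyticAt_toddProd l), Germ.coe_eq.2 ?_⟩
  filter_upwards [eventually_generic_prod_ne fun w hw => (h.1 w hw).2] with ξ hξ
  rw [inv_prod_one_sub_exp hξ, mul_div_assoc]

include hfin hinv in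
/-- The germ attached to `f` is the transform of `f` at the points where this converges. -/
theorem HasCutGF.eventually_eq {f : V → ℂ} {G : (V →L[ℝ] ℂ) → ℂ}
    (h : HasCutGF Λ ν f (G : GermV V)) : ∀ᶠ ξ : V →L[ℝ] ℂ in generic V,
      Integrable (fun x => f x * Complex.exp (ξ x)) ν → G ξ = transform ν f ξ := by
  obtain ⟨l, hl, h⟩ := h
  filter_upwards [Germ.coe_eq.1 h, eventually_prod_one_sub_exp_ne fun w hw => (hl.1 w hw).2]
    with ξ h1 h2 h3
  rw [← h1, (diffList_transform (fun w hw => hinv w (hl.1 w hw).1) h3).2]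
  field_simp

end CutGF

section Existence

variable {V : Type*} [NormedAddCommGroup V] [NormedSpace ℝ V] [FiniteDimensional ℝ V]
  [MeasurableSpace V] [BorelSpace V] {κ : Type*} [Fintype κ] {B : Module.Basis κ ℝ V}
  {Λ : Submodule ℤ V} {L : Submodule ℝ V}

theorem ind_mul_exp {p : Set V} {ξ : V →L[ℝ] ℂ} {η : Module.Dual ℝ V}
    (h : ∀ x, ξ x = ((η x : ℝ) : ℂ)) :
    (fun x => ind p x * Complex.exp (ξ x)) =
      p.indicator fun x => ((Real.exp (η x) : ℝ) : ℂ) := by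
  funext x
  by_cases hx : x ∈ p <;> simp [ind, hx, h]

/-- The germs attached to the indicators of polyhedra, for the measure on the slices, form a valuation
as required. -/
theorem exists_isIntermediateValuation (hB : Submodule.span ℤ (Set.range B) = Λ)
    (hL : IsRationalSubspace Λ L) : ∃ F, IsIntermediateValuation Λ L F := by
  classical
  have hfin := sliceMeasure_closedBall_lt_top hB hL
  have hinv : ∀ w ∈ Λ, (sliceMeasure Λ L).map (fun x => x + w) = sliceMeasure Λ L :=
    fun w hw => map_add_sliceMeasure hB hL ⟨w, hw, rfl⟩
  have hex : ∀ p, ∃ G, IsSemiRationalPolyhedron Λ p →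
      (HasCutGF Λ (sliceMeasure Λ L) (ind p) G ∧ G ∈ merL ∧ (ContainsLine p → G = 0)) := by
    intro p
    by_cases hp : IsSemiRationalPolyhedron Λ p
    · obtain ⟨l, h1, h2, h3⟩ := exists_isTame_diffList hB hp
      refine ⟨cutGF _ (ind p) l, fun _ => ⟨⟨l, ⟨h1, h2⟩, rfl⟩,
        IsCut.cutGF_mem hfin ⟨h1, h2⟩, fun hline => ?_⟩⟩
      refine Germ.coe_eq.2 (Eventually.of_forall fun ξ => ?_)
      simp [h3 hline, transform]
    · exact ⟨0, fun h => absurd h hp⟩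
  choose F hF using hex
  refine ⟨F, fun p hp => (hF p hp).2.1, ?_, fun p hp => (hF p hp).2.2, ?_⟩
  · intro n p r hp hsum
    have h1 := HasCutGF.sum hfin hinv Finset.univ fun i _ => ((hF _ (hp i)).1).smul (r i)
    rw [hsum] at h1
    exact h1.unique hfin hinv hasCutGF_zero
  · intro p hp f hf
    have h1 := (hF p hp).1
    rw [← hf] at h1
    filter_upwards [h1.eventually_eq hfin hinv] with ξ hξ η hη hconv
    have hpm := hp.measurableSet
    have hint := hconv.integrableOn hB hL hpm
    have h2 := ind_mul_exp (p := p) hη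
    rw [hξ (by rw [h2]; exact (integrable_indicator_iff hpm).2 hint.ofReal), transform, h2,
      integral_indicator hpm, tsum_sliceIntegral hpm hint]
    exact integral_ofReal

theorem isIntermediateValuation_intermediateGF (hB : Submodule.span ℤ (Set.range B) = Λ)
    (hL : IsRationalSubspace Λ L) : IsIntermediateValuation Λ L (intermediateGF Λ L) := by
  have h := exists_isIntermediateValuation hB hL
  have : intermediateGF Λ L = h.choose := by
    funext p
    rw [intermediateGF, dif_pos h]
  rw [this]
  exact h.choose_spec

/-- A valuation on polyhedra is the restriction of a linear map on functions. -/
theorem IsIntermediateValuation.exists_linearMap {F : Set V → GermV V}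
    (hF : IsIntermediateValuation Λ L F) :
    ∃ Φ : (V → ℂ) →ₗ[ℂ] GermV V, ∀ p, IsSemiRationalPolyhedron Λ p → Φ (ind p) = F p := by
  let P := {p : Set V // IsSemiRationalPolyhedron Λ p}
  let a : (P →₀ ℂ) →ₗ[ℂ] (V → ℂ) := Finsupp.linearCombination ℂ fun p : P => ind (p : Set V)
  let b : (P →₀ ℂ) →ₗ[ℂ] GermV V := Finsupp.linearCombination ℂ fun p : P => F p
  -- the valuation property says that `b` factors through the image of `a`
  have hker : ∀ x, a x = 0 → b x = 0 := by
    intro x hx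
    let e := x.support.equivFin.symm
    have h1 : ∑ i, x (e i) • ind ((e i : P) : Set V) = 0 := by
      rw [← hx, Finsupp.linearCombination_apply, Finsupp.sum,
        ← Finset.sum_coe_sort x.support fun p => x p • ind (p : Set V)]
      exact e.sum_comp fun p => x p • ind ((p : P) : Set V)
    have h2 := hF.valuation _ (fun i => ((e i : P) : Set V)) (fun i => x (e i))
      (fun i => (e i : P).2) h1
    rw [← h2, Finsupp.linearCombination_apply, Finsupp.sum,
      ← Finset.sum_coe_sort x.support fun p => x p • F (p : Set V)]
    exact (e.sum_comp fun p => x p • F ((p : P) : Set V)).symm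
  obtain ⟨σ, hσ⟩ := a.rangeRestrict.exists_rightInverse_of_surjective a.range_rangeRestrict
  obtain ⟨Φ, hΦ⟩ := (b.comp σ).exists_extend
  refine ⟨Φ, fun p hp => ?_⟩
  have ha : a (Finsupp.single ⟨p, hp⟩ 1) = ind p := by simp [a]
  have hb : b (Finsupp.single ⟨p, hp⟩ 1) = F p := by simp [b]
  have h1 := LinearMap.congr_fun hΦ (a.rangeRestrict (Finsupp.single ⟨p, hp⟩ 1))
  have h2 : a (σ (a.rangeRestrict (Finsupp.single ⟨p, hp⟩ 1)) - Finsupp.single ⟨p, hp⟩ 1) = 0 := by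
    rw [map_sub, sub_eq_zero]
    exact congrArg Subtype.val (LinearMap.congr_fun hσ (a.rangeRestrict (Finsupp.single ⟨p, hp⟩ 1)))
  have h3 := hker _ h2
  rw [map_sub, sub_eq_zero] at h3
  rw [← hb, ← h3, ← ha]
  exact h1

end Existence

/-! ### Simplicial cones cut down to boxes -/

section Box

variable {V : Type*} [NormedAddCommGroup V] [NormedSpace ℝ V] {ι : Type*} [Fintype ι]
  [DecidableEq ι] (b : Module.Basis ι ℝ V) (s : V)

/-- The points `s + ∑ t_j b_j` with `t_j ≥ 0` for all `j` and `t_j < 1` for `j ∈ A`. -/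
def partBox (A : Finset ι) : Set V :=
  {x | ∀ j, b.repr s j ≤ b.repr x j ∧ (j ∈ A → b.repr x j < b.repr s j + 1)}

theorem partBox_empty : partBox b s ∅ = (fun x => s + x) '' coneHull b := by
  ext x
  constructor
  · intro hx
    refine ⟨x - s, mem_coneHull_basis.2 fun j => ?_, by simp⟩
    simpa using (hx j).1
  · rintro ⟨y, hy, rfl⟩ j
    simpa using mem_coneHull_basis.1 hy j

variable {b s} in
theorem partBox_anti {A A' : Finset ι} (h : A ⊆ A') : partBox b s A' ⊆ partBox b s A :=
  fun _ hx j => ⟨(hx j).1, fun hj => (hx j).2 (h hj)⟩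

variable {b s} in
theorem sub_smul_mem_partBox_insert {A : Finset ι} {j : ι} {x : V} {t : ℝ}
    (hx : x ∈ partBox b s A) (hj : j ∉ A) (ht : t ≤ b.repr x j - b.repr s j)
    (ht1 : b.repr x j - b.repr s j < t + 1) : x - t • b j ∈ partBox b s (insert j A) := by
  intro i
  by_cases hij : i = j
  · subst hij
    simp only [map_sub, map_smul, Module.Basis.repr_self, Finsupp.sub_apply, Finsupp.smul_apply,
      Finsupp.single_eq_same, smul_eq_mul, mul_one]
    exact ⟨by linarith, fun _ => by linarith⟩
  · simp only [map_sub, map_smul, Module.Basis.repr_self, Finsupp.sub_apply, Finsupp.smul_apply,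
      Finsupp.single_eq_of_ne hij, smul_eq_mul, mul_zero, sub_zero]
    exact ⟨(hx i).1, fun hi => (hx i).2 (Finset.mem_of_mem_insert_of_ne hi hij)⟩

theorem diffOp_ind_partBox {A : Finset ι} {j : ι} (hj : j ∉ A) :
    diffOp (b j) (ind (partBox b s A)) = ind (partBox b s (insert j A)) := by
  funext x
  rw [diffOp_apply]
  have hrepr : ∀ i, b.repr (x - b j) i = b.repr x i - if i = j then 1 else 0 := by
    intro i
    by_cases hij : i = j
    · subst hij; simp
    · simp [hij]
  have hsub : x - b j ∈ partBox b s A → x ∈ partBox b s A ∧ b.repr s j + 1 ≤ b.repr x j := by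
    intro h
    refine ⟨fun i => ?_, ?_⟩
    · have := h i
      rw [hrepr] at this
      by_cases hij : i = j
      · subst hij
        rw [if_pos rfl] at this
        exact ⟨by linarith [this.1], fun hi => absurd hi hj⟩
      · rwa [if_neg hij, sub_zero] at this
    · have := (h j).1
      rw [hrepr, if_pos rfl] at this
      linarith
  by_cases hx : x ∈ partBox b s A
  · by_cases hlt : b.repr x j < b.repr s j + 1
    · have h1 : x - b j ∉ partBox b s A := fun h => absurd (hsub h).2 (not_le.2 hlt)
      have h2 : x ∈ partBox b s (insert j A) := fun i => ⟨(hx i).1, fun hi => by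
        rcases Finset.mem_insert.1 hi with rfl | hi
        · exact hlt
        · exact (hx i).2 hi⟩
      simp [ind, hx, h1, h2]
    · have h1 : x - b j ∈ partBox b s A := by
        intro i
        rw [hrepr]
        by_cases hij : i = j
        · subst hij
          rw [if_pos rfl]
          exact ⟨by linarith [not_lt.1 hlt], fun hi => absurd hi hj⟩
        · rw [if_neg hij, sub_zero]; exact hx i
      have h2 : x ∉ partBox b s (insert j A) := fun h =>
        hlt ((h j).2 (Finset.mem_insert_self _ _))
      simp [ind, hx, h1, h2]
  · have h1 : x - b j ∉ partBox b s A := fun h => hx (hsub h).1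
    have h2 : x ∉ partBox b s (insert j A) := fun h => hx (partBox_anti (Finset.subset_insert _ _) h)
    simp [ind, hx, h1, h2]

theorem diffList_ind_partBox {J : List ι} (hJ : J.Nodup) :
    diffList (J.map b) (ind (partBox b s ∅)) = ind (partBox b s J.toFinset) := by
  induction J with
  | nil => rfl
  | cons j J ih =>
    rw [List.nodup_cons] at hJ
    rw [List.map_cons, diffList_cons, ih hJ.2, diffOp_ind_partBox b s (by simpa using hJ.1),
      List.toFinset_cons]

variable [FiniteDimensional ℝ V] [MeasurableSpace V] [BorelSpace V]

theorem measurableSet_partBox (A : Finset ι) : MeasurableSet (partBox b s A) := by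
  have hc : ∀ j, Continuous fun x => b.repr x j := fun j =>
    (b.coord j).continuous_of_finiteDimensional
  have : partBox b s A = ⋂ j, ({x | b.repr s j ≤ b.repr x j} ∩
      {x | j ∈ A → b.repr x j < b.repr s j + 1}) := by
    ext x; simp [partBox]
  rw [this]
  refine MeasurableSet.iInter fun j =>
    (measurableSet_le measurable_const (hc j).measurable).inter ?_
  by_cases hj : j ∈ A
  · simpa [hj] using measurableSet_lt (hc j).measurable measurable_const
  · simp [hj]

theorem isTame_ind_partBox_univ : IsTame (ind (partBox b s Finset.univ)) := by
  refine ⟨measurable_ind (measurableSet_partBox b s _), ⟨1, norm_ind_le _⟩,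
    ∑ j, (|b.repr s j| + 1) * ‖b j‖, fun x hx => ?_⟩
  refine Set.indicator_of_notMem (fun hmem => absurd hx (not_lt.2 ?_)) _
  conv_lhs => rw [← b.sum_repr x]
  refine (norm_sum_le _ _).trans (Finset.sum_le_sum fun j _ => ?_)
  rw [norm_smul]
  refine mul_le_mul_of_nonneg_right ?_ (norm_nonneg _)
  have h := hmem j
  rw [Real.norm_eq_abs, abs_le]
  constructor
  · linarith [h.1, neg_abs_le (b.repr s j)]
  · linarith [h.2 (Finset.mem_univ j), le_abs_self (b.repr s j)]

variable {ν : Measure V} (hfin : ∀ R, ν (Metric.closedBall 0 R) < ⊤)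
  (hinv : ∀ j, ν.map (fun x => x + b j) = ν)

omit [NormedSpace ℝ V] [FiniteDimensional ℝ V] in
theorem map_add_nsmul {ν : Measure V} {w : V} (h : ν.map (fun x => x + w) = ν) (n : ℕ) :
    ν.map (fun x => x + n • w) = ν := by
  induction n with
  | zero => simp
  | succ n ih =>
    conv_rhs => rw [← ih, ← h]
    rw [Measure.map_map (measurable_add_const _) (measurable_add_const _)]
    congr 1
    funext x
    simp only [Function.comp, succ_nsmul, add_assoc, add_comm w]

include hfin hinv in
/-- An exponential that decreases along the edges of a simplicial cone is integrable on the cone: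
the cone is covered by the translates of a box, and the integrals over these form geometric
series. -/
theorem setLIntegral_partBox_lt_top {ξ : V →L[ℝ] ℂ} (hξ : ∀ j, (ξ (b j)).re < 0) :
    ∫⁻ x in partBox b s ∅, ‖Complex.exp (ξ x)‖ₑ ∂ν < ⊤ := by
  -- the conditions `t_j < 1` are dropped one at a time, for `j ∈ A`
  suffices H : ∀ A : Finset ι, ∫⁻ x in partBox b s (Finset.univ \ A), ‖Complex.exp (ξ x)‖ₑ ∂ν < ⊤ by
    simpa using H Finset.univ
  intro A
  induction A using Finset.induction_on with
  | empty =>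
    rw [Finset.sdiff_empty, ← lintegral_indicator (measurableSet_partBox b s _)]
    have h := (((isTame_ind_partBox_univ b s).mul_exp ξ).integrable hfin).2
    refine lt_of_le_of_lt (lintegral_mono fun x => ?_) h
    by_cases hx : x ∈ partBox b s Finset.univ <;> simp [ind, hx]
  | insert j A hj ih =>
    set E := partBox b s (Finset.univ \ A) with hE
    have hins : insert j (Finset.univ \ insert j A) = Finset.univ \ A := by
      ext i
      by_cases hij : i = j
      · subst hij; simp [hj]
      · simp [hij]
    have hcover : partBox b s (Finset.univ \ insert j A) ⊆ ⋃ n : ℕ, {x | x - n • b j ∈ E} := by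
      intro x hx
      have h0 : 0 ≤ b.repr x j - b.repr s j := by linarith [(hx j).1]
      refine Set.mem_iUnion.2 ⟨⌊b.repr x j - b.repr s j⌋₊, ?_⟩
      have := sub_smul_mem_partBox_insert hx (by simp) (Nat.floor_le h0) (Nat.lt_floor_add_one _)
      rw [hins, Nat.cast_smul_eq_nsmul] at this
      exact this
    have hterm : ∀ n : ℕ, ∫⁻ x in {x | x - n • b j ∈ E}, ‖Complex.exp (ξ x)‖ₑ ∂ν =
        ‖Complex.exp (ξ (b j))‖ₑ ^ n * ∫⁻ x in E, ‖Complex.exp (ξ x)‖ₑ ∂ν := by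
      intro n
      have hEm : MeasurableSet {x | x - n • b j ∈ E} :=
        (measurableSet_partBox b s _).preimage (measurable_sub_const _)
      have hemb : MeasurableEmbedding fun x : V => x + n • b j :=
        (MeasurableEquiv.addRight (n • b j)).measurableEmbedding
      conv_lhs => rw [← map_add_nsmul (hinv j) n]
      rw [hemb.restrict_map, hemb.lintegral_map]
      have : (fun x => x + n • b j) ⁻¹' {x | x - n • b j ∈ E} = E := by ext x; simp
      rw [this, ← lintegral_const_mul']
      · refine lintegral_congr fun x => ?_
        rw [map_add, Complex.exp_add, enorm_mul, map_nsmul, Complex.exp_nsmul, enorm_pow, mul_comm]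
      · exact ENNReal.pow_ne_top enorm_ne_top
    refine lt_of_le_of_lt (lintegral_mono_set hcover) (lt_of_le_of_lt (lintegral_iUnion_le _ _) ?_)
    simp only [hterm]
    rw [ENNReal.tsum_mul_right, ENNReal.tsum_geometric]
    refine ENNReal.mul_lt_top (ENNReal.inv_lt_top.2 (tsub_pos_of_lt ?_)) ih
    rw [← ofReal_norm, Complex.norm_exp, ENNReal.ofReal_lt_one]
    exact (Real.exp_lt_exp.2 (hξ j)).trans_eq Real.exp_zero

include hfin hinv in
theorem integrable_ind_partBox_mul_exp {ξ : V →L[ℝ] ℂ} (hξ : ∀ j, (ξ (b j)).re < 0) :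
    Integrable (fun x => ind (partBox b s ∅) x * Complex.exp (ξ x)) ν := by
  have h := setLIntegral_partBox_lt_top b s hfin hinv hξ
  refine ⟨((measurable_ind (measurableSet_partBox b s _)).mul
    (Complex.continuous_exp.comp ξ.continuous).measurable).aestronglyMeasurable, ?_⟩
  rw [← lintegral_indicator (measurableSet_partBox b s _)] at h
  refine lt_of_le_of_lt (lintegral_mono fun x => ?_) h
  by_cases hx : x ∈ partBox b s ∅ <;> simp [ind, hx]

end Box

/-! ### The generating function of a shifted simplicial cone -/

section BoxIntegral

variable {E : Type*} [NormedAddCommGroup E] [NormedSpace ℝ E] [FiniteDimensional ℝ E]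
  [MeasurableSpace E] [BorelSpace E] {ι : Type*} [Fintype ι]

/-- The half-open parallelepiped spanned by a basis. -/
def unitBox (f : Module.Basis ι ℝ E) : Set E := {u | ∀ i, 0 ≤ f.repr u i ∧ f.repr u i < 1}

theorem setIntegral_Ico_exp {z : ℂ} (hz : z ≠ 0) :
    ∫ t in Set.Ico (0 : ℝ) 1, Complex.exp (z * t) = (Complex.exp z - 1) / z := by
  rw [integral_Ico_eq_integral_Ioo, ← integral_Ioc_eq_integral_Ioo,
    ← intervalIntegral.integral_of_le zero_le_one, integral_exp_mul_complex hz]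
  simp

/-- In the coordinates of `f` the measure is a multiple of Lebesgue measure and the exponential is a
product of functions of one variable. -/
theorem setIntegral_unitBox_exp (f : Module.Basis ι ℝ E) (μ : Measure E) [μ.IsAddLeftInvariant]
    [IsFiniteMeasureOnCompacts μ] {ξ : E →L[ℝ] ℂ} (hξ : ∀ i, ξ (f i) ≠ 0) :
    ∫ u in unitBox f, Complex.exp (ξ u) ∂μ =
      μ.real (unitBox f) * ∏ i, (Complex.exp (ξ (f i)) - 1) / ξ (f i) := by
  let e : (ι → ℝ) ≃L[ℝ] E := f.equivFun.symm.toContinuousLinearEquiv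
  have he : ∀ t : ι → ℝ, e t = ∑ i, t i • f i := fun t => f.equivFun_symm_apply t
  have hpre : e ⁻¹' unitBox f = Set.univ.pi fun _ => Set.Ico (0 : ℝ) 1 := by
    ext t
    have : ∀ i, f.repr (e t) i = t i := fun i => congrFun (f.equivFun.apply_symm_apply t) i
    simp [unitBox, this]
  have hm : MeasurableSet (Set.univ.pi fun _ : ι => Set.Ico (0 : ℝ) 1) :=
    MeasurableSet.univ_pi fun _ => measurableSet_Ico
  have hemb : MeasurableEmbedding e := e.toHomeomorph.measurableEmbedding
  have hone : (volume.map e).real (unitBox f) = 1 := by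
    rw [Measure.real, hemb.map_apply, hpre, Real.volume_pi_Ico]
    simp
  have hint : ∫ u in unitBox f, Complex.exp (ξ u) ∂(volume.map e) =
      ∏ i, (Complex.exp (ξ (f i)) - 1) / ξ (f i) := by
    rw [hemb.restrict_map, hemb.integral_map, hpre, volume_pi, Measure.restrict_pi_pi]
    have : ∀ t : ι → ℝ, Complex.exp (ξ (e t)) = ∏ i, Complex.exp (ξ (f i) * t i) := by
      intro t
      rw [he, map_sum, Complex.exp_sum]
      refine Finset.prod_congr rfl fun i _ => ?_
      rw [map_smul, Complex.real_smul, mul_comm]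
    simp only [this]
    rw [integral_fintype_prod_eq_prod (fun i (t : ℝ) => Complex.exp (ξ (f i) * t))]
    exact Finset.prod_congr rfl fun i _ => setIntegral_Ico_exp (hξ i)
  have hμ := Measure.isAddLeftInvariant_eq_smul μ (volume.map e)
  set c := Measure.addHaarScalarFactor μ (volume.map e)
  rw [hμ, Measure.restrict_smul, integral_smul_nnreal_measure, hint,
    measureReal_nnreal_smul_apply, hone, mul_one, NNReal.smul_def, Complex.real_smul]

end BoxIntegral

section Formula

variable {V : Type*} [NormedAddCommGroup V] [NormedSpace ℝ V] [FiniteDimensional ℝ V]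
  [MeasurableSpace V] [BorelSpace V] {κ : Type*} [Fintype κ] {B : Module.Basis κ ℝ V}
  {Λ : Submodule ℤ V} {L : Submodule ℝ V} {ι₁ ι₂ : Type*} [Fintype ι₁] [Fintype ι₂]
  (f : Module.Basis ι₁ ℝ L) (v : Module.Basis ι₂ ℝ (V ⧸ L)) (g : ι₂ → V)
  (hg : ∀ k, L.mkQ (g k) = v k)

/-- The vector by which the exponent of the generating function of the shifted cone differs from
`s`: a combination of the `g_k` with the fractional parts of the coordinates of `-s` as
coefficients. -/
def fractVec (s : V) : V := ∑ k, Int.fract (-(v.repr (L.mkQ s) k)) • g k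

include hg in
/-- Since `t + {-t} = ⌈t⌉`, the shift by `fractVec` leads to a vector over the projected lattice. -/
theorem mkQ_fractVec (s : V) : L.mkQ (s + fractVec v g s) = ∑ k, (⌈v.repr (L.mkQ s) k⌉ : ℝ) • v k := by
  rw [map_add, fractVec, map_sum]
  conv_lhs => rw [← v.sum_repr (L.mkQ s)]
  rw [← Finset.sum_add_distrib]
  refine Finset.sum_congr rfl fun k _ => ?_
  rw [map_smul, hg, ← add_smul, v.sum_repr, Int.fract, Int.floor_neg]
  push_cast
  ring_nf

theorem adaptedBasis_repr_add_inl (x : V) (u : L) (i : ι₁) :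
    (adaptedBasis f v g hg).repr (x + u) (Sum.inl i) =
      (adaptedBasis f v g hg).repr x (Sum.inl i) + f.repr u i := by
  classical
  rw [map_add, Finsupp.add_apply]
  congr 1
  conv_lhs => rw [← f.sum_repr u]
  rw [Submodule.coe_sum, map_sum, Finsupp.finsetSum_apply]
  simp only [Submodule.coe_smul, map_smul, Finsupp.smul_apply, smul_eq_mul]
  rw [Finset.sum_eq_single i]
  · rw [← adaptedBasis_inl f v hg, Module.Basis.repr_self, Finsupp.single_eq_same, mul_one]
  · intro j _ hj
    rw [← adaptedBasis_inl f v hg, Module.Basis.repr_self, Finsupp.single_eq_of_ne, mul_zero]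
    exact fun h => hj (Sum.inl_injective h).symm
  · simp

theorem adaptedBasis_repr_fractVec_inl (s : V) (i : ι₁) :
    (adaptedBasis f v g hg).repr (fractVec v g s) (Sum.inl i) = 0 := by
  classical
  rw [fractVec, map_sum, Finsupp.finsetSum_apply]
  refine Finset.sum_eq_zero fun k _ => ?_
  rw [← adaptedBasis_inr f v hg, map_smul, Module.Basis.repr_self]
  simp

theorem measurableEmbedding_add_coe (x : V) : MeasurableEmbedding fun u : L => x + (u : V) :=
  ((Homeomorph.addLeft x).isClosedEmbedding.comp
    (L.closed_of_finiteDimensional.isClosedEmbedding_subtypeVal)).measurableEmbedding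

/-- Exactly one slice meets a box, whose projection is a fundamental domain of the projected
lattice. -/
theorem transform_box [DecidableEq ι₁] [DecidableEq ι₂] (hB : Submodule.span ℤ (Set.range B) = Λ)
    (hL : IsRationalSubspace Λ L) (hv : Submodule.span ℤ (Set.range v) = projectedLattice Λ L) (s : V)
    (ξ : V →L[ℝ] ℂ) :
    transform (sliceMeasure Λ L) (ind (partBox (adaptedBasis f v g hg) s Finset.univ)) ξ =
      Complex.exp (ξ (s + fractVec v g s)) *
        ∫ u in unitBox f, Complex.exp (ξ (u : V)) ∂(latticeMeasure Λ L) := by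
  set b := adaptedBasis f v g hg with hb
  set x₀ := s + fractVec v g s with hx₀
  set F : V → ℂ := fun x => ind (partBox b s Finset.univ) x * Complex.exp (ξ x) with hF
  have hint : Integrable F (sliceMeasure Λ L) :=
    ((isTame_ind_partBox_univ b s).mul_exp ξ).integrable (sliceMeasure_closedBall_lt_top hB hL)
  -- the slice of `x₀` is the one that meets the box
  have hx₀q := mkQ_fractVec v g hg s
  have hmem : L.mkQ x₀ ∈ projectedLattice Λ L := by
    rw [hx₀q, ← hv]
    refine Submodule.sum_mem _ fun k _ => ?_
    rw [Int.cast_smul_eq_zsmul]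
    exact Submodule.smul_mem _ _ (Submodule.subset_span ⟨k, rfl⟩)
  have hsum := (hasSum_integral_measure hint).tsum_eq
  change ∫ x, F x ∂(sliceMeasure Λ L) = _
  rw [sliceMeasure, ← hsum, tsum_eq_single (⟨L.mkQ x₀, hmem⟩ : projectedLattice Λ L)]
  · rw [map_sliceMap (x := x₀) rfl, (measurableEmbedding_add_coe x₀).integral_map,
      ← integral_const_mul, ← integral_indicator]
    · refine integral_congr_ae (Eventually.of_forall fun u => ?_)
      have hiff : x₀ + (u : V) ∈ partBox b s Finset.univ ↔ u ∈ unitBox f := by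
        have hinl : ∀ i, b.repr (x₀ + (u : V)) (Sum.inl i) =
            b.repr s (Sum.inl i) + f.repr u i := by
          intro i
          rw [hb, adaptedBasis_repr_add_inl, hx₀, map_add, Finsupp.add_apply,
            adaptedBasis_repr_fractVec_inl, add_zero]
        have hinr : ∀ k, b.repr (x₀ + (u : V)) (Sum.inr k) = ⌈v.repr (L.mkQ s) k⌉ := by
          intro k
          have hu : L.mkQ (u : V) = 0 := by simp
          rw [hb, adaptedBasis_repr_inr, map_add, hu, add_zero, hx₀q, v.repr_sum_self]
        constructor
        · intro h i
          have := h (Sum.inl i)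
          rw [hinl] at this
          exact ⟨by linarith [this.1], by linarith [this.2 (Finset.mem_univ _)]⟩
        · rintro h (i | k)
          · rw [hinl]
            exact ⟨by linarith [(h i).1], fun _ => by linarith [(h i).2]⟩
          · rw [hinr, hb, adaptedBasis_repr_inr]
            exact ⟨Int.le_ceil _, fun _ => Int.ceil_lt_add_one _⟩
      by_cases hu : u ∈ unitBox f
      · simp only [hF, ind, Set.indicator_of_mem (hiff.2 hu), Set.indicator_of_mem hu, map_add,
          Complex.exp_add, Pi.one_apply, one_mul]
      · simp only [hF, ind, Set.indicator_of_notMem (mt hiff.1 hu), Set.indicator_of_notMem hu,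
          zero_mul]
    · have : unitBox f = partBox f 0 Finset.univ := by
        ext u; simp [unitBox, partBox]
      rw [this]
      exact measurableSet_partBox f 0 _
  · intro y hy
    rw [(isClosedEmbedding_sliceMap _).measurableEmbedding.integral_map]
    refine integral_eq_zero_of_ae (Eventually.of_forall fun u => ?_)
    have hout : sliceMap L y u ∉ partBox b s Finset.univ := by
      intro h
      apply hy
      have hq : L.mkQ (sliceMap L y u) = y := by
        rw [sliceMap, map_add, mkQ_out]; simp
      refine Subtype.ext ?_
      change (y : V ⧸ L) = L.mkQ x₀
      rw [hx₀q, ← v.sum_repr (y : V ⧸ L)]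
      refine Finset.sum_congr rfl fun k _ => ?_
      have hk := h (Sum.inr k)
      rw [hb, adaptedBasis_repr_inr, adaptedBasis_repr_inr, hq, repr_eq_projEquiv v hv] at hk
      rw [repr_eq_projEquiv v hv]
      congr 2
      -- the coordinates of a point of the lattice in the projected box are the `⌈s_k⌉`
      refine ((Int.ceil_eq_iff).2 ⟨?_, hk.1⟩).symm
      linarith [hk.2 (Finset.mem_univ _)]
    simp [hF, ind, Set.indicator_of_notMem hout]

/-- The edge generators that span the face parallel to `L`. -/
def faceList : List V := Finset.univ.toList.map fun i => (f i : V)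

/-- The remaining edge generators. -/
def liftList : List V := Finset.univ.toList.map g

/-- The part of the generating function of the shifted cone that does not depend on the shift, namely
`κ ∏ (-1 / ⟨ξ, f_i⟩) ∏ 1 / (1 - e^{⟨ξ, g_k⟩})` with `κ` the volume of the parallelepiped on the `f_i`.
It is written with the product of all the edges as denominator and a holomorphic numerator. -/
def baseFun (Λ : Submodule ℤ V) (ξ : V →L[ℝ] ℂ) : ℂ :=
  ((latticeMeasure Λ L).real (unitBox f) * (-1) ^ Fintype.card ι₁ * toddProd (liftList g) ξ) /
    ((faceList f ++ liftList g).map fun x => ξ x).prod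

theorem ne_zero_of_mem_faceList {x : V} (hx : x ∈ faceList f) : x ≠ 0 := by
  obtain ⟨i, -, rfl⟩ := List.mem_map.1 hx
  simpa using f.ne_zero i

include hg in
theorem ne_zero_of_mem_liftList {x : V} (hx : x ∈ liftList g) : x ≠ 0 := by
  obtain ⟨k, -, rfl⟩ := List.mem_map.1 hx
  intro h
  exact v.ne_zero k (by rw [← hg, h, map_zero])

include hg in
theorem ne_zero_of_mem_edges : ∀ x ∈ faceList f ++ liftList g, x ≠ 0 := fun _ hx =>
  (List.mem_append.1 hx).elim (ne_zero_of_mem_faceList f) (ne_zero_of_mem_liftList v g hg)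

theorem analyticAt_baseFun_num (c : ℂ) : AnalyticAt ℂ (fun ξ => c * toddProd (liftList g) ξ) 0 :=
  analyticAt_const.mul (analyticAt_toddProd _)

include hg in
theorem expGerm_mul_baseFun_mem (x : V) :
    ((fun ξ => Complex.exp (ξ x) * baseFun f g Λ ξ : (V →L[ℝ] ℂ) → ℂ) : GermV V) ∈ merL := by
  refine ⟨faceList f ++ liftList g, fun ξ => Complex.exp (ξ x) *
    ((latticeMeasure Λ L).real (unitBox f) * (-1) ^ Fintype.card ι₁ * toddProd (liftList g) ξ),
    ne_zero_of_mem_edges f v g hg, AnalyticAt.mul ?_ (analyticAt_baseFun_num g _), ?_⟩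
  · let ev : (V →L[ℝ] ℂ) →L[ℂ] ℂ :=
      ⟨⟨⟨fun ξ => ξ x, fun _ _ => rfl⟩, fun _ _ => rfl⟩, (ContinuousLinearMap.apply ℝ ℂ x).continuous⟩
    exact AnalyticAt.cexp (ev.analyticAt 0)
  · refine Germ.coe_eq.2 (Eventually.of_forall fun ξ => ?_)
    simp only [baseFun, mul_div_assoc]

theorem IsRationalCone.isSemiRationalPolyhedron {c : Set V} (hc : IsRationalCone Λ c) (s : V) :
    IsSemiRationalPolyhedron Λ ((fun x => s + x) '' c) := by
  obtain ⟨H, hfin, hH, rfl⟩ := hc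
  refine ⟨(fun η => (η, η s)) '' H, hfin.image _, ?_, ?_⟩
  · rintro _ ⟨η, hη, rfl⟩
    exact hH η hη
  · ext x
    constructor
    · rintro ⟨y, hy, rfl⟩ _ ⟨η, hη, rfl⟩
      simpa using hy η hη
    · intro h
      refine ⟨x - s, fun η hη => ?_, by simp⟩
      have := h _ ⟨η, hη, rfl⟩
      rw [map_sub]
      linarith

/-- The sum over the slices converges where the exponential is integrable for the measure on the
slices. -/
theorem sumConverges_of_integrableOn (hB : Submodule.span ℤ (Set.range B) = Λ)
    (hL : IsRationalSubspace Λ L) {p : Set V} (hp : MeasurableSet p) {η : Module.Dual ℝ V}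
    (h : IntegrableOn (fun x => Real.exp (η x)) p (sliceMeasure Λ L)) : SumConverges Λ L p η := by
  have := countable_projectedLattice hB hL
  have h1 := h
  rw [IntegrableOn, sliceMeasure, Measure.restrict_sum _ hp] at h1
  refine ⟨fun y hy => (integrableOn_map_sliceMap hp η y).1 ?_, ?_⟩
  · exact h1.mono_measure (Measure.le_sum (fun y : projectedLattice Λ L =>
      ((latticeMeasure Λ L).map (sliceMap L y)).restrict p) ⟨y, hy⟩)
  · refine (hasSum_integral_measure h1).summable.congr fun y => ?_
    exact integral_map_sliceMap (Λ := Λ) (L := L) hp η (y : V ⧸ L)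

/-- The values of the generating function at the points where the exponential is integrable. -/
theorem eventually_eq_transform (hB : Submodule.span ℤ (Set.range B) = Λ)
    (hL : IsRationalSubspace Λ L) {p : Set V} (hp : IsSemiRationalPolyhedron Λ p)
    {F : (V →L[ℝ] ℂ) → ℂ} (hF : (F : GermV V) = intermediateGF Λ L p) :
    ∀ᶠ ξ : V →L[ℝ] ℂ in generic V, ∀ η : Module.Dual ℝ V, ξ = cplx η →
      Integrable (fun x => ind p x * Complex.exp (ξ x)) (sliceMeasure Λ L) →
        F ξ = transform (sliceMeasure Λ L) (ind p) ξ := by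
  have hpm := hp.measurableSet
  filter_upwards [(isIntermediateValuation_intermediateGF hB hL).eq_sum p hp F hF] with ξ hξ η hη hint
  have hval : ∀ x, ξ x = ((η x : ℝ) : ℂ) := fun x => by rw [hη, cplx_apply]
  have h2 := ind_mul_exp (p := p) hval
  rw [h2] at hint
  have hre : IntegrableOn (fun x => Real.exp (η x)) p (sliceMeasure Λ L) := by
    have := ((integrable_indicator_iff hpm).1 hint).re
    exact this
  rw [hξ η hval (sumConverges_of_integrableOn hB hL hpm hre), transform, h2,
    integral_indicator hpm, tsum_sliceIntegral hpm hre]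
  exact integral_ofReal.symm

/-- The generating function of a shifted simplicial cone with a face parallel to `L` whose
projection is unimodular. -/
theorem intermediateGF_simplicial (hB : Submodule.span ℤ (Set.range B) = Λ)
    (hL : IsRationalSubspace Λ L) (hv : Submodule.span ℤ (Set.range v) = projectedLattice Λ L)
    (hc : IsRationalCone Λ (coneHull (adaptedBasis f v g hg))) (s : V) :
    intermediateGF Λ L ((fun x => s + x) '' coneHull (adaptedBasis f v g hg)) =
      expGerm (s + fractVec v g s) * (baseFun f g Λ : (V →L[ℝ] ℂ) → ℂ) := by
  classical
  set b := adaptedBasis f v g hg with hb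
  have hp := hc.isSemiRationalPolyhedron s
  set p := (fun x => s + x) '' coneHull b with hpdef
  have hF := (isIntermediateValuation_intermediateGF hB hL).mem p hp
  obtain ⟨F, hFp⟩ := Quotient.exists_rep (intermediateGF Λ L p)
  have hFp' : (F : GermV V) = intermediateGF Λ L p := hFp
  rw [← hFp'] at hF ⊢
  -- both sides are compared where the exponential decreases along the edges and the sum converges
  refine eq_of_mem_merL_of_neg b hF (expGerm_mul_baseFun_mem f v g hg _) ?_
  have hinv : ∀ j, (sliceMeasure Λ L).map (fun x => x + b j) = sliceMeasure Λ L := by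
    intro j
    refine map_add_sliceMeasure hB hL ?_
    rcases j with i | k
    · rw [hb, adaptedBasis_inl]
      have h0 : L.mkQ (f i : V) = 0 := by simp
      rw [h0]
      exact Submodule.zero_mem _
    · rw [hb, adaptedBasis_inr, hg, ← hv]
      exact Submodule.subset_span ⟨k, rfl⟩
  have hfin := sliceMeasure_closedBall_lt_top hB hL
  set J : List (ι₁ ⊕ ι₂) := Finset.univ.toList.map Sum.inl ++ Finset.univ.toList.map Sum.inr with hJ
  have hJnd : J.Nodup := by
    refine List.Nodup.append ((Finset.nodup_toList _).map Sum.inl_injective)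
      ((Finset.nodup_toList _).map Sum.inr_injective) ?_
    intro j h1 h2
    obtain ⟨i, -, rfl⟩ := List.mem_map.1 h1
    obtain ⟨k, -, hk⟩ := List.mem_map.1 h2
    cases hk
  have hJu : J.toFinset = Finset.univ := by
    ext (i | k) <;> simp [hJ]
  have hJb : J.map b = faceList f ++ liftList g := by
    rw [hJ, List.map_append, List.map_map, List.map_map]
    congr 1
    · exact List.map_congr_left fun i _ => adaptedBasis_inl f v hg i
    · exact List.map_congr_left fun k _ => adaptedBasis_inr f v hg k
  filter_upwards [eventually_eq_transform hB hL hp hFp',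
    eventually_generic_prod_ne (ne_zero_of_mem_edges f v g hg),
    eventually_prod_one_sub_exp_ne (ne_zero_of_mem_edges f v g hg)] with ξ hξ h1 h2 η hη hneg
  have hint : Integrable (fun x => ind p x * Complex.exp (ξ x)) (sliceMeasure Λ L) := by
    rw [hpdef, ← partBox_empty]
    refine integrable_ind_partBox_mul_exp b s hfin hinv fun j => ?_
    rw [hη, cplx_apply, Complex.ofReal_re]
    exact hneg j
  -- cutting the cone to a box multiplies the transform by the product of the `1 - e^{⟨ξ, b_j⟩}`
  have hcut := (diffList_transform (l := J.map b) (fun w hw => by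
    obtain ⟨j, -, rfl⟩ := List.mem_map.1 hw
    exact hinv j) hint).2
  rw [hpdef, ← partBox_empty, diffList_ind_partBox b s hJnd, hJu, hb,
    transform_box f v g hg hB hL hv, ← hb, hJb] at hcut
  have hf0 : ∀ i, (ξ.comp L.subtypeL) (f i) ≠ 0 := by
    intro i h
    refine h1 (List.prod_eq_zero ?_)
    refine List.mem_map.2 ⟨(f i : V), List.mem_append_left _ (List.mem_map.2 ⟨i, by simp, rfl⟩), h⟩
  have hbox := setIntegral_unitBox_exp f (latticeMeasure Λ L) hf0
  rw [hξ η hη hint, hpdef, ← partBox_empty]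
  have hI : ∫ u in unitBox f, Complex.exp (ξ (u : V)) ∂(latticeMeasure Λ L) =
      (latticeMeasure Λ L).real (unitBox f) * (-1) ^ Fintype.card ι₁ *
        (((faceList f).map fun w => 1 - Complex.exp (ξ w)).prod /
          ((faceList f).map fun w => ξ w).prod) := by
    refine hbox.trans ?_
    rw [mul_assoc]
    congr 1
    simp only [faceList, List.map_map, Finset.prod_map_toList, Function.comp_def]
    rw [← Finset.prod_div_distrib, ← Finset.card_univ, ← Finset.prod_const, ← Finset.prod_mul_distrib]
    refine Finset.prod_congr rfl fun i _ => ?_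
    change (Complex.exp (ξ (f i)) - 1) / ξ (f i) = _
    ring
  rw [hI] at hcut
  rw [List.map_append, List.prod_append] at h1 h2 hcut
  obtain ⟨h11, h12⟩ := mul_ne_zero_iff.1 h1
  obtain ⟨h21, h22⟩ := mul_ne_zero_iff.1 h2
  have hT := inv_prod_one_sub_exp h12
  rw [inv_eq_iff_eq_inv, inv_div] at hT
  have htodd : toddProd (liftList g) ξ ≠ 0 := by
    intro h
    rw [h, div_zero] at hT
    exact h22 hT
  rw [baseFun, List.map_append, List.prod_append]
  rw [hT] at hcut
  field_simp at hcut ⊢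
  rw [← hcut]

end Formula

/-! ### Volumes of parallelepipeds -/

section Volume

variable {V : Type*} [NormedAddCommGroup V] [NormedSpace ℝ V] [FiniteDimensional ℝ V]
  [MeasurableSpace V] [BorelSpace V] {Λ : Submodule ℤ V} {L : Submodule ℝ V}

theorem unitBox_eq_fundamentalDomain {E ι : Type*} [NormedAddCommGroup E] [NormedSpace ℝ E]
    [Fintype ι] (f : Module.Basis ι ℝ E) : unitBox f = ZSpan.fundamentalDomain f := by
  ext u; simp [unitBox, ZSpan.mem_fundamentalDomain]

/-- The parallelepiped spanned by a basis `f₀` of the lattice `L ∩ Λ` has volume `1`, so volumes of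
parallelepipeds are determinants in such a basis. -/
theorem latticeMeasure_unitBox {ι : Type*} [Fintype ι] [DecidableEq ι] (f₀ f : Module.Basis ι ℝ L)
    (h : Submodule.span ℤ (Set.range f₀) = Λ.comap (L.subtype.restrictScalars ℤ)) :
    (latticeMeasure Λ L).real (unitBox f) = |f₀.det f| := by
  have hcov := ZLattice.covolume_eq_measure_fundamentalDomain (Submodule.span ℤ (Set.range f₀))
    (Measure.addHaar (G := L)) (ZSpan.isAddFundamentalDomain f₀ _)
  have hne := ZLattice.covolume_ne_zero (Submodule.span ℤ (Set.range f₀)) (Measure.addHaar (G := L))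
  have hnonneg : 0 ≤ ZLattice.covolume (Submodule.span ℤ (Set.range f₀)) (Measure.addHaar (G := L)) :=
    ENNReal.toReal_nonneg
  rw [unitBox_eq_fundamentalDomain, latticeMeasure, ← h, measureReal_ennreal_smul_apply,
    ENNReal.toReal_ofReal (inv_nonneg.2 hnonneg), ZSpan.measureReal_fundamentalDomain f _ f₀, ← hcov]
  field_simp

/-- As `L` is rational, `L ∩ Λ` is a lattice in `L` and has a basis. -/
theorem exists_integral_basis [DiscreteTopology Λ] (hL : IsRationalSubspace Λ L) :
    ∃ f : Module.Basis (Fin (Module.finrank ℝ L)) ℝ L,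
      Submodule.span ℤ (Set.range f) = Λ.comap (L.subtype.restrictScalars ℤ) := by
  set Λ' : Submodule ℤ L := Λ.comap (L.subtype.restrictScalars ℤ) with hΛ'
  have hd : DiscreteTopology Λ' :=
    DiscreteTopology.preimage_of_continuous_injective (Λ : Set V) continuous_subtype_val
      Subtype.val_injective
  have hz : IsZLattice ℝ Λ' := by
    refine ⟨?_⟩
    have himg : (L.subtype '' (Λ' : Set L)) = (L : Set V) ∩ Λ := by
      ext x
      constructor
      · rintro ⟨y, hy, rfl⟩
        exact ⟨y.2, hy⟩
      · rintro ⟨hx, hx'⟩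
        exact ⟨⟨x, hx⟩, hx', rfl⟩
    refine Submodule.map_injective_of_injective L.injective_subtype ?_
    rw [Submodule.map_span, himg, Submodule.map_top, Submodule.range_subtype]
    exact hL
  have : Module.Finite ℤ Λ' := ZLattice.module_finite ℝ Λ'
  have : Module.Free ℤ Λ' := ZLattice.module_free ℝ Λ'
  let f := (Module.Free.chooseBasis ℤ Λ').ofZLatticeBasis ℝ
  let e := Fintype.equivFinOfCardEq (Module.finrank_eq_card_basis f).symm
  refine ⟨f.reindex e, ?_⟩
  rw [Module.Basis.range_reindex]
  exact (Module.Free.chooseBasis ℤ Λ').ofZLatticeBasis_span ℝ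

theorem isRationalSubspace_top [DiscreteTopology Λ] [IsZLattice ℝ Λ] :
    IsRationalSubspace Λ (⊤ : Submodule ℝ V) := by
  rw [IsRationalSubspace, Submodule.top_coe, Set.univ_inter]
  exact IsZLattice.span_top

variable {ι₁ ι₂ : Type*} [Fintype ι₁] [Fintype ι₂] (f : Module.Basis ι₁ ℝ L)
  (v : Module.Basis ι₂ ℝ (V ⧸ L)) (g : ι₂ → V) (hg : ∀ k, L.mkQ (g k) = v k)

/-- A basis of `V`, as a basis of the subspace `⊤`. -/
def topBasis {ι : Type*} (b : Module.Basis ι ℝ V) : Module.Basis ι ℝ (⊤ : Submodule ℝ V) :=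
  b.map Submodule.topEquiv.symm

theorem topBasis_apply {ι : Type*} (b : Module.Basis ι ℝ V) (i : ι) :
    (topBasis b i : V) = b i := rfl

/-- A basis of `L ∩ Λ` and lifts to `Λ` of a basis of the projected lattice form a basis of `Λ`. -/
theorem span_adaptedBasis_eq {f : Module.Basis ι₁ ℝ L}
    (hf : Submodule.span ℤ (Set.range f) = Λ.comap (L.subtype.restrictScalars ℤ))
    (hv : Submodule.span ℤ (Set.range v) = projectedLattice Λ L) (hgΛ : ∀ k, g k ∈ Λ) :
    Submodule.span ℤ (Set.range (topBasis (adaptedBasis f v g hg))) =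
      Λ.comap ((⊤ : Submodule ℝ V).subtype.restrictScalars ℤ) := by
  set b := adaptedBasis f v g hg with hb
  have hfΛ : ∀ i, (f i : V) ∈ Λ := fun i => by
    have : f i ∈ Λ.comap (L.subtype.restrictScalars ℤ) := hf ▸ Submodule.subset_span ⟨i, rfl⟩
    exact this
  refine le_antisymm (Submodule.span_le.2 ?_) ?_
  · rintro _ ⟨i | k, rfl⟩
    · change (b (Sum.inl i) : V) ∈ Λ
      rw [hb, adaptedBasis_inl]
      exact hfΛ i
    · change (b (Sum.inr k) : V) ∈ Λ
      rw [hb, adaptedBasis_inr]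
      exact hgΛ k
  · rintro ⟨x, hxt⟩ hx
    replace hx : x ∈ Λ := hx
    have hq : L.mkQ x ∈ Submodule.span ℤ (Set.range v) := hv ▸ ⟨x, hx, rfl⟩
    obtain ⟨n, hn⟩ := (Submodule.mem_span_range_iff_exists_fun ℤ).1 hq
    have hyL : x - ∑ k, n k • g k ∈ L := by
      rw [← Submodule.Quotient.mk_eq_zero, ← Submodule.mkQ_apply, map_sub, map_sum, ← hn, sub_eq_zero]
      exact Finset.sum_congr rfl fun k _ => by rw [map_zsmul, hg]
    have hyΛ : x - ∑ k, n k • g k ∈ Λ :=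
      Submodule.sub_mem _ hx (Submodule.sum_mem _ fun k _ => Submodule.smul_mem _ _ (hgΛ k))
    have hy : (⟨_, hyL⟩ : L) ∈ Submodule.span ℤ (Set.range f) := by
      rw [hf]; exact hyΛ
    obtain ⟨m, hm⟩ := (Submodule.mem_span_range_iff_exists_fun ℤ).1 hy
    have hx' : (⟨x, trivial⟩ : (⊤ : Submodule ℝ V)) =
        ∑ i, m i • topBasis b (Sum.inl i) + ∑ k, n k • topBasis b (Sum.inr k) := by
      refine Subtype.ext ?_
      have h1 := congrArg Subtype.val hm
      simp only [Submodule.coe_sum, Submodule.coe_smul_of_tower] at h1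
      simp only [Submodule.coe_add, Submodule.coe_sum, Submodule.coe_smul_of_tower, topBasis_apply, hb,
        adaptedBasis_inl, adaptedBasis_inr, h1]
      abel
    rw [hx']
    exact Submodule.add_mem _
      (Submodule.sum_mem _ fun i _ => Submodule.smul_mem _ _ (Submodule.subset_span ⟨_, rfl⟩))
      (Submodule.sum_mem _ fun k _ => Submodule.smul_mem _ _ (Submodule.subset_span ⟨_, rfl⟩))

/-- The volume of the parallelepiped on an edge basis is that of its face parallel to `L`, as the
projections of the other edges form a basis of the projected lattice. -/
theorem latticeMeasure_unitBox_top [DiscreteTopology Λ] (hL : IsRationalSubspace Λ L)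
    (hv : Submodule.span ℤ (Set.range v) = projectedLattice Λ L) :
    (latticeMeasure Λ ⊤).real (unitBox (topBasis (adaptedBasis f v g hg))) =
      (latticeMeasure Λ L).real (unitBox f) := by
  classical
  obtain ⟨f₁, hf₁⟩ := exists_integral_basis hL
  let e : Fin (Module.finrank ℝ L) ≃ ι₁ :=
    (Fintype.equivFinOfCardEq (Module.finrank_eq_card_basis f).symm).symm
  set f₀ := f₁.reindex e with hf₀def
  have hf₀ : Submodule.span ℤ (Set.range f₀) = Λ.comap (L.subtype.restrictScalars ℤ) := by
    rw [hf₀def, Module.Basis.range_reindex]; exact hf₁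
  have hlift : ∀ k, ∃ x ∈ Λ, L.mkQ x = v k := by
    intro k
    have : v k ∈ projectedLattice Λ L := hv ▸ Submodule.subset_span ⟨k, rfl⟩
    obtain ⟨x, hx, hxk⟩ := this
    exact ⟨x, hx, hxk⟩
  -- volumes are computed in a basis of `Λ` made of a basis of `L ∩ Λ` and lifts of the `v k`; in
  -- it the matrix of the edges is block triangular, the second diagonal block being the identity
  choose g₀ hg₀Λ hg₀ using hlift
  rw [latticeMeasure_unitBox f₀ f hf₀,
    latticeMeasure_unitBox _ _ (span_adaptedBasis_eq v g₀ hg₀ hf₀ hv hg₀Λ)]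
  congr 1
  rw [Module.Basis.det_apply, Module.Basis.det_apply]
  have hmat : (topBasis (adaptedBasis f₀ v g₀ hg₀)).toMatrix (topBasis (adaptedBasis f v g hg)) =
      Matrix.fromBlocks (f₀.toMatrix f)
        (Matrix.of fun i k => (adaptedBasis f₀ v g₀ hg₀).repr (g k) (Sum.inl i)) 0 1 := by
    have hrepr : ∀ i j, (topBasis (adaptedBasis f₀ v g₀ hg₀)).toMatrix
        (topBasis (adaptedBasis f v g hg)) i j =
          (adaptedBasis f₀ v g₀ hg₀).repr (adaptedBasis f v g hg j) i := by
      intro i j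
      simp [Module.Basis.toMatrix_apply, topBasis]
    ext (i | k) (j | l)
    · rw [hrepr, adaptedBasis_inl, ← zero_add (f j : V), adaptedBasis_repr_add_inl]
      simp [Module.Basis.toMatrix_apply]
    · rw [hrepr, adaptedBasis_inr]
      simp
    · have h0 : L.mkQ (f j : V) = 0 := by simp
      rw [hrepr, adaptedBasis_inl, adaptedBasis_repr_inr, h0]
      simp
    · rw [hrepr, adaptedBasis_inr, adaptedBasis_repr_inr, hg, Module.Basis.repr_self,
        Matrix.fromBlocks_apply₂₂, Matrix.one_apply, Finsupp.single_apply]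
      simp only [eq_comm]
  rw [hmat, Matrix.det_fromBlocks_zero₂₁, Matrix.det_one, mul_one]

/-- The continuous generating function of a simplicial cone. -/
theorem I_coneHull {κ : Type*} [Fintype κ] {B : Module.Basis κ ℝ V}
    (hB : Submodule.span ℤ (Set.range B) = Λ) (hV : IsRationalSubspace Λ (⊤ : Submodule ℝ V))
    {ι : Type*} [Fintype ι] (b : Module.Basis ι ℝ V) (hc : IsRationalCone Λ (coneHull b)) :
    I Λ (coneHull b) =
      ((fun ξ => ((latticeMeasure Λ ⊤).real (unitBox (topBasis b)) * (-1) ^ Fintype.card ι) /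
        ∏ i, ξ (b i) : (V →L[ℝ] ℂ) → ℂ) : GermV V) := by
  have hsub : Subsingleton (V ⧸ (⊤ : Submodule ℝ V)) := Submodule.Quotient.subsingleton_iff.2 rfl
  -- the case `L = V` of the formula for simplicial cones
  let v : Module.Basis Empty ℝ (V ⧸ (⊤ : Submodule ℝ V)) := Module.Basis.empty _
  let g : Empty → V := fun k => k.elim
  have hg : ∀ k, (⊤ : Submodule ℝ V).mkQ (g k) = v k := fun k => k.elim
  have hv : Submodule.span ℤ (Set.range v) = projectedLattice Λ (⊤ : Submodule ℝ V) := by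
    ext x
    rw [Subsingleton.elim x 0]
    simp
  have hcone : coneHull (adaptedBasis (topBasis b) v g hg) = coneHull b := by
    ext x
    constructor
    · rintro ⟨t, ht, rfl⟩
      refine ⟨fun i => t (Sum.inl i), fun i => ht _, ?_⟩
      simp [Fintype.sum_sum_type, adaptedBasis_inl, topBasis_apply]
    · rintro ⟨t, ht, rfl⟩
      refine ⟨Sum.elim t fun k => k.elim, ?_, ?_⟩
      · rintro (i | k)
        · exact ht i
        · exact k.elim
      · simp [Fintype.sum_sum_type, adaptedBasis_inl, topBasis_apply]
  have h := intermediateGF_simplicial (topBasis b) v g hg hB hV hv (by rwa [hcone]) 0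
  rw [hcone] at h
  have h0 : (fun x : V => 0 + x) '' coneHull b = coneHull b := by simp
  rw [h0] at h
  rw [I, h]
  refine Germ.coe_eq.2 (Eventually.of_forall fun ξ => ?_)
  have hfv : fractVec v g 0 = 0 := by simp [fractVec]
  simp [hfv, baseFun, liftList, faceList, toddProd, topBasis_apply]

end Volume

/-! ### Step-polynomials with values in rational functions -/

section Tensor

variable {V : Type*} [NormedAddCommGroup V] [NormedSpace ℝ V]

instance : IsScalarTower ℂ (GermV V) (GermV V) :=
  ⟨fun c F G => Filter.Germ.inductionOn₂ F G fun f g =>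
    Germ.coe_eq.2 (Eventually.of_forall fun ξ => mul_assoc c (f ξ) (g ξ))⟩

instance : SMulCommClass ℂ (GermV V) (GermV V) :=
  ⟨fun c F G => Filter.Germ.inductionOn₂ F G fun f g =>
    Germ.coe_eq.2 (Eventually.of_forall fun ξ => mul_left_comm c (f ξ) (g ξ))⟩

theorem linGerm_mul_mem_ratHom {q : ℤ} {R : GermV V} (hR : R ∈ ratHom q) (x : V) :
    linGerm x * R ∈ ratHom (q + 1) := by
  have hpoly : ∀ (n : ℕ) (P : (V →L[ℝ] ℂ) → ℂ), P ∈ homPolyDual V n →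
      (fun ξ : V →L[ℝ] ℂ => ξ x * P ξ) ∈ homPolyDual V (n + 1) := by
    intro n P hP
    induction hP using Submodule.span_induction with
    | mem P h =>
      obtain ⟨l, hl, rfl⟩ := h
      exact Submodule.subset_span ⟨x :: l, by simp [hl], by simp⟩
    | zero =>
      convert (homPolyDual V (n + 1)).zero_mem using 1
      funext ξ
      simp
    | add P Q _ _ hP hQ =>
      convert add_mem hP hQ using 1
      funext ξ
      simp [mul_add]
    | smul c P _ hP =>
      convert Submodule.smul_mem _ c hP using 1
      funext ξ
      simp only [Pi.smul_apply, smul_eq_mul]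
      ring
  induction hR using Submodule.span_induction with
  | mem R h =>
    obtain ⟨w, n, P, hw, hn, hP, rfl⟩ := h
    refine Submodule.subset_span ⟨w, n + 1, _, hw, by push_cast; linarith, hpoly n P hP, ?_⟩
    refine Germ.coe_eq.2 (Eventually.of_forall fun ξ => ?_)
    simp only [mul_div_assoc]
  | zero => simp
  | add P Q _ _ hP hQ => rw [mul_add]; exact add_mem hP hQ
  | smul c P _ hP => rw [mul_smul_comm]; exact Submodule.smul_mem _ c hP

theorem linGerm_sum {ι : Type*} (s : Finset ι) (t : ι → ℝ) (g : ι → V) :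
    linGerm (∑ k ∈ s, t k • g k) = ∑ k ∈ s, ((t k : ℝ) : ℂ) • linGerm (g k) := by
  classical
  induction s using Finset.induction_on with
  | empty => exact Germ.coe_eq.2 (Eventually.of_forall fun ξ => by simp)
  | insert i s hi ih =>
    rw [Finset.sum_insert hi, Finset.sum_insert hi, ← ih]
    refine Germ.coe_eq.2 (Eventually.of_forall fun ξ => ?_)
    simp only [map_add, map_smul, Complex.real_smul]
    rfl

theorem tensorFun_mono {A A' : Submodule ℝ (V → ℝ)} (h : A ≤ A') (B : Submodule ℂ (GermV V)) :
    tensorFun A B ≤ tensorFun A' B := by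
  refine Submodule.span_mono ?_
  rintro _ ⟨q, hq, R, hR, rfl⟩
  exact ⟨q, h hq, R, hR, rfl⟩

theorem smul_linGerm_mul_mem_tensorFun {A A' : Submodule ℝ (V → ℝ)} {t : V → ℝ}
    (h : ∀ a ∈ A, t * a ∈ A') {q : ℤ} {F : V → GermV V} (hF : F ∈ tensorFun A (ratHom q)) (x : V) :
    (fun s => (((t s : ℝ) : ℂ) • linGerm x) * F s) ∈ tensorFun A' (ratHom (q + 1)) := by
  induction hF using Submodule.span_induction with
  | mem F hF =>
    obtain ⟨a, ha, R, hR, rfl⟩ := hF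
    refine Submodule.subset_span ⟨t * a, h a ha, linGerm x * R, linGerm_mul_mem_ratHom hR x, ?_⟩
    funext s
    simp only [Pi.mul_apply, Complex.ofReal_mul, smul_mul_assoc, mul_smul_comm, smul_smul]
    rw [mul_comm ((a s : ℝ) : ℂ)]
  | zero =>
    convert (tensorFun A' (ratHom (q + 1))).zero_mem using 1
    funext s
    simp
  | add P Q _ _ hP hQ =>
    convert add_mem hP hQ using 1
    funext s
    simp [mul_add]
  | smul c P _ hP =>
    convert Submodule.smul_mem _ c hP using 1
    funext s
    simp only [Pi.smul_apply, mul_smul_comm]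

/-- Powers of a linear form whose coefficients are functions of `s` raise the degree in `s` and the
degree in `ξ` by the exponent. -/
theorem linGerm_pow_mul_mem_tensorFun {ι : Type*} [Fintype ι] {A : ℕ → Submodule ℝ (V → ℝ)}
    {t : ι → V → ℝ} (hA : ∀ r k, ∀ a ∈ A r, t k * a ∈ A (r + 1)) (g : ι → V) {q : ℤ}
    {F : V → GermV V} (hF : F ∈ tensorFun (A 0) (ratHom q)) (r : ℕ) :
    (fun s => linGerm (∑ k, t k s • g k) ^ r * F s) ∈ tensorFun (A r) (ratHom (q + r)) := by
  induction r with
  | zero => simpa using hF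
  | succ r ih =>
    have h1 : ∀ k ∈ Finset.univ, _ := fun k (_ : k ∈ Finset.univ) =>
      smul_linGerm_mul_mem_tensorFun (hA r k) ih (g k)
    have h2 := Submodule.sum_mem _ h1
    rw [Nat.cast_succ, ← add_assoc]
    convert h2 using 1
    funext s
    rw [Finset.sum_apply, ← Finset.sum_mul, ← linGerm_sum, pow_succ', mul_assoc]

theorem stepPoly_mono (Ψ : Set (Module.Dual ℝ V)) {k k' : ℤ} (h : k ≤ k') :
    stepPoly Ψ k ≤ stepPoly Ψ k' := by
  refine Submodule.span_mono ?_
  rintro _ ⟨l, hl, hk, rfl⟩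
  exact ⟨l, hl, hk.trans h, rfl⟩

theorem one_mem_stepPoly (Ψ : Set (Module.Dual ℝ V)) : (1 : V → ℝ) ∈ stepPoly Ψ 0 :=
  Submodule.subset_span ⟨[], by simp, by simp, by funext s; simp⟩

theorem fract_mul_mem_stepPoly {Ψ : Set (Module.Dual ℝ V)} {ψ : Module.Dual ℝ V} (hψ : ψ ∈ Ψ) {k : ℤ}
    {a : V → ℝ} (ha : a ∈ stepPoly Ψ k) : (fun s => Int.fract (ψ s)) * a ∈ stepPoly Ψ (k + 1) := by
  induction ha using Submodule.span_induction with
  | mem a h =>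
    obtain ⟨l, hl, hk, rfl⟩ := h
    refine Submodule.subset_span ⟨ψ :: l, ?_, by simpa using hk, ?_⟩
    · intro η hη
      rcases List.mem_cons.1 hη with rfl | hη
      · exact hψ
      · exact hl η hη
    · funext s; simp
  | zero => simp
  | add P Q _ _ hP hQ => rw [mul_add]; exact add_mem hP hQ
  | smul c P _ hP => rw [mul_smul_comm]; exact Submodule.smul_mem _ c hP

theorem mul_mem_homPoly {r : ℕ} {h : V → ℝ} (hh : h ∈ homPoly V r) (η : Module.Dual ℝ V) :
    (fun s => η s) * h ∈ homPoly V (r + 1) := by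
  induction hh using Submodule.span_induction with
  | mem a h =>
    obtain ⟨l, hl, rfl⟩ := h
    exact Submodule.subset_span ⟨η :: l, by simp [hl], by funext s; simp⟩
  | zero => simp
  | add P Q _ _ hP hQ => rw [mul_add]; exact add_mem hP hQ
  | smul c P _ hP => rw [mul_smul_comm]; exact Submodule.smul_mem _ c hP

theorem mul_mem_quasiPoly {Ψ : Set (Module.Dual ℝ V)} {q : ℤ} {a : V → ℝ} (ha : a ∈ quasiPoly Ψ q)
    (η : Module.Dual ℝ V) : (fun s => η s) * a ∈ quasiPoly Ψ (q + 1) := by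
  induction ha using Submodule.span_induction with
  | mem a h =>
    obtain ⟨k, r, hkr, g, hg, h, hh, rfl⟩ := h
    exact Submodule.subset_span ⟨k, r + 1, by push_cast; linarith, g, hg, _, mul_mem_homPoly hh η,
      mul_left_comm _ _ _⟩
  | zero => simp
  | add P Q _ _ hP hQ => rw [mul_add]; exact add_mem hP hQ
  | smul c P _ hP => rw [mul_smul_comm]; exact Submodule.smul_mem _ c hP

theorem stepPoly_le_quasiPoly (Ψ : Set (Module.Dual ℝ V)) (k : ℤ) : stepPoly Ψ k ≤ quasiPoly Ψ k := by
  intro g hg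
  exact Submodule.subset_span ⟨k, 0, by simp, g, hg, 1,
    Submodule.subset_span ⟨[], rfl, by funext s; simp⟩, (mul_one g).symm⟩

end Tensor

/-! ### Decomposing the generating function of a cone -/

section Assembly

variable {V : Type*} [NormedAddCommGroup V] [NormedSpace ℝ V] [FiniteDimensional ℝ V]
  [MeasurableSpace V] [BorelSpace V] {Λ : Submodule ℤ V} {L : Submodule ℝ V}
  {κ : Type*} [Fintype κ] {B : Module.Basis κ ℝ V}

/-- The generating function of the shifted cones extends to a linear map on functions that vanishes
on the indicators of cones containing lines. -/
theorem exists_linearMap_shift (hB : Submodule.span ℤ (Set.range B) = Λ)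
    (hL : IsRationalSubspace Λ L) (s : V) :
    ∃ Φ : (V → ℂ) →ₗ[ℂ] GermV V,
      (∀ c, IsRationalCone Λ c → Φ (ind c) = intermediateGF Λ L ((fun x => s + x) '' c)) ∧
      ∀ f g, CongrModLines Λ f g → Φ f = Φ g := by
  have hval := isIntermediateValuation_intermediateGF hB hL
  obtain ⟨Φ, hΦ⟩ := hval.exists_linearMap
  have hT : ∀ c : Set V, (LinearMap.funLeft ℂ ℂ fun x => x - s) (ind c) =
      ind ((fun x => s + x) '' c) := by
    intro c
    funext x
    rw [LinearMap.funLeft_apply, ind, ind]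
    have hiff : x - s ∈ c ↔ x ∈ (fun x => s + x) '' c :=
      ⟨fun h => ⟨x - s, h, by simp⟩, by rintro ⟨y, hy, rfl⟩; simpa using hy⟩
    by_cases hx : x - s ∈ c
    · rw [Set.indicator_of_mem hx, Set.indicator_of_mem (hiff.1 hx)]; rfl
    · rw [Set.indicator_of_notMem hx, Set.indicator_of_notMem (mt hiff.2 hx)]
  refine ⟨Φ ∘ₗ LinearMap.funLeft ℂ ℂ fun x => x - s, fun c hc => ?_, fun f g hfg => ?_⟩
  · rw [LinearMap.comp_apply, hT, hΦ _ (hc.isSemiRationalPolyhedron s)]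
  · rw [← sub_eq_zero, ← map_sub]
    have hle : Submodule.span ℂ {h : V → ℂ | ∃ k : Set V, IsRationalCone Λ k ∧ ContainsLine k ∧
        h = ind k} ≤ LinearMap.ker (Φ ∘ₗ LinearMap.funLeft ℂ ℂ fun x => x - s) := by
      refine Submodule.span_le.2 ?_
      rintro _ ⟨k, hk, ⟨x, v, hv, hline⟩, rfl⟩
      have hp := hk.isSemiRationalPolyhedron s
      change (Φ ∘ₗ LinearMap.funLeft ℂ ℂ fun x => x - s) (ind k) = 0
      rw [LinearMap.comp_apply, hT, hΦ _ hp]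
      exact hval.line _ hp ⟨s + x, v, hv, fun t => ⟨x + t • v, hline t, by simp [add_assoc]⟩⟩
    exact hle hfg

theorem isRationalCone_coneHull {κ' : Type*} [Fintype κ'] {W : Type*} [AddCommGroup W] [Module ℝ W]
    {Γ : Submodule ℤ W} {C : Module.Basis κ' ℝ W} (hC : Submodule.span ℤ (Set.range C) = Γ) :
    IsRationalCone Γ (coneHull C) := by
  have : coneHull C = dualCone fun k => -C.coord k := by
    ext x
    rw [mem_coneHull_basis]
    simp [dualCone]
  rw [this]
  exact isRationalCone_dualCone fun k => neg_mem_dualLattice (coord_mem_dualLattice hC k)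

variable {ι₁ ι₂ : Type*} [Fintype ι₁] [Fintype ι₂] (f : Module.Basis ι₁ ℝ L)
  (v : Module.Basis ι₂ ℝ (V ⧸ L)) (g : ι₂ → V) (hg : ∀ k, L.mkQ (g k) = v k)

/-- The homogeneous components of the part of the generating function that does not depend on the
shift; the lowest one is the continuous generating function. -/
theorem exists_hasComps_baseFun [DiscreteTopology Λ] [IsZLattice ℝ Λ]
    (hB : Submodule.span ℤ (Set.range B) = Λ) (hL : IsRationalSubspace Λ L)
    (hv : Submodule.span ℤ (Set.range v) = projectedLattice Λ L)
    (hc : IsRationalCone Λ (coneHull (adaptedBasis f v g hg))) :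
    ∃ A : ℕ → GermV V, (∀ n : ℕ, A n ∈ ratHom ((n : ℤ) - Module.finrank ℝ V)) ∧
      HasComps (Module.finrank ℝ V) ((baseFun f g Λ : (V →L[ℝ] ℂ) → ℂ) : GermV V) A ∧
      A 0 = I Λ (coneHull (adaptedBasis f v g hg)) := by
  obtain ⟨A, h1, h2, h3⟩ := exists_hasComps (ne_zero_of_mem_edges f v g hg)
    (analyticAt_baseFun_num g ((latticeMeasure Λ L).real (unitBox f) * (-1) ^ Fintype.card ι₁))
  have hlen : (faceList f ++ liftList g).length = Module.finrank ℝ V := by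
    rw [Module.finrank_eq_card_basis (adaptedBasis f v g hg)]
    simp [faceList, liftList]
  rw [hlen] at h1 h2
  refine ⟨A, h1, h2, ?_⟩
  rw [h3, I_coneHull hB isRationalSubspace_top _ hc]
  refine Germ.coe_eq.2 (Eventually.of_forall fun ξ => ?_)
  simp only [latticeMeasure_unitBox_top f v g hg hL hv, toddProd_zero, Fintype.card_sum,
    Fintype.prod_sum_type, adaptedBasis_inl, adaptedBasis_inr, List.map_append, List.prod_append,
    faceList, liftList, List.map_map, Finset.prod_map_toList, List.length_map, Finset.length_toList,
    Finset.card_univ, pow_add, Function.comp_def, mul_assoc]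

/-- The generating function of the simplicial cones of a decomposition. -/
theorem Decomposition.exists_formula [DiscreteTopology Λ] [IsZLattice ℝ Λ]
    (hB : Submodule.span ℤ (Set.range B) = Λ) (hL : IsRationalSubspace Λ L) {c : Set V}
    (D : Decomposition Λ L c) (i : Fin D.n) (a : Fin (D.un i)) :
    IsRationalCone Λ (pullCone (D.gen i) (D.face i) L (coneHull (D.ugen i a))) ∧
    ∃ (g : Fin (Module.finrank ℝ (V ⧸ L)) → V) (G : GermV V) (A : ℕ → GermV V),
      (∀ s, intermediateGF Λ L
        ((fun x => s + x) '' pullCone (D.gen i) (D.face i) L (coneHull (D.ugen i a))) =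
          expGerm (s + fractVec (D.ugen i a) g s) * G) ∧
      (∀ n : ℕ, A n ∈ ratHom ((n : ℤ) - Module.finrank ℝ V)) ∧
      HasComps (Module.finrank ℝ V) G A ∧
      A 0 = I Λ (pullCone (D.gen i) (D.face i) L (coneHull (D.ugen i a))) := by
  classical
  have : Fintype (D.face i) := Fintype.ofFinite _
  have hc := isRationalCone_pullCone (D.gen i) (D.face i) hB (D.gen_mem i)
    (isRationalCone_coneHull (D.ugen_span i a))
  refine ⟨hc, ?_⟩
  choose g hg hgf using fun k => exists_lift (D.span_face i) (D.ugen i a k)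
  rw [pullCone_coneHull (D.span_face i) (D.ugen i a) hg hgf] at hc ⊢
  obtain ⟨A, h1, h2, h3⟩ := exists_hasComps_baseFun _ _ g hg hB hL (D.ugen_span i a) hc
  exact ⟨g, _, A, intermediateGF_simplicial _ _ g hg hB hL (D.ugen_span i a) hc, h1, h2, h3⟩

end Assembly

/-! ### Components of the generating function of a cone -/

section Components

variable {V : Type*} [NormedAddCommGroup V] [NormedSpace ℝ V] [FiniteDimensional ℝ V]
  [MeasurableSpace V] [BorelSpace V] {Λ : Submodule ℤ V} {L : Submodule ℝ V}
  {κ : Type*} [Fintype κ] {B : Module.Basis κ ℝ V}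

theorem expGerm_mul_expGerm (x y : V) : expGerm x * expGerm y = expGerm (x + y) :=
  Germ.coe_eq.2 (Eventually.of_forall fun ξ => by
    change Complex.exp (ξ x) * Complex.exp (ξ y) = Complex.exp (ξ (x + y))
    rw [map_add, Complex.exp_add])

theorem S_eq_expGerm_mul_M (Λ : Submodule ℤ V) (L : Submodule ℝ V) (c : Set V) (s : V) :
    S Λ L c s = expGerm s * M Λ L c s := by
  have h0 : (expGerm (0 : V) : GermV V) = 1 :=
    Germ.coe_eq.2 (Eventually.of_forall fun ξ => by simp)
  rw [M, ← mul_assoc, expGerm_mul_expGerm, add_neg_cancel, h0, one_mul]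

/-- The coefficients of `fractVec` are the functions `s ↦ {⟨ψ, s⟩}` with `ψ` in `Ψ`, so a power of it
is a step-polynomial. -/
theorem fractVec_term_mem {c : Set V} (D : Decomposition Λ L c) (i : Fin D.n) (a : Fin (D.un i))
    (g : Fin (Module.finrank ℝ (V ⧸ L)) → V) {q : ℤ} {R : GermV V} (hR : R ∈ ratHom q) (r : ℕ) :
    (fun s => linGerm (fractVec (D.ugen i a) g s) ^ r * R) ∈
      tensorFun (stepPoly D.Psi r) (ratHom (q + r)) := by
  have h0 : (fun _ : V => R) ∈ tensorFun (stepPoly D.Psi ((0 : ℕ) : ℤ)) (ratHom q) :=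
    Submodule.subset_span ⟨1, one_mem_stepPoly _, R, hR, by funext s; simp⟩
  refine linGerm_pow_mul_mem_tensorFun (A := fun r : ℕ => stepPoly D.Psi r)
    (t := fun k s => Int.fract (-((D.ugen i a).repr (L.mkQ s) k))) (fun r k b hb => ?_) g h0 r
  push_cast
  exact fract_mul_mem_stepPoly (Ψ := D.Psi) (ψ := -(((D.ugen i a).coord k).comp L.mkQ)) ⟨i, a, k, rfl⟩ hb

/-- The homogeneous components of `M^L(s, c)`, from the expansions of the exponentials in the formula
for the simplicial cones of a decomposition; the lowest one is `I(c)`. -/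
theorem Decomposition.exists_hasComps_M [DiscreteTopology Λ] [IsZLattice ℝ Λ]
    (hB : Submodule.span ℤ (Set.range B) = Λ) (hL : IsRationalSubspace Λ L) {c : Set V}
    (hc : IsRationalCone Λ c) (D : Decomposition Λ L c) :
    ∃ A : V → ℕ → GermV V, (∀ s, HasComps (Module.finrank ℝ V) (M Λ L c s) (A s)) ∧
      (∀ n : ℕ, (fun s => A s n) ∈
        tensorFun (stepPoly D.Psi n) (ratHom ((n : ℤ) - Module.finrank ℝ V))) ∧
      ∀ s, A s 0 = I Λ c := by
  choose hrat g G A hform hA hcomps hA0 using D.exists_formula hB hL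
  set ε : ∀ i, Fin (D.un i) → ℂ := fun i a => ((D.sign i : ℤ) : ℂ) * ((D.usign i a : ℤ) : ℂ) with hε
  have hM : ∀ s, M Λ L c s =
      ∑ i, ∑ a, ε i a • (expGerm (fractVec (D.ugen i a) (g i a) s) * G i a) := by
    intro s
    obtain ⟨Φ, h1, h2⟩ := exists_linearMap_shift hB hL s
    rw [M, S, ← h1 c hc, h2 _ _ (D.ind_congr hB), map_sum, Finset.mul_sum]
    refine Finset.sum_congr rfl fun i _ => ?_
    rw [map_sum, Finset.mul_sum]
    refine Finset.sum_congr rfl fun a _ => ?_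
    rw [map_smul, h1 _ (hrat i a), hform, mul_smul_comm, ← mul_assoc, expGerm_mul_expGerm,
      neg_add_cancel_left]
  refine ⟨fun s n => ∑ i, ∑ a, ε i a • ∑ r ∈ Finset.range (n + 1),
    ((r.factorial : ℂ)⁻¹ • linGerm (fractVec (D.ugen i a) (g i a) s) ^ r) * A i a (n - r),
    fun s => ?_, fun n => ?_, fun s => ?_⟩
  · rw [hM]
    exact HasComps.sum _ fun i _ => HasComps.sum _ fun a _ =>
      ((hcomps i a).expGerm_mul _).smul (ε i a)
  · have hterm : ∀ i a, ∀ r ∈ Finset.range (n + 1),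
        (fun s => ((r.factorial : ℂ)⁻¹ • linGerm (fractVec (D.ugen i a) (g i a) s) ^ r) *
          A i a (n - r)) ∈ tensorFun (stepPoly D.Psi n) (ratHom ((n : ℤ) - Module.finrank ℝ V)) := by
      intro i a r hr
      have hrn : r ≤ n := Nat.lt_succ_iff.1 (Finset.mem_range.1 hr)
      have h1 := fractVec_term_mem D i a (g i a) (hA i a (n - r)) r
      have hdeg : ((n - r : ℕ) : ℤ) - Module.finrank ℝ V + r = n - Module.finrank ℝ V := by
        rw [Nat.cast_sub hrn]; ring
      rw [hdeg] at h1
      have h2 := Submodule.smul_mem _ ((r.factorial : ℂ)⁻¹)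
        (tensorFun_mono (stepPoly_mono D.Psi (Nat.cast_le.2 hrn)) _ h1)
      convert h2 using 1
      funext s
      rw [Pi.smul_apply, smul_mul_assoc]
    have := Submodule.sum_mem _ fun i (_ : i ∈ Finset.univ) => Submodule.sum_mem _
      fun a (_ : a ∈ Finset.univ) => Submodule.smul_mem _ (ε i a) (Submodule.sum_mem _ (hterm i a))
    convert this using 1
    funext s
    simp only [Finset.sum_apply, Pi.smul_apply]
  -- the lowest components add up by the valuation property of the continuous generating function
  · obtain ⟨Φ, h1, h2⟩ := exists_linearMap_shift hB (isRationalSubspace_top (Λ := Λ)) 0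
    have hI : ∀ k, IsRationalCone Λ k → Φ (ind k) = I Λ k := by
      intro k hk
      rw [h1 k hk, I]
      simp
    rw [← hI c hc, h2 _ _ (D.ind_congr hB), map_sum]
    refine Finset.sum_congr rfl fun i _ => ?_
    rw [map_sum]
    refine Finset.sum_congr rfl fun a _ => ?_
    rw [map_smul, hI _ (hrat i a), ← hA0]
    simp [hε]

/-- The components of `S^L(s + c)` come from the Cauchy product of the expansion of `M^L(s, c)` with the
exponential series of `⟨ξ, s⟩`. -/
theorem homComp_S_eq_sum {c : Set V} {s : V} {d : ℕ} {A : ℕ → GermV V}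
    (hA : HasComps d (M Λ L c s) A) (m : ℤ) :
    homComp m (S Λ L c s) = ∑ r ∈ Finset.range (m + d + 1).toNat,
      ((r.factorial : ℂ)⁻¹ • linGerm s ^ r) * homComp (m - r) (M Λ L c s) := by
  have hS := hA.expGerm_mul s
  rw [← S_eq_expGerm_mul_M] at hS
  rw [hS.homComp_eq]
  split_ifs with hm
  · obtain ⟨n, hn⟩ := Int.eq_ofNat_of_zero_le hm
    have h1 : (m + d + 1).toNat = n + 1 := by omega
    have h2 : (m + d).toNat = n := by omega
    rw [h1, h2]
    refine Finset.sum_congr rfl fun r hr => ?_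
    have hrn : r ≤ n := Nat.lt_succ_iff.1 (Finset.mem_range.1 hr)
    rw [hA.homComp_eq, if_pos (by omega)]
    congr 2
    omega
  · have h1 : (m + d + 1).toNat = 0 := by omega
    rw [h1, Finset.sum_range_zero]

/-- The coefficients of `⟨ξ, s⟩ ^ r` are homogeneous polynomials of degree `r` in `s`. -/
theorem linGerm_pow_mul_mem_quasiPoly {Ψ : Set (Module.Dual ℝ V)} {k q : ℤ} {F : V → GermV V}
    (hF : F ∈ tensorFun (stepPoly Ψ k) (ratHom q)) (r : ℕ) :
    (fun s => linGerm s ^ r * F s) ∈ tensorFun (quasiPoly Ψ (k + r)) (ratHom (q + r)) := by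
  let e := Module.finBasis ℝ V
  have h0 : F ∈ tensorFun (quasiPoly Ψ (k + (0 : ℕ))) (ratHom q) := by
    rw [Nat.cast_zero, add_zero]
    exact tensorFun_mono (stepPoly_le_quasiPoly Ψ k) _ hF
  have h1 := linGerm_pow_mul_mem_tensorFun (A := fun r : ℕ => quasiPoly Ψ (k + r))
    (t := fun j s => e.repr s j) (fun r j b hb => by
      rw [Nat.cast_succ, ← add_assoc]
      exact mul_mem_quasiPoly hb (e.coord j)) e h0 r
  simpa only [e.sum_repr] using h1

end Components

/-! ### The lowest component does not vanish -/

section NonZero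

variable {V : Type*} [NormedAddCommGroup V] [NormedSpace ℝ V] [FiniteDimensional ℝ V]
  [MeasurableSpace V] [BorelSpace V] {Λ : Submodule ℤ V}
  {κ : Type*} [Fintype κ] {B : Module.Basis κ ℝ V}

theorem exists_basis_mem {W : Type*} [AddCommGroup W] [Module ℝ W] [FiniteDimensional ℝ W] {c : Set W}
    (hspan : Submodule.span ℝ c = ⊤) :
    ∃ b : Module.Basis (Fin (Module.finrank ℝ W)) ℝ W, ∀ i, b i ∈ c := by
  let b := Module.Basis.ofSpan hspan.ge
  have hb : ∀ i, b i ∈ c := fun i => Module.Basis.ofSpan_subset hspan.ge ⟨i, rfl⟩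
  have := Module.Finite.finite_basis b
  have := Fintype.ofFinite ((linearIndepOn_empty ℝ (id : W → W)).extend (Set.empty_subset c))
  refine ⟨b.reindex (Fintype.equivFinOfCardEq (Module.finrank_eq_card_basis b).symm), fun i => ?_⟩
  rw [Module.Basis.reindex_apply]
  exact hb _

/-- A rational cone without lines lies in a simplicial cone. -/
theorem exists_subset_coneHull (hB : Submodule.span ℤ (Set.range B) = Λ) {c : Set V}
    (hc : IsRationalCone Λ c) (hline : ¬ ContainsLine c) :
    ∃ b : Module.Basis (Fin (Module.finrank ℝ (Module.Dual ℝ V))) ℝ V, c ⊆ coneHull b := by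
  obtain ⟨H, hfin, hH, rfl⟩ := hc
  have hspan : Submodule.span ℝ H = ⊤ := by
    by_contra hcon
    obtain ⟨φ, hφ, hker⟩ := Submodule.exists_le_ker_of_lt_top _ (lt_top_iff_ne_top.2 hcon)
    refine hline ⟨0, (Module.evalEquiv ℝ V).symm φ, by simpa using hφ, fun t η hη => ?_⟩
    have h0 : φ η = 0 := hker (Submodule.subset_span hη)
    have h1 : η ((Module.evalEquiv ℝ V).symm φ) = φ η := by simp
    rw [zero_add, map_smul, h1, h0, smul_zero]
  obtain ⟨θ, hθ⟩ := exists_basis_mem hspan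
  have hcard : Fintype.card (Fin (Module.finrank ℝ (Module.Dual ℝ V))) = Fintype.card κ := by
    rw [Fintype.card_fin, Subspace.dual_finrank_eq, Module.finrank_eq_card_basis B]
  obtain ⟨v, -, hneg, -, hrepr⟩ := exists_basis_of_linearIndependent_dual hB
    (fun i => hH _ (hθ i)) θ.linearIndependent hcard
  refine ⟨v, fun x hx => ?_⟩
  rw [← dualCone_eq_coneHull hneg hrepr]
  exact fun i => hx _ (hθ i)

theorem IsRationalCone.sum_smul_mem {c : Set V} (hc : IsRationalCone Λ c) {ι : Type*} (s : Finset ι)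
    {t : ι → ℝ} (ht : ∀ i ∈ s, 0 ≤ t i) {x : ι → V} (hx : ∀ i ∈ s, x i ∈ c) :
    ∑ i ∈ s, t i • x i ∈ c := by
  obtain ⟨H, -, -, rfl⟩ := hc
  intro η hη
  rw [map_sum]
  refine Finset.sum_nonpos fun i hi => ?_
  rw [map_smul]
  exact mul_nonpos_of_nonneg_of_nonpos (ht i hi) (hx i hi η hη)

theorem map_latticeMeasure_le (Λ : Submodule ℤ V) (L : Submodule ℝ V) :
    (latticeMeasure Λ L).map (fun u : L => (0 : V) + (u : V)) ≤ sliceMeasure Λ L := by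
  have h := Measure.le_sum (fun y : projectedLattice Λ L => (latticeMeasure Λ L).map (sliceMap L y))
    ⟨L.mkQ 0, 0, Λ.zero_mem, rfl⟩
  rwa [map_sliceMap (x := 0) rfl] at h

/-- A full-dimensional cone has positive volume, since it contains a parallelepiped. -/
theorem sliceMeasure_top_pos [DiscreteTopology Λ] [IsZLattice ℝ Λ] {c : Set V}
    (hc : IsRationalCone Λ c) (hfull : Submodule.span ℝ c = ⊤) :
    0 < sliceMeasure Λ ⊤ c := by
  classical
  obtain ⟨b', hb'c⟩ := exists_basis_mem hfull
  set b := topBasis b' with hb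
  obtain ⟨f₁, hf₁⟩ := exists_integral_basis (isRationalSubspace_top (Λ := Λ))
  let f₀ := f₁.reindex (Fintype.equivFinOfCardEq (Module.finrank_eq_card_basis b).symm).symm
  have hvol := latticeMeasure_unitBox (Λ := Λ) f₀ b (by rw [Module.Basis.range_reindex]; exact hf₁)
  have hpos : 0 < latticeMeasure Λ ⊤ (unitBox b) := by
    rw [pos_iff_ne_zero]
    intro h0
    rw [Measure.real, h0, ENNReal.toReal_zero, eq_comm, abs_eq_zero] at hvol
    exact (Module.Basis.isUnit_det f₀ b).ne_zero hvol
  have hsub : unitBox b ⊆ (fun u : (⊤ : Submodule ℝ V) => (0 : V) + (u : V)) ⁻¹' c := by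
    intro u hu
    change (0 : V) + (u : V) ∈ c
    rw [zero_add, ← b.sum_repr u, Submodule.coe_sum]
    exact hc.sum_smul_mem Finset.univ (fun i _ => (hu i).1) fun i _ => hb'c i
  refine (hpos.trans_le (measure_mono hsub)).trans_le ?_
  rw [← (measurableEmbedding_add_coe 0).map_apply]
  exact map_latticeMeasure_le Λ ⊤ c

/-- The continuous generating function of a cone without lines is not zero, since its values at suitable
real points are integrals of a positive function over a set of positive volume. -/
theorem I_ne_zero [DiscreteTopology Λ] [IsZLattice ℝ Λ] (hB : Submodule.span ℤ (Set.range B) = Λ)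
    {c : Set V} (hc : IsRationalCone Λ c) (hfull : Submodule.span ℝ c = ⊤)
    (hline : ¬ ContainsLine c) : I Λ c ≠ 0 := by
  intro hI
  have hV := isRationalSubspace_top (Λ := Λ)
  have hp : IsSemiRationalPolyhedron Λ c := by
    simpa using hc.isSemiRationalPolyhedron 0
  have hcm := hp.measurableSet
  obtain ⟨b, hb⟩ := exists_subset_coneHull hB hc hline
  have hev := eventually_eq_transform hB hV hp (F := fun _ => 0) hI.symm
  -- a real `η`, negative on the edges of a simplicial cone that contains `c`, at which `I(c)` is zero
  obtain ⟨ξ, ⟨η, hη, hneg⟩, hξ⟩ := ((frequently_generic_neg b).and_eventually hev).exists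
  have hinv : ∀ j, (sliceMeasure Λ ⊤).map (fun x => x + b j) = sliceMeasure Λ ⊤ := fun j =>
    map_add_sliceMeasure hB hV (by
      have h0 : (⊤ : Submodule ℝ V).mkQ (b j) = 0 := by simp
      rw [h0]
      exact Submodule.zero_mem _)
  have hint := integrable_ind_partBox_mul_exp b 0 (sliceMeasure_closedBall_lt_top hB hV) hinv
    (ξ := ξ) (fun j => by rw [hη, cplx_apply, Complex.ofReal_re]; exact hneg j)
  have hval : ∀ x, ξ x = ((η x : ℝ) : ℂ) := fun x => by rw [hη, cplx_apply]
  have hcone : partBox b 0 ∅ = coneHull b := by rw [partBox_empty]; simp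
  have hmeas := measurableSet_partBox b 0 ∅
  rw [hcone] at hint hmeas
  rw [ind_mul_exp hval, integrable_indicator_iff hmeas] at hint
  have hintc : IntegrableOn (fun x => ((Real.exp (η x) : ℝ) : ℂ)) c (sliceMeasure Λ ⊤) :=
    hint.mono_set hb
  have hre : IntegrableOn (fun x => Real.exp (η x)) c (sliceMeasure Λ ⊤) := hintc.re
  have h0 := hξ η hη (by rw [ind_mul_exp hval, integrable_indicator_iff hcm]; exact hintc)
  rw [transform, ind_mul_exp hval, integral_indicator hcm] at h0
  have h1 : ∫ x in c, Real.exp (η x) ∂(sliceMeasure Λ ⊤) = 0 := by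
    have h2 : ((∫ x in c, Real.exp (η x) ∂(sliceMeasure Λ ⊤) : ℝ) : ℂ) = 0 :=
      integral_ofReal.symm.trans h0.symm
    exact_mod_cast h2
  have hpos : 0 < ∫ x in c, Real.exp (η x) ∂(sliceMeasure Λ ⊤) := by
    rw [setIntegral_pos_iff_support_of_nonneg_ae (Eventually.of_forall fun x => (Real.exp_pos _).le)
      hre]
    have : Function.support (fun x => Real.exp (η x)) = Set.univ :=
      Set.eq_univ_of_forall fun x => (Real.exp_pos _).ne'
    rw [this, Set.univ_inter]
    exact sliceMeasure_top_pos hc hfull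
  exact hpos.ne' h1

end NonZero

end ConeGF

end

theorem mainTheorem3 {V : Type*} [NormedAddCommGroup V] [NormedSpace ℝ V] [FiniteDimensional ℝ V]
    [MeasurableSpace V] [BorelSpace V]
    (Λ : Submodule ℤ V) [DiscreteTopology Λ] [IsZLattice ℝ Λ]
    (L : Submodule ℝ V) (hL : ConeGF.IsRationalSubspace Λ L)
    (c : Set V) (hc : ConeGF.IsRationalCone Λ c) (hfull : Submodule.span ℝ c = ⊤)
    (d : ℕ) (hd : d = Module.finrank ℝ V) :
    Nonempty (ConeGF.Decomposition Λ L c) ∧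
    (∀ (D : ConeGF.Decomposition Λ L c) (m : ℤ),
      (fun s => ConeGF.homComp m (ConeGF.M Λ L c s)) ∈
        ConeGF.tensorFun (ConeGF.stepPoly D.Psi (m + d)) (ConeGF.ratHom m) ∧
      (fun s => ConeGF.homComp m (ConeGF.S Λ L c s)) ∈
        ConeGF.tensorFun (ConeGF.quasiPoly D.Psi (m + d)) (ConeGF.ratHom m)) ∧
    (∀ (m : ℤ) (s : V),
      ConeGF.homComp m (ConeGF.S Λ L c s) =
        ∑ r ∈ Finset.range (m + d + 1).toNat,
          ((r.factorial : ℂ)⁻¹ • ConeGF.linGerm s ^ r) *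
            ConeGF.homComp (m - r) (ConeGF.M Λ L c s)) ∧
    (∀ m : ℤ, m < -(d : ℤ) → ∀ s : V,
      ConeGF.homComp m (ConeGF.S Λ L c s) = 0 ∧ ConeGF.homComp m (ConeGF.M Λ L c s) = 0) ∧
    (∀ s : V,
      ConeGF.homComp (-(d : ℤ)) (ConeGF.S Λ L c s) = ConeGF.I Λ c ∧
      ConeGF.homComp (-(d : ℤ)) (ConeGF.M Λ L c s) = ConeGF.I Λ c) ∧
    (¬ ConeGF.ContainsLine c → ConeGF.I Λ c ≠ 0) := by
  subst hd
  have : Module.Finite ℤ Λ := ZLattice.module_finite ℝ Λ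
  have : Module.Free ℤ Λ := ZLattice.module_free ℝ Λ
  have hB := (Module.Free.chooseBasis ℤ Λ).ofZLatticeBasis_span ℝ
  obtain ⟨D₀⟩ := ConeGF.nonempty_decomposition hB hL hc
  obtain ⟨A₀, hA₀, -, hI⟩ := D₀.exists_hasComps_M hB hL hc
  refine ⟨⟨D₀⟩, fun D m => ?_, fun m s => ConeGF.homComp_S_eq_sum (hA₀ s) m, fun m hm s => ?_,
    fun s => ?_, fun hline => ConeGF.I_ne_zero hB hc hfull hline⟩
  · obtain ⟨A, hA, hmem, -⟩ := D.exists_hasComps_M hB hL hc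
    have hM : ∀ m : ℤ, (fun s => ConeGF.homComp m (ConeGF.M Λ L c s)) ∈
        ConeGF.tensorFun (ConeGF.stepPoly D.Psi (m + Module.finrank ℝ V)) (ConeGF.ratHom m) := by
      intro m
      by_cases hm : 0 ≤ m + Module.finrank ℝ V
      · have h1 := hmem (m + Module.finrank ℝ V).toNat
        rw [Int.toNat_of_nonneg hm, add_sub_cancel_right] at h1
        simpa only [(hA _).homComp_eq, if_pos hm] using h1
      · simp only [(hA _).homComp_eq, if_neg hm]
        exact Submodule.zero_mem _
    refine ⟨hM m, ?_⟩
    simp only [ConeGF.homComp_S_eq_sum (hA _)]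
    have hterm : ∀ r ∈ Finset.range (m + Module.finrank ℝ V + 1).toNat, (fun s =>
        ((r.factorial : ℂ)⁻¹ • ConeGF.linGerm s ^ r) * ConeGF.homComp (m - r) (ConeGF.M Λ L c s)) ∈
          ConeGF.tensorFun (ConeGF.quasiPoly D.Psi (m + Module.finrank ℝ V)) (ConeGF.ratHom m) := by
      intro r _
      have h1 := ConeGF.linGerm_pow_mul_mem_quasiPoly (hM (m - r)) r
      have h2 : m - r + Module.finrank ℝ V + r = m + Module.finrank ℝ V := by ring
      rw [h2, sub_add_cancel] at h1
      convert Submodule.smul_mem _ ((r.factorial : ℂ)⁻¹) h1 using 1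
      funext s
      rw [Pi.smul_apply, smul_mul_assoc]
    convert Submodule.sum_mem _ hterm using 1
    funext s
    rw [Finset.sum_apply]
  · have h1 : ¬ 0 ≤ m + (Module.finrank ℝ V : ℤ) := by omega
    refine ⟨?_, by rw [(hA₀ s).homComp_eq, if_neg h1]⟩
    have h2 : (m + (Module.finrank ℝ V : ℤ) + 1).toNat = 0 := by omega
    rw [ConeGF.homComp_S_eq_sum (hA₀ s), h2, Finset.sum_range_zero]
  · have h1 : ConeGF.homComp (-(Module.finrank ℝ V : ℤ)) (ConeGF.M Λ L c s) = ConeGF.I Λ c := by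
      rw [(hA₀ s).homComp_eq, if_pos (by omega), ← hI s]
      simp
    refine ⟨?_, h1⟩
    have h2 : (-(Module.finrank ℝ V : ℤ) + Module.finrank ℝ V + 1).toNat = 1 := by omega
    rw [ConeGF.homComp_S_eq_sum (hA₀ s), h2, Finset.sum_range_one]
    simp only [Nat.factorial_zero, Nat.cast_one, inv_one, pow_zero, one_smul, one_mul, Nat.cast_zero,
      sub_zero, h1]
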